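/- **Conventions.** For a random vector $Z$ in a normed space $E$ and $\alpha:\mathbb R_+\to\mathbb R_+$, write $Z\propto_c\alpha$ if for every $1$-Lipschitz quasiconvex $f:E\to\mathbb R$ and every independent copy $Z'$ of $Z$, $\mathbb P(|f(Z)-f(Z')|\ge t)\le\alpha(t)$ for all $t>0$. For a real random variable $Y$ and $a\in\mathbb R$, write $Y\in a\pm\alpha$ if $\mathbb P(|Y-a|\ge t)\le\alpha(t)$ for all $t>0$. **Setting.** Let $q>0$, $C_0\ge e$, $c_0>0$, $z_0>0$, $M,\Gamma\in\mathbb R$ and $K\in\mathbb N$. Let $p,n\ge1$ with $\frac pn+1\le\Gamma$, let $k\le K$, and let $\mu_1,\dots,\mu_k$ be probability laws on $\mathbb R^p$ such that 1. for every $l$, every $m\in\mathbb N$ and independent $y_1,\dots,y_m\sim\mu_l$, $(y_1,\dots,y_m)\propto_c C_0e^{-(\,\cdot\,)^q/c_0}$ in the space $\mathcal M_{p,m}$ of real $p\times m$ matrices with the Frobenius norm; 2. with $y_l\sim\mu_l$, either $\mathbb E\|y_l\|\le M\sqrt p$ for all $l$, or $q\ge2$ and $\|\mathbb E y_l\|\le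 M\sqrt p$ for all $l$. Let $x_1,\dots,x_n$ be independent random vectors, each following one of the laws $\mu_l$ (its class), and let $n_l$ be the number of $x_i$ in class $l$. Put $X=[x_1,\dots,x_n]$, $S=XX^T/n$, $Q(z)=(S+zI_p)^{-1}$; let $F=\frac1p\sum_{i=1}^p\delta_{\lambda_i}$ be the empirical distribution of the eigenvalues $\lambda_i$ of $S$, and $m_F(-z)=\int\frac{dF(w)}{w+z}$. Let $\Sigma_l=\mathbb E[y_ly_l^T]$ (non-centred) and, for $\delta\in\mathbb R_+^k$, $$\tilde Q_\delta(z)=\Big(\sum_{l=1}^k\frac{n_l}{n}\frac{\Sigma_l}{1+\delta_l}+zI_p\Big)^{-1}.$$ **Statement.** There are constants $C\ge e$, $c>0$ and $N\in\mathbb N$, depending only on $q,C_0,c_0,z_0,M,\Gamma,K$, such that in the above setting, whenever $n\ge N$ and $z\ge z_0$: * the system $\delta'_l=\frac1n\operatorname{tr}\big(\Sigma_l\tilde Q_{\delta'}(z)\big)$, $1\le l\le k$, has a unique solution $\delta'$ in $\mathbb R_+^k$; * $m_F(-z)=\frac1p\operatorname{tr}Q(z)$, and $$m_F(-z)\in\frac1p\operatorname{tr}\tilde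 Q_{\delta'}(z)\pm Ce^{-(\sqrt n\,\cdot\,)^q/c},$$ that is, $\mathbb P\big(|m_F(-z)-\frac1p\operatorname{tr}\tilde Q_{\delta'}(z)|\ge t\big)\le Ce^{-(\sqrt n\,t)^q/c}$ for all $t>0$; * for given $p,n,z$, the matrix $\tilde Q_{\delta'}(z)$ depends only on the means $\mathbb E y_l$, the (centred) covariance matrices of the $\mu_l$ and the proportions $n_l/n$: it is the same for any two settings as above in which these agree. -/

import Mathlib

open MeasureTheory ProbabilityTheory

namespace ConcentratedCovariance

noncomputable section

/-! ### Concentration of random variables and random vectors -/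

/-- `Z ∝ α`: two independent copies of the random variable `Z` satisfy
`ℙ(|Z - Z'| ≥ t) ≤ α(t)` for all `t > 0`. The pair of independent copies is realised on
the product space. -/
def SelfConcentrated {Ω : Type*} [MeasurableSpace Ω] (P : Measure Ω) (Z : Ω → ℝ)
    (α : ℝ → ℝ) : Prop :=
  ∀ t : ℝ, 0 < t →
    (P.prod P) {w : Ω × Ω | t ≤ |Z w.1 - Z w.2|} ≤ ENNReal.ofReal (α t)

/-- `Z ∈ a ± α`: concentration of the random variable `Z` around the pivot `a`. -/
def ConcentratedAround {Ω : Type*} [MeasurableSpace Ω] (P : Measure Ω) (Z : Ω → ℝ)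
    (a : ℝ) (α : ℝ → ℝ) : Prop :=
  ∀ t : ℝ, 0 < t → P {ω | t ≤ |Z ω - a|} ≤ ENNReal.ofReal (α t)

/-- `Z ∝_c α` in the normed space `E`: `f(Z) ∝ α` for every `1`-Lipschitz quasiconvex
`f : E → ℝ`. -/
def ConvexlyConcentrated {Ω : Type*} [MeasurableSpace Ω] {E : Type*}
    [NormedAddCommGroup E] [NormedSpace ℝ E] (P : Measure Ω) (Z : Ω → E)
    (α : ℝ → ℝ) : Prop :=
  ∀ f : E → ℝ, LipschitzWith 1 f → QuasiconvexOn ℝ Set.univ f →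
    SelfConcentrated P (fun ω => f (Z ω)) α

/-- The matrix `[y₁, …, y_m]` whose columns are the vectors `y₁, …, y_m ∈ ℝ^p`. -/
def ofColumns {p m : ℕ} (y : Fin m → EuclideanSpace ℝ (Fin p)) :
    Matrix (Fin p) (Fin m) ℝ :=
  Matrix.of fun i j => y j i

section Frobenius

attribute [local instance] Matrix.frobeniusNormedAddCommGroup Matrix.frobeniusNormedSpace

/-- Concentration assumption on the class laws: for every class `l` and every `m`, the
matrix of `m` independent columns of law `μ l` is convexly concentrated, with concentration
function `t ↦ C₀ exp (-t^q / c₀)`, in the space of `p × m` matrices with the Frobenius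
norm. The independent columns are the coordinates of the product space. -/
def ClassConcentration {p k : ℕ} (q C₀ c₀ : ℝ)
    (μ : Fin k → Measure (EuclideanSpace ℝ (Fin p))) : Prop :=
  ∀ (l : Fin k) (m : ℕ),
    ConvexlyConcentrated (Measure.pi fun _ : Fin m => μ l)
      (ofColumns : (Fin m → EuclideanSpace ℝ (Fin p)) → Matrix (Fin p) (Fin m) ℝ)
      (fun t => C₀ * Real.exp (-(t ^ q / c₀)))

end Frobenius

/-- Size assumption on the class laws: either `𝔼‖y_l‖ / √p ≤ M` for all `l`, or `q ≥ 2` and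
`‖𝔼 y_l‖ / √p ≤ M` for all `l`. -/
def ClassSizeBound {p k : ℕ} (q M : ℝ)
    (μ : Fin k → Measure (EuclideanSpace ℝ (Fin p))) : Prop :=
  (∀ l, (∫ y, ‖y‖ ∂(μ l)) / Real.sqrt p ≤ M) ∨
    (2 ≤ q ∧ ∀ l, ‖∫ y, y ∂(μ l)‖ / Real.sqrt p ≤ M)

/-! ### Sample covariance, spectral distribution, Stieltjes transform -/

/-- The sample covariance matrix `S = X Xᵀ / n`. -/
def sampleCov {p n : ℕ} (X : Matrix (Fin p) (Fin n) ℝ) : Matrix (Fin p) (Fin p) ℝ :=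
  (1 / (n : ℝ)) • (X * X.transpose)

theorem sampleCov_isHermitian {p n : ℕ} (X : Matrix (Fin p) (Fin n) ℝ) :
    (sampleCov X).IsHermitian := by
  ext i j
  simp [sampleCov, Matrix.mul_apply, Matrix.conjTranspose_apply, mul_comm]

/-- The spectral distribution `F = (1/p) ∑ᵢ δ_{λᵢ}` of a symmetric matrix with eigenvalues
`λ₁, …, λ_p` (counted with multiplicity). -/
def spectralDistribution {p : ℕ} {S : Matrix (Fin p) (Fin p) ℝ} (hS : S.IsHermitian) :
    Measure ℝ :=
  ENNReal.ofReal (1 / (p : ℝ)) • ∑ i, Measure.dirac (hS.eigenvalues i)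

/-- The Stieltjes transform `m_F(z) = ∫ 1 / (w - z) dF(w)` at a real point `z`. -/
def stieltjes (F : Measure ℝ) (z : ℝ) : ℝ := ∫ w, 1 / (w - z) ∂F

/-- The resolvent `Q_A(z) = (A + z I)⁻¹`. -/
def resolventAt {p : ℕ} (A : Matrix (Fin p) (Fin p) ℝ) (z : ℝ) :
    Matrix (Fin p) (Fin p) ℝ :=
  (A + z • (1 : Matrix (Fin p) (Fin p) ℝ))⁻¹

/-! ### The deterministic equivalent -/

/-- The proportion `n_l / n` of the class `l`, where `κ i` is the class of the `i`-th
sample. -/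
def proportion {n k : ℕ} (κ : Fin n → Fin k) (l : Fin k) : ℝ :=
  ((Finset.univ.filter fun i => κ i = l).card : ℝ) / n

/-- The (non-centred) population covariance `Σ = 𝔼[y yᵀ]` of a law on `ℝ^p`. -/
def populationCov {p : ℕ} (μ : Measure (EuclideanSpace ℝ (Fin p))) :
    Matrix (Fin p) (Fin p) ℝ :=
  Matrix.of fun i j => ∫ y, y i * y j ∂μ

/-- The centred covariance matrix `𝔼[(y - 𝔼y)(y - 𝔼y)ᵀ]` of a law on `ℝ^p`. -/
def centredCov {p : ℕ} (μ : Measure (EuclideanSpace ℝ (Fin p))) :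
    Matrix (Fin p) (Fin p) ℝ :=
  Matrix.of fun i j => covariance (fun y : EuclideanSpace ℝ (Fin p) => y i) (fun y => y j) μ

/-- `Q̃_δ(z) = (Σ_δ + z I)⁻¹` with `Σ_δ = ∑_l (n_l / n) Σ_l / (1 + δ_l)`; here `w l` stands
for `n_l / n` and `S l` for `Σ_l`. -/
def QTilde {p k : ℕ} (w : Fin k → ℝ) (S : Fin k → Matrix (Fin p) (Fin p) ℝ) (z : ℝ)
    (δ : Fin k → ℝ) : Matrix (Fin p) (Fin p) ℝ :=
  resolventAt (∑ l, (w l / (1 + δ l)) • S l) z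

/-- `δ ∈ ℝ₊^k` solves `δ_l = (1/n) tr (Σ_l Q̃_δ(z))` for all `l`. -/
def SolvesFixedPoint {p k : ℕ} (n : ℕ) (w : Fin k → ℝ)
    (S : Fin k → Matrix (Fin p) (Fin p) ℝ) (z : ℝ) (δ : Fin k → ℝ) : Prop :=
  (∀ l, 0 ≤ δ l) ∧ ∀ l, δ l = 1 / (n : ℝ) * (S l * QTilde w S z δ).trace

end

end ConcentratedCovariance

open ConcentratedCovariance

/-! Write `Q` for the resolvent of the sample covariance at `-z`. The normalised trace of `Q`
fluctuates on the scale `1/√n`, and its mean is within `O(1/√n)` of the normalised trace of the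
deterministic equivalent. These two facts are proved separately and joined at the end.

Fluctuations. The trace of `Q` is not quasiconvex in the data, but it is a difference of two convex
functions. It equals the sum of `σ⁻²` over the singular values `σ ≥ √z` of the stacked map `u ↦
(Xᵀu/√n, √z u)`. On `[√z, ∞)` both `σ⁻² + κσ` and `κσ` are convex and nondecreasing once `κ =
2/√z³`, and the sum over singular values of such a function is convex and Lipschitz in the matrix
(`sum_tangent_le_sum_singularValues`, `exists_trace_resolventAt_gram_eq_sub`). Each class is a
concentrated block of columns. Exchanging the at most `K` blocks one at a time gives concentration
for independent copies (`ClassConcentration.selfConcentrated_trace`). A second moment bound around a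
pivot then turns this into concentration around that pivot (`SelfConcentrated.concentratedAround`).

The fixed point. Contraction holds for the weighted distance `|δ - ε| / √((1+δ)(1+ε))`. By
Cauchy–Schwarz for the trace and the identity `Σ_δ Q̃_δ = 1 - z Q̃_δ`, one application of the map
changes coordinate `l` by at most `√(F(δ)_l F(ε)_l)` times the largest weighted distance. The new
weight makes the factor smaller than `1` (`abs_fpMap_sub_le`). This gives existence and uniqueness.
The same computation in a weighted `ℓ¹` norm gives stability under approximate solutions
(`sum_fpWeight_mul_abs_sub_le`).

The mean. Removing sample `i` from the resolvent gives `Q x_i = Q₋ᵢ x_i / (1 + Δ_i)`, where `Δ_i` is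
the leave-one-out quadratic form, and `x_i` is independent of `Q₋ᵢ`. If `Δ_i` is close in mean
square to `δ_l` for the class `l` of `x_i`, then `Q` is close to `Q̃_δ` in mean trace
(`abs_integral_trace_mul_sub_QTilde_le`). When the covariances are bounded, `δ_l = 𝔼 tr(Σ_l Q)/n` is
such a value. Testing against `Σ_l` shows that this `δ` almost solves the system, and stability
brings it close to the true solution.

The class means may have norm of order `√p`, so the non-centred covariances need not be bounded. Two
regimes deal with this, with target `O(p/√n)` for the unnormalised trace. If `p ≤ √n`, the forms
`Δ_i` and `δ_l` are so small that crude bounds suffice. If `p ≥ √n`, an error `O(1)` is allowed: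
centring changes the matrices by rank `O(k)`, hence the traces by `O(k/z)`, and the solution of the
original system is an approximate solution of the centred one (`SolvesFixedPoint.centred_bounds`).
-/

namespace ConcentratedCovariance

/-! ### Quadratic forms, rank one matrices and trace inequalities -/

section LinearAlgebra

open Matrix
open scoped Matrix.Norms.L2Operator

variable {p : ℕ}

/-- The bilinear form `uᵀ A v`. -/
noncomputable def bilin (A : Matrix (Fin p) (Fin p) ℝ) (u v : EuclideanSpace ℝ (Fin p)) : ℝ :=
  u.ofLp ⬝ᵥ (A *ᵥ v.ofLp)

/-- The rank one matrix `v vᵀ`. -/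
noncomputable def outer (v : EuclideanSpace ℝ (Fin p)) : Matrix (Fin p) (Fin p) ℝ :=
  vecMulVec v.ofLp v.ofLp

theorem bilin_eq_inner (A : Matrix (Fin p) (Fin p) ℝ) (u v : EuclideanSpace ℝ (Fin p)) :
    bilin A u v = inner ℝ u (WithLp.toLp 2 (A *ᵥ v.ofLp)) := by
  rw [EuclideanSpace.inner_eq_star_dotProduct]
  simp [bilin, dotProduct_comm]

theorem norm_mulVec_le (A : Matrix (Fin p) (Fin p) ℝ) (v : EuclideanSpace ℝ (Fin p)) :
    ‖WithLp.toLp 2 (A *ᵥ v.ofLp)‖ ≤ ‖A‖ * ‖v‖ :=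
  l2_opNorm_mulVec A v

theorem abs_bilin_le (A : Matrix (Fin p) (Fin p) ℝ) (u v : EuclideanSpace ℝ (Fin p)) :
    |bilin A u v| ≤ ‖A‖ * (‖u‖ * ‖v‖) := by
  rw [bilin_eq_inner]
  refine (abs_real_inner_le_norm _ _).trans ?_
  have := mul_le_mul_of_nonneg_left (norm_mulVec_le A v) (norm_nonneg u)
  linarith

theorem l2_opNorm_le_of_forall {A : Matrix (Fin p) (Fin p) ℝ} {c : ℝ} (hc : 0 ≤ c)
    (h : ∀ v : EuclideanSpace ℝ (Fin p), ‖WithLp.toLp 2 (A *ᵥ v.ofLp)‖ ≤ c * ‖v‖) : ‖A‖ ≤ c := by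
  rw [← l2_opNorm_toEuclideanCLM]
  exact ContinuousLinearMap.opNorm_le_bound _ hc h

theorem trace_mul_outer (A : Matrix (Fin p) (Fin p) ℝ) (v : EuclideanSpace ℝ (Fin p)) :
    (A * outer v).trace = bilin A v v := by
  rw [outer, mul_vecMulVec, trace_vecMulVec, bilin, dotProduct_comm]

theorem trace_outer (v : EuclideanSpace ℝ (Fin p)) : (outer v).trace = ‖v‖ ^ 2 := by
  rw [outer, trace_vecMulVec, EuclideanSpace.real_norm_sq_eq]
  simp [dotProduct, sq]

theorem outer_posSemidef (v : EuclideanSpace ℝ (Fin p)) : (outer v).PosSemidef := by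
  simpa [outer] using posSemidef_vecMulVec_self_star v.ofLp

theorem norm_outer_le (v : EuclideanSpace ℝ (Fin p)) : ‖outer v‖ ≤ ‖v‖ ^ 2 := by
  refine l2_opNorm_le_of_forall (by positivity) fun w => ?_
  rw [outer, vecMulVec_mulVec]
  have : (WithLp.toLp 2 (MulOpposite.op (v.ofLp ⬝ᵥ w.ofLp) • v.ofLp) : EuclideanSpace ℝ (Fin p))
      = (inner ℝ v w) • v := by
    rw [EuclideanSpace.inner_eq_star_dotProduct]
    ext i
    simp [mul_comm, dotProduct_comm]
  rw [this, norm_smul, Real.norm_eq_abs]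
  have := mul_le_mul_of_nonneg_right (abs_real_inner_le_norm v w) (norm_nonneg v)
  nlinarith

theorem posSemidef_exists_outer {D : Matrix (Fin p) (Fin p) ℝ} (hD : D.PosSemidef) :
    ∃ (m : ℕ) (v : Fin m → EuclideanSpace ℝ (Fin p)), D = ∑ i, outer (v i) := by
  obtain ⟨m, v, h⟩ := posSemidef_iff_eq_sum_vecMulVec.mp hD
  exact ⟨m, fun i => WithLp.toLp 2 (v i), by simpa [outer] using h⟩

/-- Duality between the operator norm and the trace norm, read off a decomposition of `D` into rank
one pieces. It yields dimension-free bounds whenever `D` is a difference of resolvents with bounded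
trace. -/
theorem abs_trace_mul_le (A : Matrix (Fin p) (Fin p) ℝ) {D : Matrix (Fin p) (Fin p) ℝ}
    (hD : D.PosSemidef) : |(A * D).trace| ≤ ‖A‖ * D.trace := by
  obtain ⟨m, v, rfl⟩ := posSemidef_exists_outer hD
  rw [Finset.mul_sum, trace_sum, trace_sum, Finset.mul_sum]
  refine (Finset.abs_sum_le_sum_abs _ _).trans (Finset.sum_le_sum fun i _ => ?_)
  rw [trace_mul_outer, trace_outer, sq]
  exact abs_bilin_le _ _ _

theorem trace_mul_nonneg {A D : Matrix (Fin p) (Fin p) ℝ} (hA : A.PosSemidef)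
    (hD : D.PosSemidef) : 0 ≤ (A * D).trace := by
  obtain ⟨m, v, rfl⟩ := posSemidef_exists_outer hD
  rw [Finset.mul_sum, trace_sum]
  refine Finset.sum_nonneg fun i _ => ?_
  rw [trace_mul_outer]
  simpa [bilin] using hA.dotProduct_mulVec_nonneg (v i).ofLp

theorem bilin_self_nonneg {A : Matrix (Fin p) (Fin p) ℝ} (hA : A.PosSemidef)
    (v : EuclideanSpace ℝ (Fin p)) : 0 ≤ bilin A v v := by
  simpa [bilin] using hA.dotProduct_mulVec_nonneg v.ofLp

theorem norm_le_trace {D : Matrix (Fin p) (Fin p) ℝ} (hD : D.PosSemidef) : ‖D‖ ≤ D.trace := by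
  obtain ⟨m, v, rfl⟩ := posSemidef_exists_outer hD
  rw [trace_sum]
  refine (norm_sum_le _ _).trans (Finset.sum_le_sum fun i _ => ?_)
  rw [trace_outer]
  exact norm_outer_le _

theorem bilin_comm {A : Matrix (Fin p) (Fin p) ℝ} (hA : A.IsHermitian)
    (u v : EuclideanSpace ℝ (Fin p)) : bilin A u v = bilin A v u := by
  have : Aᵀ = A := (by simpa using hA : A.IsSymm)
  rw [bilin, bilin, dotProduct_mulVec, ← mulVec_transpose, this, dotProduct_comm]

/-- Cauchy–Schwarz for the trace form `(X, Y) ↦ tr (A X B Y)`. -/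
theorem abs_trace_mul_mul_mul_le {A B X Y : Matrix (Fin p) (Fin p) ℝ} (hA : A.PosSemidef)
    (hB : B.PosSemidef) (hX : X.IsHermitian) (hY : Y.IsHermitian) :
    |(A * X * B * Y).trace| ≤
      √((A * X * B * X).trace) * √((A * Y * B * Y).trace) := by
  obtain ⟨m, v, rfl⟩ := posSemidef_exists_outer hA
  obtain ⟨k, w, rfl⟩ := posSemidef_exists_outer hB
  -- With `A = ∑ vᵢvᵢᵀ` and `B = ∑ wⱼwⱼᵀ`, the trace becomes a scalar product of the families
  -- `vᵢᵀXwⱼ` and `vᵢᵀYwⱼ` indexed by pairs, to which the usual Cauchy–Schwarz inequality applies.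
  have key : ∀ X Y : Matrix (Fin p) (Fin p) ℝ, X.IsHermitian → Y.IsHermitian →
      ((∑ i, outer (v i)) * X * (∑ j, outer (w j)) * Y).trace
        = ∑ ij ∈ Finset.univ ×ˢ Finset.univ,
          bilin X (v ij.1) (w ij.2) * bilin Y (v ij.1) (w ij.2) := by
    intro X Y hX hY
    rw [Finset.sum_product]
    simp_rw [Finset.sum_mul, Finset.mul_sum, Finset.sum_mul, trace_sum]
    refine Finset.sum_congr rfl fun i _ => Finset.sum_congr rfl fun j _ => ?_
    rw [outer, outer, vecMulVec_mul, vecMulVec_mul_vecMulVec, vecMulVec_smul, smul_mul,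
      vecMulVec_mul, trace_smul, trace_vecMulVec, bilin_comm hY, bilin, bilin, dotProduct_mulVec,
      dotProduct_mulVec, smul_eq_mul, dotProduct_comm (v i).ofLp]
  rw [key X Y hX hY, key X X hX hX, key Y Y hY hY]
  have h := Finset.sum_mul_sq_le_sq_mul_sq (Finset.univ ×ˢ Finset.univ)
    (fun ij : Fin m × Fin k => bilin X (v ij.1) (w ij.2)) (fun ij => bilin Y (v ij.1) (w ij.2))
  rw [← Real.sqrt_mul (Finset.sum_nonneg fun _ _ => mul_self_nonneg _)]
  refine Real.abs_le_sqrt ?_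
  simpa [sq] using h

theorem trace_mul_mul_mul_self_nonneg {A B X : Matrix (Fin p) (Fin p) ℝ} (hA : A.PosSemidef)
    (hB : B.PosSemidef) (hX : X.IsHermitian) : 0 ≤ (A * X * B * X).trace := by
  have h : (X * B * X).PosSemidef := by
    have := hB.mul_mul_conjTranspose_same X
    rwa [hX.eq] at this
  have := trace_mul_nonneg hA h
  simpa [Matrix.mul_assoc] using this

end LinearAlgebra

/-! ### Resolvents of positive semidefinite matrices and rank one updates -/

section Resolvent

open Matrix
open scoped Matrix.Norms.L2Operator

variable {p : ℕ} {A B : Matrix (Fin p) (Fin p) ℝ} {z : ℝ}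

theorem posDef_add_smul_one (hA : A.PosSemidef) (hz : 0 < z) :
    (A + z • (1 : Matrix (Fin p) (Fin p) ℝ)).PosDef :=
  PosDef.posSemidef_add hA (PosDef.one.smul hz)

theorem add_smul_one_mul_resolventAt (hA : A.PosSemidef) (hz : 0 < z) :
    (A + z • (1 : Matrix (Fin p) (Fin p) ℝ)) * resolventAt A z = 1 :=
  mul_nonsing_inv _ ((isUnit_iff_isUnit_det _).mp (posDef_add_smul_one hA hz).isUnit)

theorem resolventAt_mul_add_smul_one (hA : A.PosSemidef) (hz : 0 < z) :
    resolventAt A z * (A + z • (1 : Matrix (Fin p) (Fin p) ℝ)) = 1 :=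
  nonsing_inv_mul _ ((isUnit_iff_isUnit_det _).mp (posDef_add_smul_one hA hz).isUnit)

theorem resolventAt_posDef (hA : A.PosSemidef) (hz : 0 < z) : (resolventAt A z).PosDef :=
  (posDef_add_smul_one hA hz).inv

theorem resolventAt_posSemidef (hA : A.PosSemidef) (hz : 0 < z) :
    (resolventAt A z).PosSemidef :=
  (resolventAt_posDef hA hz).posSemidef

theorem resolventAt_isHermitian (hA : A.PosSemidef) (hz : 0 < z) :
    (resolventAt A z).IsHermitian :=
  (resolventAt_posDef hA hz).isHermitian

theorem resolventAt_sub (hA : A.PosSemidef) (hB : B.PosSemidef) (hz : 0 < z) :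
    resolventAt A z - resolventAt B z = resolventAt A z * (B - A) * resolventAt B z := by
  have h1 := resolventAt_mul_add_smul_one hA hz
  have h2 := add_smul_one_mul_resolventAt hB hz
  have : B - A = (B + z • (1 : Matrix (Fin p) (Fin p) ℝ)) - (A + z • 1) := by abel
  rw [this, Matrix.mul_sub, Matrix.sub_mul, Matrix.mul_assoc, h2, h1]
  simp

/-- Putting `y = Qv`, so that `v = (A + z)y`, gives `vᵀQv = yᵀAy + z‖y‖²`. This one inequality gives
both the bound `‖Q‖ ≤ 1/z` and the trace bound for rank one updates. -/
theorem sq_norm_resolventAt_mulVec_le (hA : A.PosSemidef) (hz : 0 < z)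
    (v : EuclideanSpace ℝ (Fin p)) :
    z * ‖WithLp.toLp 2 (resolventAt A z *ᵥ v.ofLp)‖ ^ 2 ≤ bilin (resolventAt A z) v v := by
  set y : EuclideanSpace ℝ (Fin p) := WithLp.toLp 2 (resolventAt A z *ᵥ v.ofLp) with hy
  have hv : v.ofLp = (A + z • (1 : Matrix (Fin p) (Fin p) ℝ)) *ᵥ y.ofLp := by
    rw [hy, mulVec_mulVec, add_smul_one_mul_resolventAt hA hz, one_mulVec]
  have h1 : bilin (resolventAt A z) v v = bilin A y y + z * ‖y‖ ^ 2 := by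
    have : bilin (resolventAt A z) v v = y.ofLp ⬝ᵥ v.ofLp := by
      rw [bilin, dotProduct_comm]
    rw [this, hv, add_mulVec, dotProduct_add, smul_mulVec, one_mulVec, dotProduct_smul,
      EuclideanSpace.real_norm_sq_eq, bilin]
    simp [dotProduct, sq]
  rw [h1]
  linarith [bilin_self_nonneg hA y]

theorem norm_resolventAt_le (hA : A.PosSemidef) (hz : 0 < z) : ‖resolventAt A z‖ ≤ 1 / z := by
  refine l2_opNorm_le_of_forall (by positivity) fun v => ?_
  have h1 := sq_norm_resolventAt_mulVec_le hA hz v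
  have h2 : bilin (resolventAt A z) v v
      ≤ ‖v‖ * ‖WithLp.toLp 2 (resolventAt A z *ᵥ v.ofLp)‖ := by
    rw [bilin_eq_inner]; exact real_inner_le_norm _ _
  set t := ‖WithLp.toLp 2 (resolventAt A z *ᵥ v.ofLp)‖
  have ht : 0 ≤ t := norm_nonneg _
  rw [one_div, inv_mul_eq_div, le_div_iff₀ hz]
  rcases ht.eq_or_lt with h | h
  · rw [← h]; simp
  · nlinarith

theorem bilin_resolventAt_nonneg (hA : A.PosSemidef) (hz : 0 < z)
    (v : EuclideanSpace ℝ (Fin p)) : 0 ≤ bilin (resolventAt A z) v v :=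
  bilin_self_nonneg (resolventAt_posSemidef hA hz) v

theorem bilin_resolventAt_le (hA : A.PosSemidef) (hz : 0 < z)
    (v : EuclideanSpace ℝ (Fin p)) : bilin (resolventAt A z) v v ≤ ‖v‖ ^ 2 / z := by
  have h := (le_abs_self _).trans (abs_bilin_le (resolventAt A z) v v)
  refine h.trans ?_
  have := mul_le_mul_of_nonneg_right (norm_resolventAt_le hA hz)
    (mul_nonneg (norm_nonneg v) (norm_nonneg v))
  rw [sq, div_eq_inv_mul, ← one_div]; exact this

theorem trace_mul_resolventAt_le (hA : A.PosSemidef) (hz : 0 < z)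
    (hB : B.PosSemidef) : (B * resolventAt A z).trace ≤ B.trace / z := by
  rw [trace_mul_comm]
  refine (le_abs_self _).trans ((abs_trace_mul_le _ hB).trans ?_)
  have := mul_le_mul_of_nonneg_right (norm_resolventAt_le hA hz) hB.trace_nonneg
  rw [div_eq_inv_mul, ← one_div]; exact this

theorem trace_mul_resolventAt_nonneg (hA : A.PosSemidef) (hz : 0 < z)
    (hB : B.PosSemidef) : 0 ≤ (B * resolventAt A z).trace :=
  trace_mul_nonneg hB (resolventAt_posSemidef hA hz)

/-! ### Rank one updates -/

theorem add_smul_outer_posSemidef (hA : A.PosSemidef) {t : ℝ} (ht : 0 ≤ t)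
    (v : EuclideanSpace ℝ (Fin p)) : (A + t • outer v).PosSemidef :=
  hA.add ((outer_posSemidef v).smul ht)

/-- Sherman–Morrison applied to the updating vector itself: the resolvent identity is a scalar
linear equation for the updated image of `v`. -/
theorem resolventAt_add_outer_mulVec (hA : A.PosSemidef) (hz : 0 < z) {t : ℝ} (ht : 0 ≤ t)
    (v : EuclideanSpace ℝ (Fin p)) :
    resolventAt (A + t • outer v) z *ᵥ v.ofLp
      = (1 + t * bilin (resolventAt A z) v v)⁻¹ • (resolventAt A z *ᵥ v.ofLp) := by
  have hB := add_smul_outer_posSemidef hA ht v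
  have h := resolventAt_sub hB hA hz
  have hΔ := mul_nonneg ht (bilin_resolventAt_nonneg hA hz v)
  have h2 : resolventAt (A + t • outer v) z *ᵥ v.ofLp - resolventAt A z *ᵥ v.ofLp
      = -(t * bilin (resolventAt A z) v v) • (resolventAt (A + t • outer v) z *ᵥ v.ofLp) := by
    rw [← sub_mulVec, h, ← mulVec_mulVec, ← mulVec_mulVec]
    have : (A - (A + t • outer v)) *ᵥ (resolventAt A z *ᵥ v.ofLp)
        = -(t * bilin (resolventAt A z) v v) • v.ofLp := by
      rw [sub_add_cancel_left, neg_mulVec, smul_mulVec, outer, vecMulVec_mulVec, bilin, neg_smul,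
        mul_smul]
      simp
    rw [this, mulVec_smul]
  have h3 : (1 + t * bilin (resolventAt A z) v v) • (resolventAt (A + t • outer v) z *ᵥ v.ofLp)
      = resolventAt A z *ᵥ v.ofLp := by
    rw [add_smul, one_smul]
    rw [neg_smul, sub_eq_iff_eq_add] at h2
    nth_rewrite 1 [h2]
    abel
  rw [← h3, smul_smul, inv_mul_cancel₀ (by positivity), one_smul]

theorem resolventAt_sub_resolventAt_add_outer (hA : A.PosSemidef) (hz : 0 < z) {t : ℝ}
    (ht : 0 ≤ t) (v : EuclideanSpace ℝ (Fin p)) :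
    resolventAt A z - resolventAt (A + t • outer v) z
      = (t / (1 + t * bilin (resolventAt A z) v v)) •
        outer (WithLp.toLp 2 (resolventAt A z *ᵥ v.ofLp)) := by
  have hB := add_smul_outer_posSemidef hA ht v
  have h : resolventAt A z - resolventAt (A + t • outer v) z =
      resolventAt (A + t • outer v) z * (t • outer v) * resolventAt A z := by
    rw [← neg_sub, resolventAt_sub hB hA hz]; simp
  have h' : resolventAt (A + t • outer v) z * outer v
      = vecMulVec (resolventAt (A + t • outer v) z *ᵥ v.ofLp) v.ofLp := mul_vecMulVec _ _ _
  rw [h, Matrix.mul_smul, Matrix.smul_mul, h',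
    resolventAt_add_outer_mulVec hA hz ht, vecMulVec_mul, smul_vecMulVec, smul_smul, div_eq_mul_inv,
    outer]
  congr 3
  rw [← mulVec_transpose]
  congr 1
  have : (resolventAt A z).IsSymm := by simpa using resolventAt_isHermitian hA hz
  exact this

theorem resolventAt_sub_add_outer_posSemidef (hA : A.PosSemidef) (hz : 0 < z) {t : ℝ}
    (ht : 0 ≤ t) (v : EuclideanSpace ℝ (Fin p)) :
    (resolventAt A z - resolventAt (A + t • outer v) z).PosSemidef := by
  have hΔ := mul_nonneg ht (bilin_resolventAt_nonneg hA hz v)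
  rw [resolventAt_sub_resolventAt_add_outer hA hz ht]
  exact (outer_posSemidef _).smul (by positivity)

/-- The difference has trace `t‖Qv‖²/(1 + t vᵀQv)` and `z‖Qv‖² ≤ vᵀQv`, so the size of `v` cancels.
A perturbation of rank `r` thus costs at most `r/z` in trace, however large it is. -/
theorem trace_resolventAt_sub_add_outer_le (hA : A.PosSemidef) (hz : 0 < z) {t : ℝ}
    (ht : 0 ≤ t) (v : EuclideanSpace ℝ (Fin p)) :
    (resolventAt A z - resolventAt (A + t • outer v) z).trace ≤ 1 / z := by
  have hΔ := mul_nonneg ht (bilin_resolventAt_nonneg hA hz v)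
  have h1 := mul_le_mul_of_nonneg_left (sq_norm_resolventAt_mulVec_le hA hz v) ht
  rw [resolventAt_sub_resolventAt_add_outer hA hz ht, trace_smul, trace_outer, smul_eq_mul,
    div_mul_eq_mul_div, div_le_div_iff₀ (by positivity) hz]
  linarith

/-- Complement to the size-free bound, better when `t‖v‖²` is small; it serves the regime `p ≤ √n`.
-/
theorem trace_resolventAt_sub_add_outer_le' (hA : A.PosSemidef) (hz : 0 < z) {t : ℝ}
    (ht : 0 ≤ t) (v : EuclideanSpace ℝ (Fin p)) :
    (resolventAt A z - resolventAt (A + t • outer v) z).trace ≤ t * ‖v‖ ^ 2 / z ^ 2 := by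
  have hΔ := mul_nonneg ht (bilin_resolventAt_nonneg hA hz v)
  rw [resolventAt_sub_resolventAt_add_outer hA hz ht, trace_smul, trace_outer, smul_eq_mul]
  have h2 : ‖(WithLp.toLp 2 (resolventAt A z *ᵥ v.ofLp) : EuclideanSpace ℝ (Fin p))‖ ^ 2
      ≤ ‖v‖ ^ 2 / z ^ 2 := by
    have := (norm_mulVec_le (resolventAt A z) v).trans
      (mul_le_mul_of_nonneg_right (norm_resolventAt_le hA hz) (norm_nonneg v))
    calc _ ≤ (1 / z * ‖v‖) ^ 2 := by gcongr
      _ = _ := by ring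
  have h3 : t / (1 + t * bilin (resolventAt A z) v v) ≤ t :=
    div_le_self ht (by linarith)
  rw [mul_div_assoc]
  gcongr

theorem resolventAt_sub_add_sum_outer {ι : Type*} (s : Finset ι) (hA : A.PosSemidef)
    (hz : 0 < z) (t : ι → ℝ) (ht : ∀ i, 0 ≤ t i) (v : ι → EuclideanSpace ℝ (Fin p)) :
    (A + ∑ i ∈ s, t i • outer (v i)).PosSemidef ∧
    (resolventAt A z - resolventAt (A + ∑ i ∈ s, t i • outer (v i)) z).PosSemidef ∧
    (resolventAt A z - resolventAt (A + ∑ i ∈ s, t i • outer (v i)) z).trace ≤ s.card / z := by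
  classical
  induction s using Finset.induction_on with
  | empty => simpa using ⟨hA, PosSemidef.zero⟩
  | insert a s ha ih =>
    obtain ⟨h0, h1, h2⟩ := ih
    rw [Finset.sum_insert ha, add_comm (t a • _), ← add_assoc]
    have e : resolventAt A z - resolventAt (A + ∑ i ∈ s, t i • outer (v i) + t a • outer (v a)) z
      = (resolventAt A z - resolventAt (A + ∑ i ∈ s, t i • outer (v i)) z)
        + (resolventAt (A + ∑ i ∈ s, t i • outer (v i)) z
          - resolventAt (A + ∑ i ∈ s, t i • outer (v i) + t a • outer (v a)) z) := by abel
    refine ⟨add_smul_outer_posSemidef h0 (ht a) _, ?_, ?_⟩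
    · rw [e]
      exact h1.add (resolventAt_sub_add_outer_posSemidef h0 hz (ht a) _)
    · rw [e, trace_add, Finset.card_insert_of_notMem ha]
      have := trace_resolventAt_sub_add_outer_le h0 hz (ht a) (v a)
      push_cast
      rw [add_div]
      linarith

theorem continuous_resolventAt {X : Type*} [TopologicalSpace X]
    {f : X → Matrix (Fin p) (Fin p) ℝ} (hf : Continuous f) (hp : ∀ x, (f x).PosSemidef)
    (hz : 0 < z) : Continuous fun x => resolventAt (f x) z := by
  have h : Continuous fun x => f x + z • (1 : Matrix (Fin p) (Fin p) ℝ) := by fun_prop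
  have hd : ∀ x, (f x + z • (1 : Matrix (Fin p) (Fin p) ℝ)).det ≠ 0 := fun x =>
    (posDef_add_smul_one (hp x) hz).det_pos.ne'
  have : (fun x => resolventAt (f x) z) = fun x =>
      ((f x + z • (1 : Matrix (Fin p) (Fin p) ℝ)).det)⁻¹ •
        (f x + z • (1 : Matrix (Fin p) (Fin p) ℝ)).adjugate := by
    ext1 x
    rw [resolventAt, Matrix.inv_def, Ring.inverse_eq_inv]
  rw [this]
  exact (h.matrix_det.inv₀ hd).smul h.matrix_adjugate

end Resolvent

/-! ### The fixed point system: existence, uniqueness, stability -/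

section FixedPoint

open Matrix Filter Topology
open scoped Matrix.Norms.L2Operator

variable {p k : ℕ}

/-- The map `δ ↦ ((1/n) tr (Σ_l Q̃_δ(z)))_l` whose fixed points define the deterministic
equivalent. -/
noncomputable def fpMap (n : ℕ) (w : Fin k → ℝ) (S : Fin k → Matrix (Fin p) (Fin p) ℝ) (z : ℝ)
    (δ : Fin k → ℝ) (l : Fin k) : ℝ :=
  1 / (n : ℝ) * (S l * QTilde w S z δ).trace

/-- The weight `((1 + δ_l) (1 + ε_l))^{-1/2}`. -/
noncomputable def fpWeight (δ ε : Fin k → ℝ) (l : Fin k) : ℝ :=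
  (√(1 + δ l))⁻¹ * (√(1 + ε l))⁻¹

/-- The coefficient `(1/n) tr (Σ_j Q̃_δ Σ_l Q̃_ε)`. -/
noncomputable def fpCoeff (n : ℕ) (w : Fin k → ℝ) (S : Fin k → Matrix (Fin p) (Fin p) ℝ) (z : ℝ)
    (δ ε : Fin k → ℝ) (j l : Fin k) : ℝ :=
  1 / (n : ℝ) * (S j * QTilde w S z δ * S l * QTilde w S z ε).trace

variable {n : ℕ} {w : Fin k → ℝ} {S : Fin k → Matrix (Fin p) (Fin p) ℝ} {z : ℝ}
  {δ ε : Fin k → ℝ}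

theorem sum_smul_posSemidef (hw : ∀ l, 0 ≤ w l) (hS : ∀ l, (S l).PosSemidef)
    (hδ : ∀ l, 0 ≤ δ l) : (∑ l, (w l / (1 + δ l)) • S l).PosSemidef :=
  posSemidef_sum _ fun l _ => (hS l).smul (div_nonneg (hw l) (by linarith [hδ l]))

theorem QTilde_posSemidef (hw : ∀ l, 0 ≤ w l) (hS : ∀ l, (S l).PosSemidef)
    (hδ : ∀ l, 0 ≤ δ l) (hz : 0 < z) : (QTilde w S z δ).PosSemidef :=
  resolventAt_posSemidef (sum_smul_posSemidef hw hS hδ) hz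

theorem norm_QTilde_le (hw : ∀ l, 0 ≤ w l) (hS : ∀ l, (S l).PosSemidef)
    (hδ : ∀ l, 0 ≤ δ l) (hz : 0 < z) : ‖QTilde w S z δ‖ ≤ 1 / z :=
  norm_resolventAt_le (sum_smul_posSemidef hw hS hδ) hz

theorem fpMap_nonneg (hw : ∀ l, 0 ≤ w l) (hS : ∀ l, (S l).PosSemidef)
    (hδ : ∀ l, 0 ≤ δ l) (hz : 0 < z) (l : Fin k) : 0 ≤ fpMap n w S z δ l :=
  mul_nonneg (by positivity) (trace_mul_nonneg (hS l) (QTilde_posSemidef hw hS hδ hz))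

theorem fpMap_le (hw : ∀ l, 0 ≤ w l) (hS : ∀ l, (S l).PosSemidef)
    (hδ : ∀ l, 0 ≤ δ l) (hz : 0 < z) (l : Fin k) :
    fpMap n w S z δ l ≤ 1 / (n : ℝ) * ((S l).trace / z) :=
  mul_le_mul_of_nonneg_left
    (trace_mul_resolventAt_le (sum_smul_posSemidef hw hS hδ) hz (hS l)) (by positivity)

theorem fpWeight_pos (hδ : ∀ l, 0 ≤ δ l) (hε : ∀ l, 0 ≤ ε l) (l : Fin k) :
    0 < fpWeight δ ε l := by
  have := hδ l
  have := hε l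
  unfold fpWeight
  positivity

theorem fpWeight_le_one (hδ : ∀ l, 0 ≤ δ l) (hε : ∀ l, 0 ≤ ε l) (l : Fin k) :
    fpWeight δ ε l ≤ 1 := by
  have h : ∀ x : ℝ, 0 ≤ x → (√(1 + x))⁻¹ ≤ 1 := fun x hx =>
    inv_le_one_of_one_le₀ (Real.one_le_sqrt.mpr (by linarith))
  exact mul_le_one₀ (h _ (hδ l)) (by positivity) (h _ (hε l))

theorem fpWeight_sq (hδ : ∀ l, 0 ≤ δ l) (hε : ∀ l, 0 ≤ ε l) (l : Fin k) :
    fpWeight δ ε l ^ 2 = 1 / ((1 + δ l) * (1 + ε l)) := by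
  have := hδ l
  have := hε l
  rw [fpWeight, mul_pow, inv_pow, inv_pow, Real.sq_sqrt (by positivity),
    Real.sq_sqrt (by positivity), one_div, mul_inv]

theorem QTilde_sub (hw : ∀ l, 0 ≤ w l) (hS : ∀ l, (S l).PosSemidef)
    (hδ : ∀ l, 0 ≤ δ l) (hε : ∀ l, 0 ≤ ε l) (hz : 0 < z) :
    QTilde w S z δ - QTilde w S z ε =
      ∑ l, (w l * fpWeight δ ε l ^ 2 * (δ l - ε l)) • (QTilde w S z δ * S l * QTilde w S z ε) := by
  have h : ∑ l, (w l / (1 + ε l)) • S l - ∑ l, (w l / (1 + δ l)) • S l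
      = ∑ l, (w l * fpWeight δ ε l ^ 2 * (δ l - ε l)) • S l := by
    rw [← Finset.sum_sub_distrib]
    refine Finset.sum_congr rfl fun l _ => ?_
    rw [← sub_smul, fpWeight_sq hδ hε]
    congr 1
    have := hδ l
    have := hε l
    field_simp
    ring
  rw [QTilde, QTilde, resolventAt_sub (sum_smul_posSemidef hw hS hδ)
    (sum_smul_posSemidef hw hS hε) hz, h]
  simp [Finset.mul_sum, Finset.sum_mul]

theorem fpMap_sub (hw : ∀ l, 0 ≤ w l) (hS : ∀ l, (S l).PosSemidef)
    (hδ : ∀ l, 0 ≤ δ l) (hε : ∀ l, 0 ≤ ε l) (hz : 0 < z) (j : Fin k) :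
    fpMap n w S z δ j - fpMap n w S z ε j =
      ∑ l, w l * fpWeight δ ε l ^ 2 * (δ l - ε l) * fpCoeff n w S z δ ε j l := by
  rw [fpMap, fpMap, ← mul_sub, ← trace_sub, ← Matrix.mul_sub, QTilde_sub hw hS hδ hε hz,
    Finset.mul_sum, trace_sum, Finset.mul_sum]
  refine Finset.sum_congr rfl fun l _ => ?_
  rw [Matrix.mul_smul, trace_smul, fpCoeff, smul_eq_mul, Matrix.mul_assoc (S j),
    Matrix.mul_assoc (S j)]
  ring

/-- Transposition and cyclicity of the trace. The symmetry allows sums over rows to be exchanged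
with sums over columns in the `ℓ¹` stability estimate. -/
theorem fpCoeff_comm (hw : ∀ l, 0 ≤ w l) (hS : ∀ l, (S l).PosSemidef)
    (hδ : ∀ l, 0 ≤ δ l) (hε : ∀ l, 0 ≤ ε l) (hz : 0 < z) (j l : Fin k) :
    fpCoeff n w S z δ ε j l = fpCoeff n w S z δ ε l j := by
  have e : ∀ {A : Matrix (Fin p) (Fin p) ℝ}, A.PosSemidef → Aᵀ = A := fun {A} hA =>
    (by simpa using hA.isHermitian : A.IsSymm)
  rw [fpCoeff, fpCoeff, ← trace_transpose]
  simp only [transpose_mul, e (hS _), e (QTilde_posSemidef hw hS hδ hz),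
    e (QTilde_posSemidef hw hS hε hz)]
  rw [trace_mul_comm]
  simp only [Matrix.mul_assoc]

theorem fpCoeff_self_nonneg (hw : ∀ l, 0 ≤ w l) (hS : ∀ l, (S l).PosSemidef)
    (hδ : ∀ l, 0 ≤ δ l) (hz : 0 < z) (j l : Fin k) : 0 ≤ fpCoeff n w S z δ δ j l :=
  mul_nonneg (by positivity) (trace_mul_mul_mul_self_nonneg (hS j) (hS l)
    (QTilde_posSemidef hw hS hδ hz).isHermitian)

theorem abs_fpCoeff_le (hw : ∀ l, 0 ≤ w l) (hS : ∀ l, (S l).PosSemidef)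
    (hδ : ∀ l, 0 ≤ δ l) (hε : ∀ l, 0 ≤ ε l) (hz : 0 < z) (j l : Fin k) :
    |fpCoeff n w S z δ ε j l| ≤
      √(fpCoeff n w S z δ δ j l) * √(fpCoeff n w S z ε ε j l) := by
  have h := abs_trace_mul_mul_mul_le (hS j) (hS l) (QTilde_posSemidef hw hS hδ hz).isHermitian
    (QTilde_posSemidef hw hS hε hz).isHermitian
  have hn : (0 : ℝ) ≤ 1 / n := by positivity
  rw [fpCoeff, fpCoeff, fpCoeff, Real.sqrt_mul hn, Real.sqrt_mul hn, abs_mul, abs_of_nonneg hn]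
  calc _ ≤ (1 / (n : ℝ)) * _ := mul_le_mul_of_nonneg_left h hn
    _ = √(1 / (n : ℝ)) * √(1 / (n : ℝ)) * _ := by rw [Real.mul_self_sqrt hn]
    _ = _ := by ring

/-- The weighted sum rebuilds `Σ_δ` between two copies of `Q̃_δ`. Since `Σ_δ Q̃_δ = 1 - z Q̃_δ`, it
equals the fixed point map minus a nonnegative multiple of `tr(S_j Q̃_δ²)`. -/
theorem sum_fpCoeff_self_le (hw : ∀ l, 0 ≤ w l) (hS : ∀ l, (S l).PosSemidef)
    (hδ : ∀ l, 0 ≤ δ l) (hz : 0 < z) (j : Fin k) :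
    ∑ l, w l / (1 + δ l) * fpCoeff n w S z δ δ j l ≤ fpMap n w S z δ j := by
  have hP := sum_smul_posSemidef hw hS hδ
  have e1 : ∑ l, w l / (1 + δ l) * fpCoeff n w S z δ δ j l = 1 / (n : ℝ) *
      (S j * QTilde w S z δ * (∑ l, (w l / (1 + δ l)) • S l) * QTilde w S z δ).trace := by
    simp only [Finset.mul_sum, Finset.sum_mul, trace_sum, fpCoeff, Matrix.mul_smul,
      Matrix.smul_mul, trace_smul, smul_eq_mul]
    exact Finset.sum_congr rfl fun l _ => by ring
  have e2 : (∑ l, (w l / (1 + δ l)) • S l) * QTilde w S z δ = 1 - z • QTilde w S z δ := by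
    have := add_smul_one_mul_resolventAt hP hz
    rw [Matrix.add_mul] at this
    rw [QTilde, ← this]
    simp
  have h0 : 0 ≤ (S j * (QTilde w S z δ * QTilde w S z δ)).trace := by
    refine trace_mul_nonneg (hS j) ?_
    have h := QTilde_posSemidef hw hS hδ hz
    have := posSemidef_self_mul_conjTranspose (QTilde w S z δ)
    rwa [h.isHermitian.eq] at this
  rw [e1, Matrix.mul_assoc (S j * _), e2, fpMap]
  refine mul_le_mul_of_nonneg_left ?_ (by positivity)
  rw [Matrix.mul_sub, trace_sub, Matrix.mul_one, Matrix.mul_smul, trace_smul, Matrix.mul_assoc,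
    smul_eq_mul]
  nlinarith

theorem sum_fpWeight_mul_abs_fpCoeff_le (hw : ∀ l, 0 ≤ w l) (hS : ∀ l, (S l).PosSemidef)
    (hδ : ∀ l, 0 ≤ δ l) (hε : ∀ l, 0 ≤ ε l) (hz : 0 < z) (j : Fin k) :
    ∑ l, w l * fpWeight δ ε l * |fpCoeff n w S z δ ε j l| ≤
      √(fpMap n w S z δ j) * √(fpMap n w S z ε j) := by
  have hf : ∀ (δ : Fin k → ℝ), (∀ l, 0 ≤ δ l) → ∀ l,
      0 ≤ w l / (1 + δ l) * fpCoeff n w S z δ δ j l := fun δ hδ l =>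
    mul_nonneg (div_nonneg (hw l) (by linarith [hδ l])) (fpCoeff_self_nonneg hw hS hδ hz j l)
  calc ∑ l, w l * fpWeight δ ε l * |fpCoeff n w S z δ ε j l|
      ≤ ∑ l, √(w l / (1 + δ l) * fpCoeff n w S z δ δ j l)
          * √(w l / (1 + ε l) * fpCoeff n w S z ε ε j l) := by
        refine Finset.sum_le_sum fun l _ => ?_
        have h1 := hδ l
        have h2 := hε l
        have h3 := hw l
        rw [Real.sqrt_mul (by positivity), Real.sqrt_mul (by positivity),
          Real.sqrt_div h3, Real.sqrt_div h3]
        calc _ ≤ w l * fpWeight δ ε l *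
              (√(fpCoeff n w S z δ δ j l) * √(fpCoeff n w S z ε ε j l)) :=
              mul_le_mul_of_nonneg_left (abs_fpCoeff_le hw hS hδ hε hz j l)
                (mul_nonneg h3 (fpWeight_pos hδ hε l).le)
          _ = (√(w l) * √(w l)) * fpWeight δ ε l *
              (√(fpCoeff n w S z δ δ j l) * √(fpCoeff n w S z ε ε j l)) := by
              rw [Real.mul_self_sqrt h3]
          _ = _ := by rw [fpWeight]; ring
    _ ≤ √(∑ l, w l / (1 + δ l) * fpCoeff n w S z δ δ j l) *
        √(∑ l, w l / (1 + ε l) * fpCoeff n w S z ε ε j l) :=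
      Real.sum_sqrt_mul_sqrt_le _ (hf δ hδ) (hf ε hε)
    _ ≤ _ := mul_le_mul (Real.sqrt_le_sqrt (sum_fpCoeff_self_le hw hS hδ hz j))
        (Real.sqrt_le_sqrt (sum_fpCoeff_self_le hw hS hε hz j)) (by positivity) (by positivity)

/-- The key Lipschitz estimate for the fixed point map. -/
theorem abs_fpMap_sub_le (hw : ∀ l, 0 ≤ w l) (hS : ∀ l, (S l).PosSemidef)
    (hδ : ∀ l, 0 ≤ δ l) (hε : ∀ l, 0 ≤ ε l) (hz : 0 < z) {r : ℝ}
    (hr : ∀ l, |δ l - ε l| * fpWeight δ ε l ≤ r) (j : Fin k) :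
    |fpMap n w S z δ j - fpMap n w S z ε j| ≤
      r * (√(fpMap n w S z δ j) * √(fpMap n w S z ε j)) := by
  have hr0 : 0 ≤ r := (mul_nonneg (abs_nonneg _) (fpWeight_pos hδ hε j).le).trans (hr j)
  rw [fpMap_sub hw hS hδ hε hz]
  refine (Finset.abs_sum_le_sum_abs _ _).trans
    (le_trans ?_ (mul_le_mul_of_nonneg_left (sum_fpWeight_mul_abs_fpCoeff_le hw hS hδ hε hz j) hr0))
  rw [Finset.mul_sum]
  refine Finset.sum_le_sum fun l _ => ?_
  have h1 := (fpWeight_pos hδ hε l).le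
  rw [abs_mul, abs_mul, abs_of_nonneg (mul_nonneg (hw l) (sq_nonneg _))]
  have := mul_le_mul_of_nonneg_right (hr l)
    (mul_nonneg (mul_nonneg (hw l) h1) (abs_nonneg (fpCoeff n w S z δ ε j l)))
  calc _ = |δ l - ε l| * fpWeight δ ε l * (w l * fpWeight δ ε l * |fpCoeff n w S z δ ε j l|) := by
        ring
    _ ≤ _ := this

theorem sqrt_mul_inv_sqrt_le {a b B h : ℝ} (ha : 0 ≤ a) (hB : a ≤ B) (hh : 0 < h) 
    (hab : a + h ≤ 1 + b) : √a * (√(1 + b))⁻¹ ≤ √(B / (B + h)) := by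
  rw [← Real.sqrt_inv, ← Real.sqrt_mul ha]
  refine Real.sqrt_le_sqrt ?_
  rw [← div_eq_mul_inv, div_le_div_iff₀ (by linarith) (by linarith)]
  nlinarith

/-- Source of the contraction factor: `F/(1 + α) ≤ F/(F + h) ≤ B/(B + h)`. The weight has its own
points `α`, `β` because along the iteration it is taken at the next iterates, where `α = F(δ)` and
`h = 1`. Approximate solutions leave the margin `h = 1/2`. -/
theorem sqrt_fpMap_mul_fpWeight_le (hw : ∀ l, 0 ≤ w l) (hS : ∀ l, (S l).PosSemidef)
    (hδ : ∀ l, 0 ≤ δ l) (hε : ∀ l, 0 ≤ ε l) (hz : 0 < z) {B h : ℝ} (hh : 0 < h)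
    {α β : Fin k → ℝ}
    (hδB : ∀ l, fpMap n w S z δ l ≤ B) (hεB : ∀ l, fpMap n w S z ε l ≤ B)
    (hδ1 : ∀ l, fpMap n w S z δ l + h ≤ 1 + α l) (hε1 : ∀ l, fpMap n w S z ε l + h ≤ 1 + β l)
    (j : Fin k) :
    √(fpMap n w S z δ j) * √(fpMap n w S z ε j) * fpWeight α β j ≤ B / (B + h) := by
  have h1 := fpMap_nonneg (n := n) hw hS hδ hz j
  have h2 := fpMap_nonneg (n := n) hw hS hε hz j
  have hB : 0 ≤ B := h1.trans (hδB j)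
  have := mul_le_mul (sqrt_mul_inv_sqrt_le h1 (hδB j) hh (hδ1 j))
    (sqrt_mul_inv_sqrt_le h2 (hεB j) hh (hε1 j)) (by positivity) (by positivity)
  rw [Real.mul_self_sqrt (by positivity)] at this
  calc _ = √(fpMap n w S z δ j) * (√(1 + α j))⁻¹ * (√(fpMap n w S z ε j) * (√(1 + β j))⁻¹) := by
        rw [fpWeight]; ring
    _ ≤ _ := this

theorem solvesFixedPoint_iff : SolvesFixedPoint n w S z δ ↔
    (∀ l, 0 ≤ δ l) ∧ ∀ l, δ l = fpMap n w S z δ l := Iff.rfl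

theorem solvesFixedPoint_unique (hw : ∀ l, 0 ≤ w l) (hS : ∀ l, (S l).PosSemidef) (hz : 0 < z)
    (h1 : SolvesFixedPoint n w S z δ) (h2 : SolvesFixedPoint n w S z ε) : δ = ε := by
  rw [solvesFixedPoint_iff] at h1 h2
  obtain ⟨hδ, h1⟩ := h1
  obtain ⟨hε, h2⟩ := h2
  set B := ∑ l, (δ l + ε l) with hBdef
  have hB : ∀ l, δ l + ε l ≤ B := fun l =>
    Finset.single_le_sum (f := fun l => δ l + ε l) (fun l _ => add_nonneg (hδ l) (hε l))
      (Finset.mem_univ l)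
  have hB0 : 0 ≤ B := Finset.sum_nonneg fun l _ => add_nonneg (hδ l) (hε l)
  -- Both points are fixed, so the Lipschitz estimate can be fed back into itself; each round gains
  -- a factor `B/(B+1)`.
  have key : ∀ m : ℕ, ∀ l, |δ l - ε l| * fpWeight δ ε l ≤ (B / (B + 1)) ^ m * B := by
    intro m
    induction m with
    | zero =>
      intro l
      rw [pow_zero, one_mul]
      have : |δ l - ε l| ≤ B := by
        rw [abs_le]; constructor <;> linarith [hδ l, hε l, hB l]
      calc _ ≤ |δ l - ε l| * 1 :=
            mul_le_mul_of_nonneg_left (fpWeight_le_one hδ hε l) (abs_nonneg _)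
        _ ≤ B := by linarith
    | succ m ih =>
      intro l
      have h3 := abs_fpMap_sub_le (n := n) hw hS hδ hε hz ih l
      rw [← h1, ← h2] at h3
      have h4 := sqrt_fpMap_mul_fpWeight_le (n := n) hw hS hδ hε hz (B := B) one_pos
        (α := δ) (β := ε)
        (fun l => by rw [← h1]; linarith [hδ l, hε l, hB l])
        (fun l => by rw [← h2]; linarith [hδ l, hε l, hB l])
        (fun l => by rw [← h1]; linarith) (fun l => by rw [← h2]; linarith) l
      rw [← h1, ← h2] at h4
      have h5 := mul_le_mul_of_nonneg_right h3 (fpWeight_pos hδ hε l).le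
      have h6 := mul_le_mul_of_nonneg_left h4 (by positivity : 0 ≤ (B / (B + 1)) ^ m * B)
      calc _ ≤ _ := h5
        _ = (B / (B + 1)) ^ m * B * (√(δ l) * √(ε l) * fpWeight δ ε l) := by ring
        _ ≤ _ := h6
        _ = _ := by ring
  funext l
  have hlim : Tendsto (fun m : ℕ => (B / (B + 1)) ^ m * B) atTop (𝓝 (0 * B)) :=
    (tendsto_pow_atTop_nhds_zero_of_lt_one (by positivity)
      ((div_lt_one (by linarith)).mpr (by linarith))).mul_const B
  have h := ge_of_tendsto' hlim fun m => key m l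
  rw [zero_mul] at h
  have h0 := fpWeight_pos hδ hε l
  have := nonpos_of_mul_nonpos_left h h0
  exact sub_eq_zero.mp (abs_nonpos_iff.mp this)

theorem exists_solvesFixedPoint (n : ℕ) (hw : ∀ l, 0 ≤ w l) (hS : ∀ l, (S l).PosSemidef)
    (hz : 0 < z) : ∃ δ, SolvesFixedPoint n w S z δ := by
  set B := ∑ l, 1 / (n : ℝ) * ((S l).trace / z) with hBdef
  have hterm : ∀ l, 0 ≤ 1 / (n : ℝ) * ((S l).trace / z) := fun l =>
    mul_nonneg (by positivity) (div_nonneg (hS l).trace_nonneg hz.le)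
  have hB0 : 0 ≤ B := Finset.sum_nonneg fun l _ => hterm l
  have hB : ∀ δ : Fin k → ℝ, (∀ l, 0 ≤ δ l) → ∀ l, fpMap n w S z δ l ≤ B := fun δ hδ l =>
    (fpMap_le hw hS hδ hz l).trans
      (Finset.single_le_sum (f := fun l => 1 / (n : ℝ) * ((S l).trace / z)) (fun l _ => hterm l)
        (Finset.mem_univ l))
  -- Picard iteration from `0`. The iterates stay in `[0, B]ᵏ`, and their consecutive weighted
  -- distances decay geometrically.
  set d : ℕ → Fin k → ℝ := fun m => (fpMap n w S z)^[m] 0 with hd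
  have hsucc : ∀ m, d (m + 1) = fpMap n w S z (d m) := fun m => Function.iterate_succ_apply' _ _ _
  have hd0 : ∀ m l, 0 ≤ d m l := by
    intro m
    induction m with
    | zero => intro l; simp [hd]
    | succ m ih => intro l; rw [hsucc]; exact fpMap_nonneg hw hS ih hz l
  have hdB : ∀ m l, d m l ≤ B := by
    intro m
    cases m with
    | zero => intro l; simpa [hd] using hB0
    | succ m => intro l; rw [hsucc]; exact hB _ (hd0 m) l
  have key : ∀ m l, |d m l - d (m + 1) l| * fpWeight (d m) (d (m + 1)) l
      ≤ (B / (B + 1)) ^ m * B := by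
    intro m
    induction m with
    | zero =>
      intro l
      rw [pow_zero, one_mul]
      have : |d 0 l - d (0 + 1) l| ≤ B := by
        rw [abs_le]; constructor <;> linarith [hd0 0 l, hd0 (0 + 1) l, hdB 0 l, hdB (0 + 1) l]
      calc _ ≤ |d 0 l - d (0 + 1) l| * 1 :=
            mul_le_mul_of_nonneg_left (fpWeight_le_one (hd0 _) (hd0 _) l) (abs_nonneg _)
        _ ≤ B := by linarith
    | succ m ih =>
      intro l
      have h3 := abs_fpMap_sub_le (n := n) hw hS (hd0 m) (hd0 (m + 1)) hz ih l
      have h4 := sqrt_fpMap_mul_fpWeight_le (n := n) hw hS (hd0 m) (hd0 (m + 1)) hz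
        (B := B) one_pos (α := d (m + 1)) (β := d (m + 1 + 1)) (hB _ (hd0 m)) (hB _ (hd0 _))
        (fun l => by rw [← hsucc]; linarith) (fun l => by rw [← hsucc]; linarith) l
      rw [← hsucc, ← hsucc] at h3 h4
      have h5 := mul_le_mul_of_nonneg_right h3 (fpWeight_pos (hd0 (m + 1)) (hd0 (m + 1 + 1)) l).le
      have h6 := mul_le_mul_of_nonneg_left h4 (by positivity : 0 ≤ (B / (B + 1)) ^ m * B)
      calc _ ≤ _ := h5
        _ = (B / (B + 1)) ^ m * B * (√(d (m + 1) l) * √(d (m + 1 + 1) l) *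
            fpWeight (d (m + 1)) (d (m + 1 + 1)) l) := by ring
        _ ≤ _ := h6
        _ = _ := by ring
  -- On `[0, B]ᵏ` the weight is at least `1/(1+B)`, so geometric decay of the weighted distances
  -- implies that the iterates are Cauchy in the sup metric.
  have hwt : ∀ δ ε : Fin k → ℝ, (∀ l, 0 ≤ δ l) → (∀ l, 0 ≤ ε l) → (∀ l, δ l ≤ B) →
      (∀ l, ε l ≤ B) → ∀ l, 1 ≤ fpWeight δ ε l * (1 + B) := by
    intro δ ε hδ hε hδB hεB l
    have h : ∀ x : ℝ, 0 ≤ x → x ≤ B → (√(1 + B))⁻¹ ≤ (√(1 + x))⁻¹ := fun x hx hxB => by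
      have : 0 < √(1 + x) := Real.sqrt_pos.mpr (by linarith)
      gcongr
    have := mul_le_mul (h _ (hδ l) (hδB l)) (h _ (hε l) (hεB l)) (by positivity) (by positivity)
    calc (1 : ℝ) = (√(1 + B))⁻¹ * (√(1 + B))⁻¹ * (1 + B) := by
          rw [← mul_inv, Real.mul_self_sqrt (by linarith), inv_mul_cancel₀ (by linarith)]
      _ ≤ _ := mul_le_mul_of_nonneg_right this (by linarith)
  have hdist : ∀ m, dist (d m) (d (m + 1)) ≤ B * (1 + B) * (B / (B + 1)) ^ m := by
    intro m
    refine (dist_pi_le_iff (by positivity)).mpr fun l => ?_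
    rw [Real.dist_eq]
    have h1 := hwt _ _ (hd0 m) (hd0 (m + 1)) (hdB m) (hdB (m + 1)) l
    have h2 := mul_le_mul_of_nonneg_right (key m l) (by linarith : 0 ≤ 1 + B)
    have h3 := mul_le_mul_of_nonneg_left h1 (abs_nonneg (d m l - d (m + 1) l))
    nlinarith
  obtain ⟨δ, hδ⟩ := cauchySeq_tendsto_of_complete (cauchySeq_of_le_geometric _ _
    ((div_lt_one (by linarith)).mpr (by linarith)) hdist)
  have hδ0 : ∀ l, 0 ≤ δ l := fun l =>
    ge_of_tendsto' ((continuous_apply l).continuousAt.tendsto.comp hδ) fun m => hd0 m l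
  refine ⟨δ, hδ0, fun l => ?_⟩
  have h1 : Tendsto (fun m => d (m + 1) l) atTop (𝓝 (δ l)) :=
    (((continuous_apply l).continuousAt.tendsto.comp hδ)).comp (tendsto_add_atTop_nat 1)
  have h2 : Tendsto (fun m => d (m + 1) l) atTop (𝓝 (fpMap n w S z δ l)) := by
    rw [tendsto_iff_dist_tendsto_zero]
    have hlim : Tendsto (fun m => dist (d m) δ * B) atTop (𝓝 0) := by
      simpa using (tendsto_iff_dist_tendsto_zero.mp hδ).mul_const B
    refine squeeze_zero (fun _ => dist_nonneg) (fun m => ?_) hlim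
    rw [hsucc, Real.dist_eq]
    refine (abs_fpMap_sub_le (n := n) hw hS (hd0 m) hδ0 hz (r := dist (d m) δ)
      (fun j => ?_) l).trans ?_
    · calc _ ≤ |d m j - δ j| * 1 :=
            mul_le_mul_of_nonneg_left (fpWeight_le_one (hd0 _) hδ0 j) (abs_nonneg _)
        _ ≤ _ := by rw [mul_one, ← Real.dist_eq]; exact dist_le_pi_dist _ _ j
    · refine mul_le_mul_of_nonneg_left ?_ dist_nonneg
      calc _ ≤ √B * √B := mul_le_mul (Real.sqrt_le_sqrt (hB _ (hd0 m) l))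
            (Real.sqrt_le_sqrt (hB _ hδ0 l)) (by positivity) (by positivity)
        _ = B := Real.mul_self_sqrt hB0
  exact tendsto_nhds_unique h1 h2

/-- Stability of the fixed point system in a weighted `ℓ¹` norm. -/
theorem sum_fpWeight_mul_abs_sub_le (hw : ∀ l, 0 ≤ w l) (hS : ∀ l, (S l).PosSemidef)
    (hδ : ∀ l, 0 ≤ δ l) (hε : ∀ l, 0 ≤ ε l) (hz : 0 < z) {B : ℝ} (hB0 : 0 ≤ B)
    (hδB : ∀ l, fpMap n w S z δ l ≤ B) (hεB : ∀ l, fpMap n w S z ε l ≤ B)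
    (hδ1 : ∀ l, fpMap n w S z δ l ≤ δ l + 1 / 2) (hε1 : ∀ l, fpMap n w S z ε l ≤ ε l + 1 / 2) :
    ∑ l, w l * fpWeight δ ε l * |δ l - ε l| ≤ (2 * B + 1) *
      ∑ l, w l * fpWeight δ ε l *
        (|δ l - fpMap n w S z δ l| + |ε l - fpMap n w S z ε l|) := by
  set U := ∑ l, w l * fpWeight δ ε l * |δ l - ε l| with hU
  set V := ∑ l, w l * fpWeight δ ε l *
        (|δ l - fpMap n w S z δ l| + |ε l - fpMap n w S z ε l|) with hV
  have hwc : ∀ l, 0 ≤ w l * fpWeight δ ε l := fun l =>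
    mul_nonneg (hw l) (fpWeight_pos hδ hε l).le
  have h1 : U ≤ V + ∑ l, w l * fpWeight δ ε l * |fpMap n w S z δ l - fpMap n w S z ε l| := by
    rw [hU, hV, ← Finset.sum_add_distrib]
    refine Finset.sum_le_sum fun l _ => ?_
    rw [← mul_add]
    refine mul_le_mul_of_nonneg_left ?_ (hwc l)
    have e : δ l - ε l = (δ l - fpMap n w S z δ l) - (ε l - fpMap n w S z ε l)
      + (fpMap n w S z δ l - fpMap n w S z ε l) := by ring
    calc |δ l - ε l| ≤ |(δ l - fpMap n w S z δ l) - (ε l - fpMap n w S z ε l)| + _ := by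
          conv_lhs => rw [e]
          exact abs_add_le _ _
      _ ≤ _ := by gcongr; exact abs_sub _ _
  -- After the sums are exchanged by symmetry of the coefficients, each column sum is at most
  -- `√(F(δ)_j F(ε)_j)`. One of the two weights remaining on `j` turns this into the factor `B/(B +
  -- 1/2)`.
  have h2 : ∑ l, w l * fpWeight δ ε l * |fpMap n w S z δ l - fpMap n w S z ε l|
      ≤ B / (B + 1 / 2) * U := by
    calc _ ≤ ∑ l, w l * fpWeight δ ε l *
          ∑ j, w j * fpWeight δ ε j ^ 2 * |δ j - ε j| * |fpCoeff n w S z δ ε l j| := by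
          refine Finset.sum_le_sum fun l _ => mul_le_mul_of_nonneg_left ?_ (hwc l)
          rw [fpMap_sub hw hS hδ hε hz]
          refine (Finset.abs_sum_le_sum_abs _ _).trans_eq (Finset.sum_congr rfl fun j _ => ?_)
          rw [abs_mul, abs_mul, abs_of_nonneg (mul_nonneg (hw j) (sq_nonneg _))]
      _ = ∑ j, w j * fpWeight δ ε j ^ 2 * |δ j - ε j| *
          ∑ l, w l * fpWeight δ ε l * |fpCoeff n w S z δ ε j l| := by
          simp_rw [Finset.mul_sum]
          rw [Finset.sum_comm]
          refine Finset.sum_congr rfl fun j _ => Finset.sum_congr rfl fun l _ => ?_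
          rw [fpCoeff_comm hw hS hδ hε hz j l]
          ring
      _ ≤ ∑ j, w j * fpWeight δ ε j ^ 2 * |δ j - ε j| *
          (√(fpMap n w S z δ j) * √(fpMap n w S z ε j)) :=
          Finset.sum_le_sum fun j _ => mul_le_mul_of_nonneg_left
            (sum_fpWeight_mul_abs_fpCoeff_le hw hS hδ hε hz j)
            (mul_nonneg (mul_nonneg (hw j) (sq_nonneg _)) (abs_nonneg _))
      _ ≤ _ := by
          rw [hU, Finset.mul_sum]
          refine Finset.sum_le_sum fun j _ => ?_
          have h := sqrt_fpMap_mul_fpWeight_le (n := n) hw hS hδ hε hz (B := B) (h := 1 / 2)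
            (by norm_num) (α := δ) (β := ε) hδB hεB (fun l => by linarith [hδ1 l])
            (fun l => by linarith [hε1 l]) j
          have := mul_le_mul_of_nonneg_left h (mul_nonneg (hwc j) (abs_nonneg (δ j - ε j)))
          calc _ = w j * fpWeight δ ε j * |δ j - ε j| *
                (√(fpMap n w S z δ j) * √(fpMap n w S z ε j) * fpWeight δ ε j) := by ring
            _ ≤ _ := this
            _ = _ := by ring
  have h3 : U ≤ V + B / (B + 1 / 2) * U := h1.trans (by linarith)
  -- The contraction defect is `1 - B/(B + 1/2) = 1/(2B + 1)`, which gives the stability constant.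
  have h4 : B / (B + 1 / 2) * U = U - U / (2 * B + 1) := by
    field_simp
    ring
  rw [h4] at h3
  have h5 : U / (2 * B + 1) ≤ V := by linarith
  rw [div_le_iff₀ (by linarith)] at h5
  linarith

end FixedPoint

/-! ### The trace of the resolvent as a difference of convex Lipschitz functions -/

section TraceFunctions

open Matrix

/-- A Peierls type inequality for singular values: a convex nondecreasing function of the singular
values of `T` lies above the tangent functional at `T₀`. -/
theorem sum_tangent_le_sum_singularValues {E H : Type*} [NormedAddCommGroup E]
    [InnerProductSpace ℝ E] [NormedAddCommGroup H] [InnerProductSpace ℝ H] {p : ℕ}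
    (a u : OrthonormalBasis (Fin p) ℝ E) {b v : Fin p → H} (hb : Orthonormal ℝ b)
    (hv : Orthonormal ℝ v) (T T₀ : E →ₗ[ℝ] H) {σ τ : Fin p → ℝ}
    (hT : ∀ k, T (a k) = σ k • b k) (hT₀ : ∀ i, T₀ (u i) = τ i • v i) {s₀ : ℝ} (hs₀ : 0 ≤ s₀)
    (hσ : ∀ k, s₀ ≤ σ k) (hτ : ∀ i, s₀ ≤ τ i) {φ φ' : ℝ → ℝ}
    (hφ : ∀ x y, s₀ ≤ x → s₀ ≤ y → φ x + φ' x * (y - x) ≤ φ y) (hφ' : ∀ x, s₀ ≤ x → 0 ≤ φ' x) :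
    ∑ i, φ (τ i) + ∑ i, φ' (τ i) * inner ℝ ((T - T₀) (u i)) (v i) ≤ ∑ k, φ (σ k) := by
  -- Averaging the squared overlaps of the right and the left singular vectors gives a doubly
  -- substochastic matrix. By `2xy ≤ x² + y²` it dominates the products of overlaps occurring in `⟨T
  -- uᵢ, vᵢ⟩`.
  set P : Fin p → Fin p → ℝ := fun i k =>
    (inner ℝ (a k) (u i) ^ 2 + inner ℝ (b k) (v i) ^ 2) / 2 with hP
  have hP0 : ∀ i k, 0 ≤ P i k := fun i k => by positivity
  have hrow : ∀ i, ∑ k, P i k ≤ 1 := by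
    intro i
    have h1 := a.sum_sq_inner_right (u i)
    have h2 := hb.sum_inner_products_le (s := Finset.univ) (v i)
    simp only [Real.norm_eq_abs, sq_abs, OrthonormalBasis.norm_eq_one, hv.1 i] at h1 h2
    simp only [hP]
    rw [← Finset.sum_div, Finset.sum_add_distrib, h1]
    linarith
  have hcol : ∀ k, ∑ i, P i k ≤ 1 := by
    intro k
    have h1 := u.sum_sq_inner_right (a k)
    have h2 := hv.sum_inner_products_le (s := Finset.univ) (b k)
    simp only [Real.norm_eq_abs, sq_abs, OrthonormalBasis.norm_eq_one, hb.1 k] at h1 h2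
    simp only [hP]
    rw [← Finset.sum_div, Finset.sum_add_distrib]
    simp only [real_inner_comm (u _) (a k), real_inner_comm (v _) (b k)] at h1 h2 ⊢
    rw [h1]
    linarith
  have hinner : ∀ i, inner ℝ (T (u i)) (v i) ≤ ∑ k, P i k * σ k := by
    intro i
    have : T (u i) = ∑ k, (inner ℝ (a k) (u i) * σ k) • b k := by
      conv_lhs => rw [← a.sum_repr' (u i), map_sum]
      exact Finset.sum_congr rfl fun k _ => by rw [map_smul, hT, smul_smul]
    rw [this, sum_inner]
    refine Finset.sum_le_sum fun k _ => ?_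
    rw [real_inner_smul_left]
    have hk := hs₀.trans (hσ k)
    have := two_mul_le_add_sq (inner ℝ (a k) (u i)) (inner ℝ (b k) (v i))
    calc _ = σ k * (inner ℝ (a k) (u i) * inner ℝ (b k) (v i)) := by ring
      _ ≤ σ k * P i k := mul_le_mul_of_nonneg_left (by simp only [hP]; linarith) hk
      _ = _ := mul_comm _ _
  -- Rows may sum to less than `1`. The missing mass is placed at `0`, where the tangent line lies
  -- below its value at `s₀` because its slope is nonnegative, hence below `φ s₀`.
  have hmain : ∀ i, φ (τ i) + φ' (τ i) * inner ℝ ((T - T₀) (u i)) (v i)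
      ≤ ∑ k, P i k * φ (σ k) + (1 - ∑ k, P i k) * φ s₀ := by
    intro i
    have h0 : inner ℝ (T₀ (u i)) (v i) = τ i := by
      rw [hT₀, real_inner_smul_left, real_inner_self_eq_norm_sq, hv.1 i]; ring
    have h1 : φ' (τ i) * inner ℝ ((T - T₀) (u i)) (v i) ≤ φ' (τ i) * (∑ k, P i k * σ k - τ i) := by
      refine mul_le_mul_of_nonneg_left ?_ (hφ' _ (hτ i))
      rw [LinearMap.sub_apply, inner_sub_left, h0]
      linarith [hinner i]
    have h2 : φ (τ i) + φ' (τ i) * (∑ k, P i k * σ k - τ i) =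
        ∑ k, P i k * (φ (τ i) + φ' (τ i) * (σ k - τ i))
          + (1 - ∑ k, P i k) * (φ (τ i) + φ' (τ i) * (0 - τ i)) := by
      have e1 : ∑ k, P i k * (φ (τ i) + φ' (τ i) * (σ k - τ i)) =
          (∑ k, P i k) * (φ (τ i) - φ' (τ i) * τ i) + φ' (τ i) * ∑ k, P i k * σ k := by
        rw [Finset.sum_mul, Finset.mul_sum, ← Finset.sum_add_distrib]
        exact Finset.sum_congr rfl fun k _ => by ring
      rw [e1]; ring
    have h3 : ∑ k, P i k * (φ (τ i) + φ' (τ i) * (σ k - τ i)) ≤ ∑ k, P i k * φ (σ k) :=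
      Finset.sum_le_sum fun k _ => mul_le_mul_of_nonneg_left (hφ _ _ (hτ i) (hσ k)) (hP0 i k)
    have h4 : φ (τ i) + φ' (τ i) * (0 - τ i) ≤ φ s₀ := by
      refine le_trans ?_ (hφ _ _ (hτ i) le_rfl)
      have := mul_nonneg (hφ' _ (hτ i)) hs₀
      nlinarith
    have h5 := mul_le_mul_of_nonneg_left h4 (sub_nonneg.mpr (hrow i))
    linarith
  rw [← Finset.sum_add_distrib]
  refine (Finset.sum_le_sum fun i _ => hmain i).trans ?_
  -- Rows and columns both number `p`, so the missing row mass equals the missing column mass. The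
  -- latter is then absorbed using `φ s₀ ≤ φ (σ k)`.
  have e : ∑ i, (∑ k, P i k * φ (σ k) + (1 - ∑ k, P i k) * φ s₀)
      = ∑ k, ((∑ i, P i k) * φ (σ k) + (1 - ∑ i, P i k) * φ s₀) := by
    rw [Finset.sum_add_distrib, Finset.sum_add_distrib, ← Finset.sum_mul, ← Finset.sum_mul,
      Finset.sum_sub_distrib, Finset.sum_sub_distrib, Finset.sum_comm]
    simp_rw [Finset.sum_mul]
    congr 3
    exact Finset.sum_comm
  rw [e]
  refine Finset.sum_le_sum fun k _ => ?_
  have h1 := hφ s₀ (σ k) le_rfl (hσ k)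
  have h2 := mul_nonneg (hφ' s₀ le_rfl) (sub_nonneg.mpr (hσ k))
  nlinarith [hcol k]

variable {p n : ℕ}

/-- The matrix `(1/n) ∑ᵢ xᵢ xᵢᵀ`. -/
noncomputable def gram (x : Fin n → EuclideanSpace ℝ (Fin p)) : Matrix (Fin p) (Fin p) ℝ :=
  (1 / (n : ℝ)) • ∑ i, outer (x i)

theorem gram_posSemidef (x : Fin n → EuclideanSpace ℝ (Fin p)) : (gram x).PosSemidef :=
  (posSemidef_sum _ fun i _ => outer_posSemidef (x i)).smul (by positivity)

theorem sampleCov_ofColumns (x : Fin n → EuclideanSpace ℝ (Fin p)) :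
    sampleCov (ofColumns x) = gram x := by
  rw [sampleCov, gram]
  congr 1
  ext i j
  simp [Matrix.mul_apply, ofColumns, Matrix.sum_apply, outer, vecMulVec_apply]

theorem bilin_outer (v u w : EuclideanSpace ℝ (Fin p)) :
    bilin (outer v) u w = inner ℝ v u * inner ℝ v w := by
  rw [bilin, outer, vecMulVec_mulVec]
  simp only [EuclideanSpace.inner_eq_star_dotProduct, star_trivial, dotProduct_smul]
  simp [dotProduct_comm]

theorem bilin_smul (c : ℝ) (A : Matrix (Fin p) (Fin p) ℝ) (u w : EuclideanSpace ℝ (Fin p)) :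
    bilin (c • A) u w = c * bilin A u w := by
  simp [bilin, smul_mulVec]

theorem bilin_sum {ι : Type*} (s : Finset ι) (A : ι → Matrix (Fin p) (Fin p) ℝ)
    (u w : EuclideanSpace ℝ (Fin p)) : bilin (∑ i ∈ s, A i) u w = ∑ i ∈ s, bilin (A i) u w := by
  simp [bilin, sum_mulVec, dotProduct_sum]

/-- The linear map `u ↦ (n^{-1/2} Xᵀ u, √z u)`. -/
noncomputable def stackMap (z : ℝ) (x : Fin n → EuclideanSpace ℝ (Fin p)) :
    EuclideanSpace ℝ (Fin p) →ₗ[ℝ] EuclideanSpace ℝ (Fin n ⊕ Fin p) where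
  toFun u := WithLp.toLp 2 (Sum.elim (fun i => (√(n : ℝ))⁻¹ * inner ℝ (x i) u) fun j => √z * u j)
  map_add' u v := by
    ext i
    rcases i with i | i <;> simp [inner_add_right, mul_add]
  map_smul' c u := by
    ext i
    rcases i with i | i <;> simp [inner_smul_right] <;> ring

theorem inner_stackMap {z : ℝ} (hz : 0 ≤ z) (x : Fin n → EuclideanSpace ℝ (Fin p))
    (u v : EuclideanSpace ℝ (Fin p)) :
    inner ℝ (stackMap z x u) (stackMap z x v) = bilin (gram x) u v + z * inner ℝ u v := by
  have h1 : inner ℝ (stackMap z x u) (stackMap z x v) =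
      ∑ i, ((√(n : ℝ))⁻¹ * inner ℝ (x i) u) * ((√(n : ℝ))⁻¹ * inner ℝ (x i) v)
        + ∑ j, (√z * u j) * (√z * v j) := by
    rw [PiLp.inner_apply, Fintype.sum_sum_type]
    simp [stackMap, mul_comm]
  have h2 : inner ℝ u v = ∑ j, u j * v j := by
    rw [PiLp.inner_apply]
    simp [mul_comm]
  have hn : (√(n : ℝ))⁻¹ * (√(n : ℝ))⁻¹ = 1 / n := by
    rw [← mul_inv, Real.mul_self_sqrt (by positivity), one_div]
  rw [h1, gram, bilin_smul, bilin_sum, h2, Finset.mul_sum, Finset.mul_sum]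
  congr 1
  · refine Finset.sum_congr rfl fun i _ => ?_
    rw [bilin_outer, ← hn]; ring
  · refine Finset.sum_congr rfl fun i _ => ?_
    rw [mul_mul_mul_comm, Real.mul_self_sqrt hz]

theorem stackMap_sub (z : ℝ) (x y : Fin n → EuclideanSpace ℝ (Fin p)) :
    stackMap z x - stackMap z y = stackMap 0 (x - y) := by
  ext u i
  rcases i with i | i <;> simp [stackMap, inner_sub_left, mul_sub]

/-- The `k`-th singular value of `u ↦ (n^{-1/2} Xᵀ u, √z u)`. -/
noncomputable def singVal (z : ℝ) (x : Fin n → EuclideanSpace ℝ (Fin p)) (k : Fin p) : ℝ :=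
  √((gram_posSemidef x).isHermitian.eigenvalues k + z)

theorem sqrt_le_singVal (z : ℝ) (x : Fin n → EuclideanSpace ℝ (Fin p)) (k : Fin p) :
    √z ≤ singVal z x k :=
  Real.sqrt_le_sqrt (by linarith [(gram_posSemidef x).eigenvalues_nonneg k])

theorem exists_orthonormal_singVal {z : ℝ} (hz : 0 < z) (x : Fin n → EuclideanSpace ℝ (Fin p)) :
    ∃ (a : OrthonormalBasis (Fin p) ℝ (EuclideanSpace ℝ (Fin p)))
      (b : Fin p → EuclideanSpace ℝ (Fin n ⊕ Fin p)), Orthonormal ℝ b ∧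
      ∀ k, stackMap z x (a k) = singVal z x k • b k := by
  have hpos : ∀ k, 0 < singVal z x k := fun k =>
    (Real.sqrt_pos.mpr hz).trans_le (sqrt_le_singVal z x k)
  refine ⟨(gram_posSemidef x).isHermitian.eigenvectorBasis,
    fun k => (singVal z x k)⁻¹ •
      stackMap z x ((gram_posSemidef x).isHermitian.eigenvectorBasis k), ?_, fun k => ?_⟩
  · rw [orthonormal_iff_ite]
    intro i j
    have h : bilin (gram x) ((gram_posSemidef x).isHermitian.eigenvectorBasis i)
        ((gram_posSemidef x).isHermitian.eigenvectorBasis j) =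
        (gram_posSemidef x).isHermitian.eigenvalues j * (if i = j then 1 else 0) := by
      rw [bilin_eq_inner, IsHermitian.mulVec_eigenvectorBasis, WithLp.toLp_smul,
        real_inner_smul_right]
      congr 1
      exact orthonormal_iff_ite.mp
        (gram_posSemidef x).isHermitian.eigenvectorBasis.orthonormal i j
    rw [real_inner_smul_left, real_inner_smul_right, inner_stackMap hz.le, h,
      orthonormal_iff_ite.mp (gram_posSemidef x).isHermitian.eigenvectorBasis.orthonormal i j]
    split_ifs with hij
    · subst hij
      have h2 : singVal z x i * singVal z x i =
          (gram_posSemidef x).isHermitian.eigenvalues i + z :=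
        Real.mul_self_sqrt (by linarith [(gram_posSemidef x).eigenvalues_nonneg i])
      rw [mul_one, mul_one, ← h2]
      field_simp [(hpos i).ne']
    · simp
  · rw [smul_smul, mul_inv_cancel₀ (hpos k).ne', one_smul]

theorem sum_sq_norm_stackMap_zero (y : Fin n → EuclideanSpace ℝ (Fin p))
    (u : OrthonormalBasis (Fin p) ℝ (EuclideanSpace ℝ (Fin p))) :
    ∑ i, ‖stackMap 0 y (u i)‖ ^ 2 = 1 / (n : ℝ) * ∑ j, ‖y j‖ ^ 2 := by
  have h : ∀ i, ‖stackMap 0 y (u i)‖ ^ 2 = 1 / (n : ℝ) * ∑ j, inner ℝ (y j) (u i) ^ 2 := by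
    intro i
    rw [← real_inner_self_eq_norm_sq, inner_stackMap le_rfl, gram, bilin_smul, bilin_sum]
    simp [bilin_outer, sq]
  simp_rw [h]
  rw [← Finset.mul_sum, Finset.sum_comm]
  congr 1
  exact Finset.sum_congr rfl fun j _ => u.sum_sq_inner_left (y j)

/-- The trace functional `∑ₖ φ(σₖ)`. -/
noncomputable def specSum (φ : ℝ → ℝ) (z : ℝ) (x : Fin n → EuclideanSpace ℝ (Fin p)) : ℝ :=
  ∑ k, φ (singVal z x k)

/-- The tangent functional of the Peierls inequality at `x₀` is a supporting linear form. Its norm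
is at most `c√(p/n)`: Cauchy–Schwarz over the `p` singular directions, with the Hilbert–Schmidt norm
of `n^{-1/2} yᵀ`. Supporting forms of bounded norm at every point give both convexity and the
Lipschitz bound. -/
theorem exists_specSum_support {z c : ℝ} (hz : 0 < z) {φ φ' : ℝ → ℝ}
    (hφ : ∀ x y, √z ≤ x → √z ≤ y → φ x + φ' x * (y - x) ≤ φ y)
    (hφ' : ∀ x, √z ≤ x → 0 ≤ φ' x) (hc : ∀ x, √z ≤ x → φ' x ≤ c)
    (x₀ : Fin n → EuclideanSpace ℝ (Fin p)) :
    ∃ L : (Fin n → EuclideanSpace ℝ (Fin p)) →ₗ[ℝ] ℝ,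
      (∀ x, specSum φ z x₀ + L (x - x₀) ≤ specSum φ z x) ∧
      ∀ y, |L y| ≤ c * √((p : ℝ) / n) * √(∑ j, ‖y j‖ ^ 2) := by
  obtain ⟨u, v, hv, huv⟩ := exists_orthonormal_singVal hz x₀
  refine ⟨{ toFun := fun y => ∑ i, φ' (singVal z x₀ i) * inner ℝ (stackMap 0 y (u i)) (v i)
            map_add' := ?_
            map_smul' := ?_ }, fun x => ?_, fun y => ?_⟩
  · intro y y'
    rw [← Finset.sum_add_distrib]
    refine Finset.sum_congr rfl fun i _ => ?_
    rw [← mul_add, ← inner_add_left]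
    congr 2
    ext j
    rcases j with j | j <;> simp [stackMap, inner_add_left, mul_add]
  · intro t y
    rw [RingHom.id_apply, smul_eq_mul, Finset.mul_sum]
    refine Finset.sum_congr rfl fun i _ => ?_
    have : stackMap 0 (t • y) (u i) = t • stackMap 0 y (u i) := by
      ext j
      rcases j with j | j <;> simp [stackMap, inner_smul_left]
      ring
    rw [this, real_inner_smul_left]
    ring
  · obtain ⟨a, b, hb, hab⟩ := exists_orthonormal_singVal hz x
    have := sum_tangent_le_sum_singularValues a u hb hv (stackMap z x) (stackMap z x₀) hab huv
      (Real.sqrt_nonneg z) (sqrt_le_singVal z x) (sqrt_le_singVal z x₀) hφ hφ'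
    rw [stackMap_sub] at this
    exact this
  · have hc0 : 0 ≤ c := (hφ' _ le_rfl).trans (hc _ le_rfl)
    have h1 : |∑ i, φ' (singVal z x₀ i) * inner ℝ (stackMap 0 y (u i)) (v i)|
        ≤ ∑ i, c * ‖stackMap 0 y (u i)‖ := by
      refine (Finset.abs_sum_le_sum_abs _ _).trans (Finset.sum_le_sum fun i _ => ?_)
      rw [abs_mul, abs_of_nonneg (hφ' _ (sqrt_le_singVal z x₀ i))]
      refine mul_le_mul (hc _ (sqrt_le_singVal z x₀ i)) ?_ (abs_nonneg _) hc0
      simpa [hv.1 i] using abs_real_inner_le_norm (stackMap 0 y (u i)) (v i)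
    refine h1.trans ?_
    rw [← Finset.mul_sum, mul_assoc]
    refine mul_le_mul_of_nonneg_left ?_ hc0
    rw [← Real.sqrt_mul (by positivity)]
    refine Real.le_sqrt_of_sq_le ?_
    refine (sq_sum_le_card_mul_sum_sq).trans_eq ?_
    rw [sum_sq_norm_stackMap_zero, Finset.card_univ, Fintype.card_fin]
    ring

theorem specSum_convexOn {z c : ℝ} (hz : 0 < z) {φ φ' : ℝ → ℝ}
    (hφ : ∀ x y, √z ≤ x → √z ≤ y → φ x + φ' x * (y - x) ≤ φ y)
    (hφ' : ∀ x, √z ≤ x → 0 ≤ φ' x) (hc : ∀ x, √z ≤ x → φ' x ≤ c) :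
    ConvexOn ℝ Set.univ (specSum φ z : (Fin n → EuclideanSpace ℝ (Fin p)) → ℝ) := by
  refine ⟨convex_univ, fun x _ y _ a b ha hb hab => ?_⟩
  obtain ⟨L, hL, -⟩ := exists_specSum_support hz hφ hφ' hc (a • x + b • y)
  have h1 := mul_le_mul_of_nonneg_left (hL x) ha
  have h2 := mul_le_mul_of_nonneg_left (hL y) hb
  have h3 : a * L (x - (a • x + b • y)) + b * L (y - (a • x + b • y)) = 0 := by
    rw [← smul_eq_mul, ← smul_eq_mul, ← map_smul, ← map_smul, ← map_add]
    have : a • (x - (a • x + b • y)) + b • (y - (a • x + b • y)) = 0 := by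
      have : b = 1 - a := by linarith
      subst this
      module
    rw [this, map_zero]
  have h4 : a * specSum φ z (a • x + b • y) + b * specSum φ z (a • x + b • y)
      = specSum φ z (a • x + b • y) := by rw [← add_mul, hab, one_mul]
  simp only [smul_eq_mul]
  linarith

theorem abs_specSum_sub_le {z c : ℝ} (hz : 0 < z) {φ φ' : ℝ → ℝ}
    (hφ : ∀ x y, √z ≤ x → √z ≤ y → φ x + φ' x * (y - x) ≤ φ y)
    (hφ' : ∀ x, √z ≤ x → 0 ≤ φ' x) (hc : ∀ x, √z ≤ x → φ' x ≤ c)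
    (x y : Fin n → EuclideanSpace ℝ (Fin p)) :
    |specSum φ z x - specSum φ z y| ≤ c * √((p : ℝ) / n) * √(∑ j, ‖x j - y j‖ ^ 2) := by
  have key : ∀ x y : Fin n → EuclideanSpace ℝ (Fin p),
      specSum φ z x - specSum φ z y ≤ c * √((p : ℝ) / n) * √(∑ j, ‖x j - y j‖ ^ 2) := by
    intro x y
    obtain ⟨L, hL, hL'⟩ := exists_specSum_support hz hφ hφ' hc x
    have h1 := hL y
    have h2 := neg_le_of_abs_le (hL' (y - x))
    have h3 : ∑ j, ‖(y - x) j‖ ^ 2 = ∑ j, ‖x j - y j‖ ^ 2 :=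
      Finset.sum_congr rfl fun j _ => by rw [Pi.sub_apply, norm_sub_rev]
    rw [h3] at h2
    linarith
  rw [abs_le]
  refine ⟨?_, key x y⟩
  have := key y x
  simp only [norm_sub_rev (y _)] at this
  linarith

theorem trace_resolventAt_eq_sum {S : Matrix (Fin p) (Fin p) ℝ} (hS : S.PosSemidef) {z : ℝ}
    (hz : 0 < z) :
    (resolventAt S z).trace = ∑ k, 1 / (hS.isHermitian.eigenvalues k + z) := by
  have hne : ∀ k, hS.isHermitian.eigenvalues k + z ≠ 0 := fun k => by
    have := hS.eigenvalues_nonneg k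
    positivity
  set a := hS.isHermitian.eigenvectorBasis
  have h1 : ∀ k, resolventAt S z *ᵥ (a k).ofLp
      = (1 / (hS.isHermitian.eigenvalues k + z)) • (a k).ofLp := by
    intro k
    have h : (S + z • (1 : Matrix (Fin p) (Fin p) ℝ)) *ᵥ (a k).ofLp
        = (hS.isHermitian.eigenvalues k + z) • (a k).ofLp := by
      rw [add_mulVec, hS.isHermitian.mulVec_eigenvectorBasis, smul_mulVec, one_mulVec, add_smul]
    have h' := congrArg (fun v => resolventAt S z *ᵥ v) h
    simp only [mulVec_mulVec, resolventAt_mul_add_smul_one hS hz, one_mulVec, mulVec_smul] at h'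
    rw [h', smul_smul, one_div, inv_mul_cancel₀ (hne k), one_smul, ← h']
  have h2 : (∑ k, outer (a k)) = 1 := by
    ext i j
    have := a.sum_inner_mul_inner (EuclideanSpace.single i 1) (EuclideanSpace.single j 1)
    simp only [EuclideanSpace.inner_single_left, EuclideanSpace.inner_single_right] at this
    simp only [Matrix.sum_apply, outer, vecMulVec_apply, Matrix.one_apply]
    simpa [Pi.single_apply, eq_comm] using this
  rw [← Matrix.mul_one (resolventAt S z), ← h2, Finset.mul_sum, trace_sum]
  refine Finset.sum_congr rfl fun k _ => ?_
  rw [trace_mul_outer, bilin, h1, dotProduct_smul, smul_eq_mul]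
  have : (a k).ofLp ⬝ᵥ (a k).ofLp = 1 := by
    have h := trace_outer (a k)
    rw [outer, trace_vecMulVec, OrthonormalBasis.norm_eq_one] at h
    simpa using h
  rw [this, mul_one]

theorem stieltjes_spectralDistribution {S : Matrix (Fin p) (Fin p) ℝ} (hS : S.PosSemidef)
    {z : ℝ} (hz : 0 < z) (h : S.IsHermitian) :
    stieltjes (spectralDistribution h) (-z) = 1 / (p : ℝ) * (resolventAt S z).trace := by
  rw [stieltjes, spectralDistribution, integral_smul_measure, integral_finsetSum_measure,
    trace_resolventAt_eq_sum hS hz, ENNReal.toReal_ofReal (by positivity), smul_eq_mul]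
  · simp
  · intro i _
    exact integrable_dirac (by simp)

theorem exists_trace_resolventAt_gram_eq_sub {z : ℝ} (hz : 0 < z) :
    ∃ F G : (Fin n → EuclideanSpace ℝ (Fin p)) → ℝ,
      ConvexOn ℝ Set.univ F ∧ ConvexOn ℝ Set.univ G ∧
      (∀ x y, |F x - F y| ≤ 2 / √z ^ 3 * √((p : ℝ) / n) * √(∑ j, ‖x j - y j‖ ^ 2)) ∧
      (∀ x y, |G x - G y| ≤ 2 / √z ^ 3 * √((p : ℝ) / n) * √(∑ j, ‖x j - y j‖ ^ 2)) ∧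
      ∀ x, (resolventAt (gram x) z).trace = F x - G x := by
  -- The derivative of `σ⁻²` is at least `-2/√z³` on `[√z, ∞)`, so adding `κσ` makes it
  -- nondecreasing while keeping it convex.
  set κ := 2 / √z ^ 3 with hκ
  have hs : 0 < √z := Real.sqrt_pos.mpr hz
  have hκ0 : 0 ≤ κ := by positivity
  have h1 : ∀ x y, √z ≤ x → √z ≤ y →
      (1 / x ^ 2 + κ * x) + (κ - 2 / x ^ 3) * (y - x) ≤ 1 / y ^ 2 + κ * y := by
    intro x y hx hy
    have hx0 := hs.trans_le hx
    have hy0 := hs.trans_le hy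
    have : 1 / y ^ 2 - (1 / x ^ 2 - 2 / x ^ 3 * (y - x))
        = (x - y) ^ 2 * (x + 2 * y) / (x ^ 3 * y ^ 2) := by
      field_simp
      ring
    have h2 : 0 ≤ (x - y) ^ 2 * (x + 2 * y) / (x ^ 3 * y ^ 2) := by positivity
    linarith
  have h2 : ∀ x, √z ≤ x → 0 ≤ κ - 2 / x ^ 3 := by
    intro x hx
    rw [sub_nonneg, hκ]
    gcongr
  have h3 : ∀ x, √z ≤ x → κ - 2 / x ^ 3 ≤ κ := by
    intro x hx
    have hx0 := hs.trans_le hx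
    have : 0 ≤ 2 / x ^ 3 := by positivity
    linarith
  have h4 : ∀ x y, √z ≤ x → √z ≤ y → κ * x + κ * (y - x) ≤ κ * y := fun x y _ _ => by
    linarith
  refine ⟨specSum (fun y => 1 / y ^ 2 + κ * y) z, specSum (fun y => κ * y) z,
    specSum_convexOn (φ' := fun x => κ - 2 / x ^ 3) hz h1 h2 h3,
    specSum_convexOn (φ' := fun _ => κ) hz h4 (fun _ _ => hκ0) (fun _ _ => le_rfl),
    abs_specSum_sub_le (φ' := fun x => κ - 2 / x ^ 3) hz h1 h2 h3,
    abs_specSum_sub_le (φ' := fun _ => κ) hz h4 (fun _ _ => hκ0) (fun _ _ => le_rfl), fun x => ?_⟩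
  rw [trace_resolventAt_eq_sum (gram_posSemidef x) hz, specSum, specSum, ← Finset.sum_sub_distrib]
  refine Finset.sum_congr rfl fun k _ => ?_
  rw [add_sub_cancel_right, singVal,
    Real.sq_sqrt (by linarith [(gram_posSemidef x).eigenvalues_nonneg k])]

end TraceFunctions

/-! ### Moments from concentration of independent copies -/

section SelfConcentration

theorem SelfConcentrated.of_measurePreserving {Ω Ω' : Type*} [MeasurableSpace Ω]
    [MeasurableSpace Ω'] {P : Measure Ω} {P' : Measure Ω'} [IsProbabilityMeasure P]
    [IsProbabilityMeasure P'] {φ : Ω → Ω'} (hφ : MeasurePreserving φ P P') {Z : Ω' → ℝ}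
    (hZ : Measurable Z) {α : ℝ → ℝ} (h : SelfConcentrated P (fun ω => Z (φ ω)) α) :
    SelfConcentrated P' Z α := by
  intro t ht
  have hm : MeasurableSet {w : Ω' × Ω' | t ≤ |Z w.1 - Z w.2|} :=
    measurableSet_le measurable_const
      ((hZ.comp measurable_fst).sub (hZ.comp measurable_snd)).abs
  rw [← (hφ.prod hφ).measure_preimage hm.nullMeasurableSet]
  exact h t ht

/-- The bound on the moment of order `r` given by the concentration function
`t ↦ C₀ exp (-t^q / c₀)`. -/
noncomputable def momentBound (q C₀ c₀ : ℝ) (r : ℕ) : ENNReal :=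
  ENNReal.ofReal r * ∫⁻ t in Set.Ioi (0 : ℝ),
    ENNReal.ofReal (C₀ * Real.exp (-(t ^ q / c₀))) * ENNReal.ofReal (t ^ ((r : ℝ) - 1))

theorem momentBound_ne_top {q C₀ c₀ : ℝ} (hq : 0 < q) (hc₀ : 0 < c₀) (hC₀ : 0 ≤ C₀)
    {r : ℕ} (hr : 0 < r) : momentBound q C₀ c₀ r ≠ ⊤ := by
  refine ENNReal.mul_ne_top ENNReal.ofReal_ne_top ?_
  have hr' : (1 : ℝ) ≤ r := by exact_mod_cast hr
  have h := (integrableOn_rpow_mul_exp_neg_mul_rpow (p := q) (s := (r : ℝ) - 1) (b := 1 / c₀)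
    (by linarith) hq (by positivity)).const_mul C₀
  have h2 := h.lintegral_lt_top
  have e : ∀ t : ℝ, ENNReal.ofReal (C₀ * Real.exp (-(t ^ q / c₀))) *
      ENNReal.ofReal (t ^ ((r : ℝ) - 1))
      = ENNReal.ofReal (C₀ * (t ^ ((r : ℝ) - 1) * Real.exp (-(1 / c₀) * t ^ q))) := by
    intro t
    rw [← ENNReal.ofReal_mul (by positivity)]
    congr 1
    rw [show -(1 / c₀) * t ^ q = -(t ^ q / c₀) by ring]
    ring
  simp_rw [e]
  exact h2.ne

theorem SelfConcentrated.lintegral_pow_le {Ω : Type*} [MeasurableSpace Ω] {P : Measure Ω}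
    [IsProbabilityMeasure P] {Z : Ω → ℝ} (hZ : Measurable Z) {q C₀ c₀ : ℝ}
    (h : SelfConcentrated P Z fun t => C₀ * Real.exp (-(t ^ q / c₀))) {r : ℕ} (hr : 0 < r) :
    ∫⁻ w, ENNReal.ofReal (|Z w.1 - Z w.2| ^ r) ∂(P.prod P) ≤ momentBound q C₀ c₀ r := by
  have hr' : (0 : ℝ) < r := by exact_mod_cast hr
  have hm : Measurable fun w : Ω × Ω => |Z w.1 - Z w.2| :=
    ((hZ.comp measurable_fst).sub (hZ.comp measurable_snd)).abs
  have := lintegral_rpow_eq_lintegral_meas_le_mul (P.prod P)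
    (f := fun w : Ω × Ω => |Z w.1 - Z w.2|) (Filter.Eventually.of_forall fun _ => abs_nonneg _)
    hm.aemeasurable hr'
  simp_rw [Real.rpow_natCast] at this
  rw [this, momentBound]
  refine mul_le_mul le_rfl (setLIntegral_mono' measurableSet_Ioi fun t ht => ?_) zero_le
    zero_le
  gcongr
  exact h t ht

theorem integrable_of_lintegral_le {Ω : Type*} [MeasurableSpace Ω] {P : Measure Ω} {f : Ω → ℝ}
    (hf : Measurable f) (h0 : ∀ ω, 0 ≤ f ω) {B : ENNReal} (hB : B ≠ ⊤)
    (h : ∫⁻ ω, ENNReal.ofReal (f ω) ∂P ≤ B) : Integrable f P ∧ ∫ ω, f ω ∂P ≤ B.toReal := by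
  have hi : Integrable f P := by
    refine ⟨hf.aestronglyMeasurable, ?_⟩
    rw [hasFiniteIntegral_iff_ofReal (Filter.Eventually.of_forall h0)]
    exact h.trans_lt hB.lt_top
  refine ⟨hi, ?_⟩
  rw [integral_eq_lintegral_of_nonneg_ae (Filter.Eventually.of_forall h0) hi.1]
  exact ENNReal.toReal_mono hB h

theorem SelfConcentrated.integral_pow_le {Ω : Type*} [MeasurableSpace Ω] {P : Measure Ω}
    [IsProbabilityMeasure P] {Z : Ω → ℝ} (hZ : Measurable Z) {q C₀ c₀ : ℝ} (hq : 0 < q)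
    (hc₀ : 0 < c₀) (hC₀ : 0 ≤ C₀)
    (h : SelfConcentrated P Z fun t => C₀ * Real.exp (-(t ^ q / c₀))) {r : ℕ} (hr : 0 < r) :
    Integrable (fun w : Ω × Ω => |Z w.1 - Z w.2| ^ r) (P.prod P) ∧
    ∫ w, |Z w.1 - Z w.2| ^ r ∂(P.prod P) ≤ (momentBound q C₀ c₀ r).toReal :=
  integrable_of_lintegral_le
    (((hZ.comp measurable_fst).sub (hZ.comp measurable_snd)).abs.pow_const r)
    (fun _ => by positivity) (momentBound_ne_top hq hc₀ hC₀ hr) (h.lintegral_pow_le hZ hr)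

/-- By Fubini some value `Z ω` of the second copy makes `|Z - Z ω|^r` integrable, and a constant
shift does not affect membership in `L^r`. -/
theorem memLp_of_integrable_prod {Ω : Type*} [MeasurableSpace Ω] {P : Measure Ω}
    [IsProbabilityMeasure P] {Z : Ω → ℝ} (hZ : Measurable Z) {r : ℕ} (hr : 0 < r)
    (h : Integrable (fun w : Ω × Ω => |Z w.1 - Z w.2| ^ r) (P.prod P)) : MemLp Z r P := by
  obtain ⟨ω, hω⟩ := h.prod_left_ae.exists
  have h1 : MemLp (fun ω' => Z ω' - Z ω) r P := by
    rw [← integrable_norm_rpow_iff (hZ.sub_const _).aestronglyMeasurable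
      (by exact_mod_cast hr.ne') (by simp)]
    simpa using hω
  have h2 := h1.add (memLp_const (Z ω))
  refine h2.congr_norm hZ.aestronglyMeasurable (Filter.Eventually.of_forall fun x => ?_)
  simp

theorem integral_prod_sub_sq {Ω : Type*} [MeasurableSpace Ω] {P : Measure Ω}
    [IsProbabilityMeasure P] {Z : Ω → ℝ} (hZ : MemLp Z 2 P) :
    ∫ w, (Z w.1 - Z w.2) ^ 2 ∂(P.prod P) = 2 * ∫ ω, (Z ω - ∫ x, Z x ∂P) ^ 2 ∂P := by
  set m := ∫ x, Z x ∂P with hm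
  set Y : Ω → ℝ := fun ω => Z ω - m with hY
  have hYL : MemLp Y 2 P := hZ.sub (memLp_const m)
  have hYi : Integrable Y P := hYL.integrable one_le_two
  have hY0 : ∫ ω, Y ω ∂P = 0 := by
    rw [hY, integral_sub (hZ.integrable one_le_two) (integrable_const _)]
    simp [hm]
  have hYs : Integrable (fun ω => Y ω ^ 2) P := hYL.integrable_sq
  have e : ∀ w : Ω × Ω, (Z w.1 - Z w.2) ^ 2 = Y w.1 ^ 2 + Y w.2 ^ 2 - 2 * (Y w.1 * Y w.2) := by
    intro w; simp only [hY]; ring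
  simp_rw [e]
  have i1 : Integrable (fun w : Ω × Ω => Y w.1 ^ 2) (P.prod P) := hYs.comp_fst P
  have i2 : Integrable (fun w : Ω × Ω => Y w.2 ^ 2) (P.prod P) := hYs.comp_snd P
  have i3 : Integrable (fun w : Ω × Ω => Y w.1 * Y w.2) (P.prod P) := hYi.mul_prod hYi
  have h1 := integral_sub (i1.add i2) (i3.const_mul 2)
  have h2 := integral_add i1 i2
  simp only [Pi.add_apply] at h1
  rw [h1, h2, integral_const_mul,
    integral_prod_mul, hY0, integral_fun_fst (fun ω => Y ω ^ 2), integral_fun_snd (fun ω => Y ω ^ 2)]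
  simp
  ring

end SelfConcentration

/-! ### Concentration of functions of samples from one class -/

section ClassLaw

variable {p k : ℕ}

section

attribute [local instance] Matrix.frobeniusNormedAddCommGroup Matrix.frobeniusNormedSpace

theorem norm_ofColumns (x : Matrix (Fin p) (Fin k) ℝ) :
    √(∑ j, ‖(WithLp.toLp 2 (fun i => x i j) : EuclideanSpace ℝ (Fin p))‖ ^ 2) = ‖x‖ := by
  rw [Matrix.frobenius_norm_def, ← Real.sqrt_eq_rpow, Finset.sum_comm]
  congr 1
  refine Finset.sum_congr rfl fun j _ => ?_
  rw [EuclideanSpace.real_norm_sq_eq]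
  simp

theorem ClassConcentration.selfConcentrated_pi {q C₀ c₀ : ℝ}
    {μ : Fin k → Measure (EuclideanSpace ℝ (Fin p))} (h : ClassConcentration q C₀ c₀ μ)
    (l : Fin k) {m : ℕ} {F : (Fin m → EuclideanSpace ℝ (Fin p)) → ℝ}
    (hF : QuasiconvexOn ℝ Set.univ F) {L : ℝ} (hL : 0 < L)
    (hLip : ∀ x y, |F x - F y| ≤ L * √(∑ j, ‖x j - y j‖ ^ 2)) :
    SelfConcentrated (Measure.pi fun _ : Fin m => μ l) F
      fun t => C₀ * Real.exp (-((t / L) ^ q / c₀)) := by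
  -- The columns of a matrix, as a linear map inverse to `ofColumns`. Precomposition with it carries
  -- quasiconvexity to the matrix space, and the Frobenius norm is the `ℓ²` norm of the columns.
  set cols : Matrix (Fin p) (Fin m) ℝ →ₗ[ℝ] (Fin m → EuclideanSpace ℝ (Fin p)) :=
    { toFun := fun Y j => WithLp.toLp 2 fun i => Y i j
      map_add' := fun _ _ => rfl
      map_smul' := fun _ _ => rfl } with hcols
  have hc : ∀ x : Fin m → EuclideanSpace ℝ (Fin p), cols (ofColumns x) = x := fun x => rfl
  have hlip : LipschitzWith 1 fun Y => L⁻¹ * F (cols Y) := by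
    refine LipschitzWith.of_dist_le_mul fun Y Y' => ?_
    rw [Real.dist_eq, dist_eq_norm, ← norm_ofColumns, ← mul_sub, abs_mul,
      abs_of_pos (inv_pos.mpr hL), NNReal.coe_one, one_mul, inv_mul_le_iff₀ hL]
    exact hLip _ _
  have hquasi : QuasiconvexOn ℝ Set.univ fun Y => L⁻¹ * F (cols Y) := by
    intro r
    have h1 := hF (L * r)
    simp only [Set.mem_univ, true_and] at h1 ⊢
    have h2 := h1.linear_preimage cols
    convert! h2 using 1
    ext Y
    simp [inv_mul_le_iff₀ hL]
  intro t ht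
  have h1 := h l m _ hlip hquasi (t / L) (by positivity)
  simp only [hc] at h1
  convert! h1 using 3
  ext w
  rw [← mul_sub, abs_mul, abs_of_pos (inv_pos.mpr hL), div_eq_inv_mul,
    mul_le_mul_iff_right₀ (inv_pos.mpr hL)]

end

theorem ClassConcentration.convexlyConcentrated {q C₀ c₀ : ℝ}
    {μ : Fin k → Measure (EuclideanSpace ℝ (Fin p))} [∀ l, IsProbabilityMeasure (μ l)]
    (h : ClassConcentration q C₀ c₀ μ) (l : Fin k) :
    ConvexlyConcentrated (μ l) (fun y => y) fun t => C₀ * Real.exp (-(t ^ q / c₀)) := by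
  intro f hf hq
  have h1 := h.selfConcentrated_pi l (m := 1) (F := fun x => f (x 0)) (L := 1)
    (by
      intro r
      have := (hq r).linear_preimage (LinearMap.proj (R := ℝ)
        (φ := fun _ : Fin 1 => EuclideanSpace ℝ (Fin p)) 0)
      convert! this using 1) one_pos
    (fun x y => by
      have := hf.dist_le_mul (x 0) (y 0)
      rw [Real.dist_eq, dist_eq_norm] at this
      simpa [Real.sqrt_sq] using this)
  simp only [div_one] at h1
  exact SelfConcentrated.of_measurePreserving
    (measurePreserving_eval (fun _ : Fin 1 => μ l) 0) hf.continuous.measurable h1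

/-- Moments of a Lipschitz quasiconvex function of a convexly concentrated vector. -/
theorem ConvexlyConcentrated.integral_pow_le {q C₀ c₀ : ℝ} (hq : 0 < q) (hc₀ : 0 < c₀)
    (hC₀ : 0 ≤ C₀) {μ : Measure (EuclideanSpace ℝ (Fin p))} [IsProbabilityMeasure μ]
    (h : ConvexlyConcentrated μ (fun y => y) fun t => C₀ * Real.exp (-(t ^ q / c₀)))
    {f : EuclideanSpace ℝ (Fin p) → ℝ} (hf : ConvexOn ℝ Set.univ f) {L : ℝ} (hL : 0 < L)
    (hLip : ∀ x y, |f x - f y| ≤ L * ‖x - y‖) {r : ℕ} (hr : 0 < r) :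
    MemLp f r μ ∧ Integrable (fun w : _ × _ => |f w.1 - f w.2| ^ r) (μ.prod μ) ∧
    ∫ w, |f w.1 - f w.2| ^ r ∂(μ.prod μ) ≤ L ^ r * (momentBound q C₀ c₀ r).toReal := by
  have hcont : Continuous f := by
    refine (LipschitzWith.of_dist_le_mul (K := ⟨L, hL.le⟩) fun x y => ?_).continuous
    rw [Real.dist_eq, dist_eq_norm]; exact hLip x y
  have hlip : LipschitzWith 1 fun y => L⁻¹ * f y := by
    refine LipschitzWith.of_dist_le_mul fun x y => ?_
    rw [Real.dist_eq, dist_eq_norm, ← mul_sub, abs_mul,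
      abs_of_pos (inv_pos.mpr hL), NNReal.coe_one, one_mul, inv_mul_le_iff₀ hL]
    exact hLip _ _
  have hconv : ConvexOn ℝ Set.univ fun y => L⁻¹ * f y := hf.smul (inv_nonneg.mpr hL.le)
  have hsc : SelfConcentrated μ (fun y => L⁻¹ * f y) fun t => C₀ * Real.exp (-(t ^ q / c₀)) :=
    h _ hlip hconv.quasiconvexOn
  obtain ⟨h1, h2⟩ := hsc.integral_pow_le (hcont.measurable.const_mul _) hq hc₀ hC₀ hr
  have e : ∀ w : EuclideanSpace ℝ (Fin p) × EuclideanSpace ℝ (Fin p),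
      |f w.1 - f w.2| ^ r = L ^ r * |L⁻¹ * f w.1 - L⁻¹ * f w.2| ^ r := by
    intro w
    rw [← mul_sub, abs_mul, abs_of_pos (inv_pos.mpr hL), mul_pow, ← mul_assoc, ← mul_pow,
      mul_inv_cancel₀ hL.ne', one_pow, one_mul]
  have hi : Integrable (fun w : EuclideanSpace ℝ (Fin p) × EuclideanSpace ℝ (Fin p) =>
      |f w.1 - f w.2| ^ r) (μ.prod μ) := by
    simp_rw [e]; exact h1.const_mul _
  refine ⟨memLp_of_integrable_prod hcont.measurable hr hi, hi, ?_⟩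
  simp_rw [e]
  rw [integral_const_mul]
  gcongr

end ClassLaw

/-! ### Covariance, fourth moment and quadratic forms of a concentrated vector -/

section LawMoments

open Matrix
open scoped Matrix.Norms.L2Operator

variable {p : ℕ}

theorem norm_le_of_bilin_le {D : Matrix (Fin p) (Fin p) ℝ} (hD : D.PosSemidef) {c : ℝ}
    (hc : 0 ≤ c) (h : ∀ u : EuclideanSpace ℝ (Fin p), bilin D u u ≤ c * ‖u‖ ^ 2) : ‖D‖ ≤ c := by
  have cs : ∀ u v : EuclideanSpace ℝ (Fin p), bilin D u v ^ 2 ≤ bilin D u u * bilin D v v := by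
    obtain ⟨m, w, rfl⟩ := posSemidef_exists_outer hD
    intro u v
    simp only [bilin_sum, bilin_outer]
    simpa [sq] using Finset.sum_mul_sq_le_sq_mul_sq Finset.univ
      (fun i => inner ℝ (w i) u) (fun i => inner ℝ (w i) v)
  refine l2_opNorm_le_of_forall hc fun v => ?_
  set w : EuclideanSpace ℝ (Fin p) := WithLp.toLp 2 (D *ᵥ v.ofLp) with hw
  have h1 : bilin D w v = ‖w‖ ^ 2 := by rw [bilin_eq_inner, ← hw, real_inner_self_eq_norm_sq]
  have h2 := cs w v
  rw [h1] at h2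
  have h3 : (‖w‖ ^ 2) ^ 2 ≤ (c * ‖w‖ ^ 2) * (c * ‖v‖ ^ 2) :=
    h2.trans (mul_le_mul (h w) (h v) (bilin_self_nonneg hD v) (by positivity))
  rcases (norm_nonneg w).eq_or_lt with h0 | h0
  · rw [← h0]; positivity
  · have h4 : ‖w‖ ^ 2 ≤ (c * ‖v‖) ^ 2 := by
      have : 0 < ‖w‖ ^ 2 := by positivity
      nlinarith
    exact le_of_sq_le_sq h4 (by positivity)

theorem trace_le_card_mul_norm (D : Matrix (Fin p) (Fin p) ℝ) : D.trace ≤ p * ‖D‖ := by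
  have := abs_trace_mul_le D (PosSemidef.one (n := Fin p) (R := ℝ))
  rw [Matrix.mul_one, trace_one, Fintype.card_fin, mul_comm] at this
  exact (le_abs_self _).trans this

variable {μ : Measure (EuclideanSpace ℝ (Fin p))}

theorem integrable_inner_mul_inner (hμ : MemLp (fun y => y) 2 μ)
    (u v : EuclideanSpace ℝ (Fin p)) :
    Integrable (fun y => inner ℝ u y * inner ℝ v y) μ :=
  MemLp.integrable_mul (hμ.const_inner u) (hμ.const_inner v)

theorem integrable_coord_mul_coord (hμ : MemLp (fun y => y) 2 μ) (i j : Fin p) :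
    Integrable (fun y : EuclideanSpace ℝ (Fin p) => y i * y j) μ := by
  simpa [EuclideanSpace.inner_single_left] using
    integrable_inner_mul_inner hμ (EuclideanSpace.single i 1) (EuclideanSpace.single j 1)

theorem bilin_populationCov (hμ : MemLp (fun y => y) 2 μ) (u v : EuclideanSpace ℝ (Fin p)) :
    bilin (populationCov μ) u v = ∫ y, inner ℝ u y * inner ℝ v y ∂μ := by
  have e : ∀ y : EuclideanSpace ℝ (Fin p), inner ℝ u y * inner ℝ v y =
      ∑ i, ∑ j, u i * v j * (y i * y j) := by
    intro y
    simp only [PiLp.inner_apply, RCLike.inner_apply, conj_trivial]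
    rw [Finset.sum_mul_sum]
    exact Finset.sum_congr rfl fun i _ => Finset.sum_congr rfl fun j _ => by ring
  simp_rw [e]
  rw [integral_finsetSum _ fun i _ => integrable_finsetSum _ fun j _ =>
    (integrable_coord_mul_coord hμ i j).const_mul _]
  simp only [bilin, dotProduct, mulVec, Finset.mul_sum]
  refine Finset.sum_congr rfl fun i _ => ?_
  rw [integral_finsetSum _ fun j _ => (integrable_coord_mul_coord hμ i j).const_mul _]
  refine Finset.sum_congr rfl fun j _ => ?_
  rw [integral_const_mul, populationCov, Matrix.of_apply]
  ring

theorem populationCov_posSemidef (hμ : MemLp (fun y => y) 2 μ) :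
    (populationCov μ).PosSemidef := by
  refine PosSemidef.of_dotProduct_mulVec_nonneg ?_ fun x => ?_
  · ext i j
    simp [populationCov, mul_comm]
  · have := bilin_populationCov hμ (WithLp.toLp 2 x) (WithLp.toLp 2 x)
    rw [star_trivial]
    change 0 ≤ bilin (populationCov μ) (WithLp.toLp 2 x) (WithLp.toLp 2 x)
    rw [this]
    exact integral_nonneg fun y => mul_self_nonneg _

theorem bilin_eq_sum (A : Matrix (Fin p) (Fin p) ℝ) (y : EuclideanSpace ℝ (Fin p)) :
    bilin A y y = ∑ i, ∑ j, A i j * (y j * y i) := by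
  simp only [bilin, dotProduct, mulVec, Finset.mul_sum]
  exact Finset.sum_congr rfl fun i _ => Finset.sum_congr rfl fun j _ => by ring

theorem integrable_bilin (hμ : MemLp (fun y => y) 2 μ) (A : Matrix (Fin p) (Fin p) ℝ) :
    Integrable (fun y => bilin A y y) μ := by
  simp_rw [bilin_eq_sum]
  exact integrable_finsetSum _ fun i _ => integrable_finsetSum _ fun j _ =>
    (integrable_coord_mul_coord hμ j i).const_mul _

theorem trace_mul_populationCov (hμ : MemLp (fun y => y) 2 μ) (A : Matrix (Fin p) (Fin p) ℝ) :
    (A * populationCov μ).trace = ∫ y, bilin A y y ∂μ := by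
  simp_rw [bilin_eq_sum]
  rw [integral_finsetSum Finset.univ (f := fun i (y : EuclideanSpace ℝ (Fin p)) =>
    ∑ j, A i j * (y j * y i)) fun i _ => integrable_finsetSum _ fun j _ =>
    (integrable_coord_mul_coord hμ j i).const_mul _]
  simp only [Matrix.trace, Matrix.diag, Matrix.mul_apply]
  refine Finset.sum_congr rfl fun i _ => ?_
  rw [integral_finsetSum _ fun j _ => (integrable_coord_mul_coord hμ j i).const_mul _]
  refine Finset.sum_congr rfl fun j _ => ?_
  rw [integral_const_mul, populationCov, Matrix.of_apply]

theorem trace_populationCov (hμ : MemLp (fun y => y) 2 μ) :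
    (populationCov μ).trace = ∫ y, ‖y‖ ^ 2 ∂μ := by
  have := trace_mul_populationCov hμ 1
  rw [Matrix.one_mul] at this
  rw [this]
  refine integral_congr_ae (Filter.Eventually.of_forall fun y => ?_)
  simp only [← trace_outer, ← trace_mul_outer, Matrix.one_mul]

/-! ### Centring -/

variable [IsProbabilityMeasure μ]

theorem ConvexlyConcentrated.map_sub {α : ℝ → ℝ}
    (h : ConvexlyConcentrated μ (fun y => y) α) (m : EuclideanSpace ℝ (Fin p)) :
    ConvexlyConcentrated (μ.map fun y => y - m) (fun y => y) α := by
  intro f hf hq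
  have : IsProbabilityMeasure (μ.map fun y => y - m) :=
    Measure.isProbabilityMeasure_map (by fun_prop)
  have h1 := h (fun y => f (y - m))
    (LipschitzWith.of_dist_le_mul fun x y => by
      simpa using hf.dist_le_mul (x - m) (y - m))
    (by
      intro r
      have := (hq r).translate_preimage_left (-m)
      convert! this using 1)
  exact SelfConcentrated.of_measurePreserving
    (⟨by fun_prop, rfl⟩ : MeasurePreserving (fun y => y - m) μ (μ.map fun y => y - m))
    hf.continuous.measurable h1

theorem memLp_map_sub {r : ENNReal} (hμ : MemLp (fun y => y) r μ)
    (m : EuclideanSpace ℝ (Fin p)) : MemLp (fun y => y) r (μ.map fun y => y - m) := by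
  rw [memLp_map_measure_iff (by fun_prop) (by fun_prop)]
  exact hμ.sub (memLp_const m)

theorem integral_map_sub_mean (hμ : MemLp (fun y => y) 2 μ) :
    ∫ y, y ∂(μ.map fun y => y - ∫ x, x ∂μ) = 0 := by
  rw [integral_map (by fun_prop) (by fun_prop),
    integral_sub (hμ.integrable one_le_two) (integrable_const _)]
  simp

theorem populationCov_eq_add_outer (hμ : MemLp (fun y => y) 2 μ) :
    populationCov μ = populationCov (μ.map fun y => y - ∫ x, x ∂μ) + outer (∫ x, x ∂μ) := by
  set m := ∫ x, x ∂μ with hm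
  ext i j
  have hc : ∀ i, Integrable (fun y : EuclideanSpace ℝ (Fin p) => y i) μ := fun i =>
    (hμ.integrable one_le_two).eval_piLp i
  have hmi : ∀ i, ∫ y : EuclideanSpace ℝ (Fin p), y i ∂μ = m i := fun i => by
    rw [hm, eval_integral_piLp fun i => hc i]
  rw [Matrix.add_apply, populationCov, populationCov, Matrix.of_apply, Matrix.of_apply,
    integral_map (by fun_prop) (by fun_prop), outer, vecMulVec_apply]
  have e : ∀ y : EuclideanSpace ℝ (Fin p),
      (y - m) i * (y - m) j = y i * y j - (m j * y i + m i * y j - m i * m j) := by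
    intro y
    simp only [PiLp.sub_apply]
    ring
  simp_rw [e]
  have i1 : Integrable (fun y : EuclideanSpace ℝ (Fin p) => m j * y i + m i * y j) μ :=
    ((hc i).const_mul _).add ((hc j).const_mul _)
  have h1 := integral_sub (integrable_coord_mul_coord hμ i j)
    (i1.sub (integrable_const (m i * m j)))
  have h2 := integral_sub i1 (integrable_const (m i * m j))
  simp only [Pi.sub_apply] at h1
  rw [h1, h2, integral_add ((hc i).const_mul _) ((hc j).const_mul _), integral_const_mul,
    integral_const_mul, hmi, hmi]
  simp
  ring

/-! ### Moment bounds for convexly concentrated laws -/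

theorem ConvexlyConcentrated.memLp_four {q C₀ c₀ : ℝ} (hq : 0 < q) (hc₀ : 0 < c₀)
    (hC₀ : 0 ≤ C₀)
    (h : ConvexlyConcentrated μ (fun y => y) fun t => C₀ * Real.exp (-(t ^ q / c₀))) :
    MemLp (fun y => y) 4 μ := by
  have := (h.integral_pow_le hq hc₀ hC₀ (f := fun y => ‖y‖) (convexOn_norm convex_univ) one_pos
    (fun x y => by simpa using abs_norm_sub_norm_le x y) (r := 4) (by norm_num)).1
  exact (memLp_norm_iff (by fun_prop)).mp (by exact_mod_cast this)

theorem ConvexlyConcentrated.memLp_two {q C₀ c₀ : ℝ} (hq : 0 < q) (hc₀ : 0 < c₀)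
    (hC₀ : 0 ≤ C₀)
    (h : ConvexlyConcentrated μ (fun y => y) fun t => C₀ * Real.exp (-(t ^ q / c₀))) :
    MemLp (fun y => y) 2 μ :=
  (h.memLp_four hq hc₀ hC₀).mono_exponent (by norm_num)

/-- Linear forms are convex, and twice the variance of `⟨u, y⟩` is the second moment of the
difference of two copies. For centred laws the covariance is therefore bounded independently of the
dimension. -/
theorem ConvexlyConcentrated.norm_populationCov_le {q C₀ c₀ : ℝ} (hq : 0 < q) (hc₀ : 0 < c₀)
    (hC₀ : 0 ≤ C₀)
    (h : ConvexlyConcentrated μ (fun y => y) fun t => C₀ * Real.exp (-(t ^ q / c₀)))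
    (h0 : ∫ y, y ∂μ = 0) :
    ‖populationCov μ‖ ≤ (momentBound q C₀ c₀ 2).toReal := by
  have hμ := h.memLp_two hq hc₀ hC₀
  refine norm_le_of_bilin_le (populationCov_posSemidef hμ) ENNReal.toReal_nonneg fun u => ?_
  rcases eq_or_ne u 0 with rfl | hu
  · simp [bilin]
  have hu' := norm_pos_iff.mpr hu
  obtain ⟨h1, -, h3⟩ := h.integral_pow_le hq hc₀ hC₀ (f := fun y => inner ℝ u y)
    ((innerSL ℝ u).toLinearMap.convexOn convex_univ) hu'
    (fun x y => by rw [← inner_sub_right]; exact abs_real_inner_le_norm _ _) (r := 2) (by norm_num)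
  have h4 := integral_prod_sub_sq (by exact_mod_cast h1)
  have h5 : ∫ y, inner ℝ u y ∂μ = 0 := by
    rw [integral_inner (hμ.integrable one_le_two), h0, inner_zero_right]
  simp only [sq_abs] at h3
  rw [h4, h5] at h3
  rw [bilin_populationCov hμ]
  have h6 : ∫ y, inner ℝ u y * inner ℝ u y ∂μ = ∫ y, (inner ℝ u y - 0) ^ 2 ∂μ := by
    simp [sq]
  rw [h6]
  have h7 : 0 ≤ ∫ y, (inner ℝ u y - 0) ^ 2 ∂μ := integral_nonneg fun _ => sq_nonneg _
  linarith

/-- The second moment is the trace of the centred covariance plus the squared norm of the mean; each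
is of order `p`. -/
theorem ConvexlyConcentrated.integral_norm_sq_le {q C₀ c₀ : ℝ} (hq : 0 < q) (hc₀ : 0 < c₀)
    (hC₀ : 0 ≤ C₀)
    (h : ConvexlyConcentrated μ (fun y => y) fun t => C₀ * Real.exp (-(t ^ q / c₀)))
    {M : ℝ} (hM : ‖∫ y, y ∂μ‖ ≤ M * √p) :
    ∫ y, ‖y‖ ^ 2 ∂μ ≤ ((momentBound q C₀ c₀ 2).toReal + M ^ 2) * p := by
  have hμ := h.memLp_two hq hc₀ hC₀
  set m := ∫ x, x ∂μ with hm
  have : IsProbabilityMeasure (μ.map fun y => y - m) :=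
    Measure.isProbabilityMeasure_map (by fun_prop)
  rw [← trace_populationCov hμ, populationCov_eq_add_outer hμ, trace_add, trace_outer, add_mul]
  refine add_le_add ?_ ?_
  · refine (trace_le_card_mul_norm _).trans ?_
    rw [mul_comm]
    exact mul_le_mul_of_nonneg_right ((h.map_sub m).norm_populationCov_le hq hc₀ hC₀
      (integral_map_sub_mean hμ)) (by positivity)
  · calc ‖m‖ ^ 2 ≤ (M * √p) ^ 2 := by gcongr
      _ = M ^ 2 * p := by rw [mul_pow, Real.sq_sqrt (by positivity)]

theorem ConvexlyConcentrated.integral_norm_pow_four_le {q C₀ c₀ : ℝ} (hq : 0 < q)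
    (hc₀ : 0 < c₀) (hC₀ : 0 ≤ C₀)
    (h : ConvexlyConcentrated μ (fun y => y) fun t => C₀ * Real.exp (-(t ^ q / c₀)))
    {B : ℝ} (hB0 : 0 ≤ B) (hB : ∫ y, ‖y‖ ^ 2 ∂μ ≤ B * p) (hp : 0 < p) :
    ∫ y, ‖y‖ ^ 4 ∂μ ≤
      (16 * ((momentBound q C₀ c₀ 4).toReal + 1) + 32 * (B + 1) ^ 2) * p ^ 2 := by
  have hμ4 := h.memLp_four hq hc₀ hC₀
  have hμ := h.memLp_two hq hc₀ hC₀
  obtain ⟨-, h2, h3⟩ := h.integral_pow_le hq hc₀ hC₀ (f := fun y => ‖y‖)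
    (convexOn_norm convex_univ) one_pos
    (fun x y => by simpa using abs_norm_sub_norm_le x y) (r := 4) (by norm_num)
  set K := (momentBound q C₀ c₀ 4).toReal with hK
  rw [one_pow, one_mul] at h3
  have hK0 : 0 ≤ K := ENNReal.toReal_nonneg
  have hn2 : Integrable (fun y : EuclideanSpace ℝ (Fin p) => ‖y‖ ^ 2) μ := hμ.norm.integrable_sq
  have hn4 : Integrable (fun y : EuclideanSpace ℝ (Fin p) => ‖y‖ ^ 4) μ :=
    hμ4.integrable_norm_pow (by norm_num)
  have hp1 : (1 : ℝ) ≤ p := by exact_mod_cast hp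
  have i1 := h2.integral_prod_right
  -- Some value `y'` of the second copy must be good for two quantities at once: the fourth moment
  -- of `‖y‖ - ‖y'‖`, and `‖y'‖²`. Their normalised sum has mean at most `2`, so some point outside
  -- the null set of bad sections has both terms at most `2`. The added ones keep the denominators
  -- positive.
  have hi : Integrable (fun y' : EuclideanSpace ℝ (Fin p) =>
      (∫ y, |‖y‖ - ‖y'‖| ^ 4 ∂μ) / (K + 1) + ‖y'‖ ^ 2 / (B * p + 1)) μ :=
    (i1.div_const _).add (hn2.div_const _)
  obtain ⟨y', hN, hy'⟩ := exists_notMem_null_le_integral hi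
    (Filter.eventually_iff.mp h2.prod_left_ae)
  replace hN : Integrable (fun y : EuclideanSpace ℝ (Fin p) => |‖y‖ - ‖y'‖| ^ 4) μ := by
    simpa using hN
  rw [integral_add (i1.div_const _) (hn2.div_const _), integral_div, integral_div,
    ← integral_prod_symm _ h2] at hy'
  have hy2 : (∫ w : EuclideanSpace ℝ (Fin p) × EuclideanSpace ℝ (Fin p),
      |‖w.1‖ - ‖w.2‖| ^ 4 ∂(μ.prod μ)) / (K + 1) + (∫ y, ‖y‖ ^ 2 ∂μ) / (B * p + 1) ≤ 2 := by
    have e1 := (div_le_one (by linarith : 0 < K + 1)).mpr (h3.trans (by linarith))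
    have e2 := (div_le_one (by positivity : 0 < B * p + 1)).mpr (hB.trans (by linarith))
    linarith
  have hA0 : 0 ≤ ∫ y : EuclideanSpace ℝ (Fin p), |‖y‖ - ‖y'‖| ^ 4 ∂μ :=
    integral_nonneg fun _ => by positivity
  have hA : ∫ y : EuclideanSpace ℝ (Fin p), |‖y‖ - ‖y'‖| ^ 4 ∂μ ≤ 2 * (K + 1) := by
    rw [← div_le_iff₀ (by linarith)]
    have : 0 ≤ ‖y'‖ ^ 2 / (B * p + 1) := by positivity
    linarith
  have hy3 : ‖y'‖ ^ 2 ≤ 2 * (B * p + 1) := by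
    rw [← div_le_iff₀ (by positivity)]
    have : 0 ≤ (∫ y : EuclideanSpace ℝ (Fin p), |‖y‖ - ‖y'‖| ^ 4 ∂μ) / (K + 1) := by positivity
    linarith
  have hpt : ∀ y : EuclideanSpace ℝ (Fin p), ‖y‖ ^ 4 ≤ 8 * |‖y‖ - ‖y'‖| ^ 4 + 8 * ‖y'‖ ^ 4 := by
    intro y
    have := add_pow_le (abs_nonneg (‖y‖ - ‖y'‖)) (norm_nonneg y') 4
    have h5 : ‖y‖ ≤ |‖y‖ - ‖y'‖| + ‖y'‖ := by linarith [le_abs_self (‖y‖ - ‖y'‖)]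
    calc ‖y‖ ^ 4 ≤ (|‖y‖ - ‖y'‖| + ‖y'‖) ^ 4 := by gcongr
      _ ≤ _ := this
      _ = _ := by norm_num; ring
  have hint := integral_mono hn4 ((hN.const_mul 8).add (integrable_const (8 * ‖y'‖ ^ 4))) hpt
  have h6 := integral_add (hN.const_mul 8) (integrable_const (μ := μ) (8 * ‖y'‖ ^ 4))
  simp only [Pi.add_apply] at hint
  rw [h6, integral_const_mul] at hint
  simp only [integral_const, probReal_univ, one_smul] at hint
  have h7 : ‖y'‖ ^ 4 ≤ (2 * (B * p + 1)) ^ 2 := by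
    calc ‖y'‖ ^ 4 = (‖y'‖ ^ 2) ^ 2 := by ring
      _ ≤ _ := by gcongr
  have h8 : (B * p + 1) ^ 2 ≤ ((B + 1) * p) ^ 2 := by
    gcongr
    linarith
  have h9 : 1 ≤ (p : ℝ) ^ 2 := one_le_pow₀ hp1
  nlinarith

/-- Variance of a quadratic form of a convexly concentrated vector. -/
theorem ConvexlyConcentrated.integral_bilin_sub_sq_le {q C₀ c₀ : ℝ} (hq : 0 < q)
    (hc₀ : 0 < c₀) (hC₀ : 0 ≤ C₀)
    (h : ConvexlyConcentrated μ (fun y => y) fun t => C₀ * Real.exp (-(t ^ q / c₀)))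
    {B : ℝ} (hB : ∫ y, ‖y‖ ^ 4 ∂μ ≤ B * p ^ 2) (hp : 0 < p)
    {A : Matrix (Fin p) (Fin p) ℝ} (hA : A.PosSemidef) {a : ℝ} (ha : 0 < a) (hAa : ‖A‖ ≤ a) :
    Integrable (fun y => (bilin A y y - (A * populationCov μ).trace) ^ 2) μ ∧
    ∫ y, (bilin A y y - (A * populationCov μ).trace) ^ 2 ∂μ ≤
      ((momentBound q C₀ c₀ 4).toReal + 4 * B) * a ^ 2 * p := by
  have hμ4 := h.memLp_four hq hc₀ hC₀
  have hμ := h.memLp_two hq hc₀ hC₀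
  have hp0 : (0 : ℝ) < p := by exact_mod_cast hp
  have hbd : ∀ y : EuclideanSpace ℝ (Fin p), bilin A y y ≤ a * ‖y‖ ^ 2 := fun y => by
    rw [sq]
    exact (le_abs_self _).trans ((abs_bilin_le _ _ _).trans
      (mul_le_mul_of_nonneg_right hAa (by positivity)))
  obtain ⟨m, v, hv⟩ := posSemidef_exists_outer hA
  -- A linear square root of the form, `‖V y‖² = yᵀAy`. The quadratic form itself is not Lipschitz,
  -- but `‖V y‖` is convex and `√a`-Lipschitz.
  set V : EuclideanSpace ℝ (Fin p) →ₗ[ℝ] EuclideanSpace ℝ (Fin m) :=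
    { toFun := fun y => WithLp.toLp 2 fun i => inner ℝ (v i) y
      map_add' := fun x y => by ext i; simp [inner_add_right]
      map_smul' := fun c y => by ext i; simp [inner_smul_right] } with hV
  have hVsq : ∀ y, ‖V y‖ ^ 2 = bilin A y y := fun y => by
    rw [EuclideanSpace.real_norm_sq_eq, hv, bilin_sum]
    simp [bilin_outer, hV, sq]
  have hVle : ∀ y, ‖V y‖ ≤ √a * ‖y‖ := fun y => by
    refine le_of_sq_le_sq ?_ (by positivity)
    rw [hVsq, mul_pow, Real.sq_sqrt ha.le]
    exact hbd y
  obtain ⟨h1, h2, h3⟩ := h.integral_pow_le hq hc₀ hC₀ (f := fun y => ‖V y‖)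
    (((convexOn_norm convex_univ).comp_linearMap V).subset (Set.subset_univ _) convex_univ)
    (Real.sqrt_pos.mpr ha)
    (fun x y => (abs_norm_sub_norm_le _ _).trans (by rw [← _root_.map_sub]; exact hVle _))
    (r := 4) (by norm_num)
  set K := (momentBound q C₀ c₀ 4).toReal with hK
  have hG : MemLp (fun y => bilin A y y) 2 μ := by
    have hm : AEStronglyMeasurable (fun y => bilin A y y) μ := (integrable_bilin hμ A).1
    rw [memLp_two_iff_integrable_sq hm]
    refine (((hμ4.integrable_norm_pow (by norm_num)).const_mul (a ^ 2))).mono' (hm.pow 2)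
      (Filter.Eventually.of_forall fun y => ?_)
    rw [Real.norm_eq_abs, abs_of_nonneg (sq_nonneg _)]
    calc bilin A y y ^ 2 ≤ (a * ‖y‖ ^ 2) ^ 2 := by
          gcongr
          · exact bilin_self_nonneg hA y
          · exact hbd y
      _ = _ := by ring
  have hmean := trace_mul_populationCov hμ A
  rw [hmean]
  refine ⟨(hG.sub (memLp_const _)).integrable_sq, ?_⟩
  have hvar := integral_prod_sub_sq hG
  have hn4 : Integrable (fun y : EuclideanSpace ℝ (Fin p) => ‖y‖ ^ 4) μ :=
    hμ4.integrable_norm_pow (by norm_num)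
  have hpt : ∀ w : EuclideanSpace ℝ (Fin p) × EuclideanSpace ℝ (Fin p),
      (bilin A w.1 w.1 - bilin A w.2 w.2) ^ 2 ≤
        p / 2 * |‖V w.1‖ - ‖V w.2‖| ^ 4 + (4 * a ^ 2 / p) * (‖w.1‖ ^ 4 + ‖w.2‖ ^ 4) := by
    intro w
    rw [← hVsq, ← hVsq]
    set x := ‖V w.1‖
    set y := ‖V w.2‖
    have hx : x ^ 4 ≤ a ^ 2 * ‖w.1‖ ^ 4 := by
      calc x ^ 4 ≤ (√a * ‖w.1‖) ^ 4 := by gcongr; exact hVle _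
        _ = (√a ^ 2) ^ 2 * ‖w.1‖ ^ 4 := by ring
        _ = _ := by rw [Real.sq_sqrt ha.le]
    have hy : y ^ 4 ≤ a ^ 2 * ‖w.2‖ ^ 4 := by
      calc y ^ 4 ≤ (√a * ‖w.2‖) ^ 4 := by gcongr; exact hVle _
        _ = (√a ^ 2) ^ 2 * ‖w.2‖ ^ 4 := by ring
        _ = _ := by rw [Real.sq_sqrt ha.le]
    have e1 : |x - y| ^ 4 = (x - y) ^ 4 := by
      rw [show (4 : ℕ) = 2 * 2 from rfl, pow_mul, pow_mul, sq_abs]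
    have e2 : (x + y) ^ 4 ≤ 8 * (x ^ 4 + y ^ 4) := by
      have := add_pow_le (norm_nonneg (V w.1)) (norm_nonneg (V w.2)) 4
      norm_num at this
      exact this
    -- Factor `x² - y² = (x - y)(x + y)` and apply the arithmetic–geometric inequality with weight
    -- `p`. In mean `(x - y)⁴` is `O(1)` and `(x + y)⁴` is `O(p²)`, so both terms become `O(p)`.
    have e3 : (x ^ 2 - y ^ 2) ^ 2 ≤ p / 2 * (x - y) ^ 4 + 1 / (2 * p) * (x + y) ^ 4 := by
      have : p / 2 * (x - y) ^ 4 + 1 / (2 * p) * (x + y) ^ 4 - (x ^ 2 - y ^ 2) ^ 2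
          = 1 / (2 * p) * (p * (x - y) ^ 2 - (x + y) ^ 2) ^ 2 := by
        field_simp
        ring
      have h0 : 0 ≤ 1 / (2 * p) * (p * (x - y) ^ 2 - (x + y) ^ 2) ^ 2 := by positivity
      linarith
    rw [e1]
    have e4 : 1 / (2 * p) * (x + y) ^ 4 ≤ (4 * a ^ 2 / p) * (‖w.1‖ ^ 4 + ‖w.2‖ ^ 4) := by
      calc 1 / (2 * p) * (x + y) ^ 4
          ≤ 1 / (2 * (p : ℝ)) * (8 * (a ^ 2 * ‖w.1‖ ^ 4 + a ^ 2 * ‖w.2‖ ^ 4)) := by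
            refine mul_le_mul_of_nonneg_left (e2.trans ?_) (by positivity)
            linarith
        _ = _ := by field_simp; ring
    linarith
  have i2 : Integrable (fun w : EuclideanSpace ℝ (Fin p) × EuclideanSpace ℝ (Fin p) =>
      (4 * a ^ 2 / p) * (‖w.1‖ ^ 4 + ‖w.2‖ ^ 4)) (μ.prod μ) :=
    ((hn4.comp_fst μ).add (hn4.comp_snd μ)).const_mul _
  have hint := integral_mono_of_nonneg (Filter.Eventually.of_forall fun w => sq_nonneg _)
    ((h2.const_mul (p / 2 : ℝ)).add i2) (Filter.Eventually.of_forall hpt)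
  have h6 := integral_add (h2.const_mul (p / 2 : ℝ)) i2
  simp only [Pi.add_apply] at hint
  rw [hvar, h6, integral_const_mul, integral_const_mul,
    integral_add (hn4.comp_fst μ) (hn4.comp_snd μ), integral_fun_fst (fun y => ‖y‖ ^ 4),
    integral_fun_snd (fun y => ‖y‖ ^ 4)] at hint
  simp only [probReal_univ, one_smul] at hint
  have e5 : √a ^ 4 = a ^ 2 := by
    rw [show (4 : ℕ) = 2 * 2 from rfl, pow_mul, Real.sq_sqrt ha.le]
  rw [e5] at h3
  have h7 := mul_le_mul_of_nonneg_left h3 (by positivity : (0 : ℝ) ≤ p / 2)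
  have h8 : 4 * a ^ 2 / p * (∫ y, ‖y‖ ^ 4 ∂μ + ∫ y, ‖y‖ ^ 4 ∂μ) ≤ 8 * a ^ 2 * B * p := by
    calc _ ≤ 4 * a ^ 2 / p * (B * p ^ 2 + B * p ^ 2) := by gcongr
      _ = _ := by field_simp; ring
  have hK0 : 0 ≤ K := ENNReal.toReal_nonneg
  have h9 : 0 ≤ K * a ^ 2 * p := by positivity
  nlinarith

end LawMoments

/-! ### Resampling, variance and concentration on product spaces -/

section ProductMeasures

/-- Replacing one coordinate by a fresh independent one leaves the product law unchanged. This is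
the form in which independence of a sample from the others is used. -/
theorem measurePreserving_update {ι : Type*} [Fintype ι] [DecidableEq ι] {X : ι → Type*}
    [∀ i, MeasurableSpace (X i)] (ν : ∀ i, Measure (X i)) [∀ i, IsProbabilityMeasure (ν i)]
    (i : ι) :
    MeasurePreserving (fun w : (∀ j, X j) × X i => Function.update w.1 i w.2)
      ((Measure.pi ν).prod (ν i)) (Measure.pi ν) := by
  have hm : Measurable fun w : (∀ j, X j) × X i => Function.update w.1 i w.2 := by
    refine measurable_pi_lambda _ fun j => ?_
    rcases eq_or_ne j i with rfl | hj
    · simpa using measurable_snd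
    · simp only [Function.update_of_ne hj]
      exact (measurable_pi_apply j).comp measurable_fst
  refine ⟨hm, (Measure.pi_eq fun s hs => ?_).symm⟩
  rw [Measure.map_apply hm (MeasurableSet.univ_pi hs)]
  have e : (fun w : (∀ j, X j) × X i => Function.update w.1 i w.2) ⁻¹' Set.pi Set.univ s
      = Set.pi Set.univ (Function.update s i Set.univ) ×ˢ s i := by
    ext ⟨ω, y⟩
    simp only [Set.mem_preimage, Set.mem_pi, Set.mem_univ, true_implies, Set.mem_prod]
    constructor
    · intro h
      refine ⟨fun j => ?_, by simpa using h i⟩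
      rcases eq_or_ne j i with rfl | hj
      · simp
      · simpa [hj] using h j
    · rintro ⟨h1, h2⟩ j
      rcases eq_or_ne j i with rfl | hj
      · simpa using h2
      · simpa [hj] using h1 j
  rw [e, Measure.prod_prod, Measure.pi_pi, ← Finset.mul_prod_erase _ _ (Finset.mem_univ i),
    ← Finset.mul_prod_erase Finset.univ (fun j => ν j (s j)) (Finset.mem_univ i)]
  have : ∏ j ∈ Finset.univ.erase i, ν j (Function.update s i Set.univ j)
      = ∏ j ∈ Finset.univ.erase i, ν j (s j) :=
    Finset.prod_congr rfl fun j hj => by rw [Function.update_of_ne (Finset.ne_of_mem_erase hj)]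
  rw [this, Function.update_self, measure_univ, one_mul, mul_comm]

/-- Variance bound under bounded differences. -/
theorem integral_sub_integral_sq_le_of_bounded_differences {X : Type*} [MeasurableSpace X] {c : ℝ} :
    ∀ {n : ℕ} (ν : Fin n → Measure X) [∀ i, IsProbabilityMeasure (ν i)]
      {f : (Fin n → X) → ℝ} {b : ℝ}, Measurable f → (∀ ω, |f ω| ≤ b) →
      (∀ ω i y, |f (Function.update ω i y) - f ω| ≤ c) →
      ∫ ω, (f ω - ∫ x, f x ∂(Measure.pi ν)) ^ 2 ∂(Measure.pi ν) ≤ n * c ^ 2 := by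
  intro n
  induction n with
  | zero =>
    intro ν _ f b hf hb hc
    have : ∀ ω, f ω = f default := fun ω => congrArg f (Subsingleton.elim _ _)
    simp [this]
  | succ n ih =>
    intro ν _ f b hf hb hc
    have hmp := measurePreserving_piFinSuccAbove ν 0
    set e := MeasurableEquiv.piFinSuccAbove (fun _ : Fin (n + 1) => X) 0 with he
    set ν' : Fin n → Measure X := fun j => ν (Fin.succAbove 0 j) with hν'
    set g : X × (Fin n → X) → ℝ := fun w => f (e.symm w) with hg
    have hgm : Measurable g := hf.comp e.symm.measurable
    have hgb : ∀ w, |g w| ≤ b := fun w => hb _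
    have hbdd : ∀ {Y : Type _} [MeasurableSpace Y] (P : Measure Y) [IsProbabilityMeasure P]
        (h : Y → ℝ) (B : ℝ), Measurable h → (∀ y, |h y| ≤ B) → Integrable h P :=
      fun P _ h B hm hB => Integrable.of_bound hm.aestronglyMeasurable B
        (Filter.Eventually.of_forall hB)
    have hcomp : ∀ h : (Fin (n + 1) → X) → ℝ, ∫ ω, h ω ∂(Measure.pi ν)
        = ∫ w, h (e.symm w) ∂((ν 0).prod (Measure.pi ν')) := fun h => by
      rw [← hmp.integral_comp e.measurableEmbedding]
      simp only [MeasurableEquiv.symm_apply_apply]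
    set M := ∫ x, f x ∂(Measure.pi ν) with hM
    have hMb : |M| ≤ b := by
      rw [hM, ← Real.norm_eq_abs]
      refine (norm_integral_le_of_norm_le_const (C := b)
        (Filter.Eventually.of_forall hb)).trans ?_
      simp
    set m : X → ℝ := fun a => ∫ y, g (a, y) ∂(Measure.pi ν') with hm
    have hgi : Integrable g ((ν 0).prod (Measure.pi ν')) := hbdd _ g b hgm hgb
    have hsec : ∀ a, Integrable (fun y => g (a, y)) (Measure.pi ν') := fun a =>
      hbdd _ _ b (hgm.comp measurable_prodMk_left) fun y => hgb _
    have hMm : M = ∫ a, m a ∂(ν 0) := by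
      rw [hM, hcomp]
      exact integral_prod _ hgi
    have hdiff : ∀ a a', |m a - m a'| ≤ c := by
      intro a a'
      rw [hm]
      simp only
      rw [← integral_sub (hsec a) (hsec a'), ← Real.norm_eq_abs]
      refine (norm_integral_le_of_norm_le_const (C := c)
        (Filter.Eventually.of_forall fun y => ?_)).trans (by simp)
      have := hc (Fin.insertNth 0 a' y) 0 a
      rw [Fin.update_insertNth] at this
      exact this
    -- The conditional mean `m` varies by at most `c` and averages to `M`. The variance then splits
    -- into the part inside a section, bounded by induction, and this part, at most `c²`.
    have hmM : ∀ a, |m a - M| ≤ c := by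
      intro a
      have hmi : Integrable m (ν 0) := hgi.integral_prod_left
      have : m a - M = ∫ a', (m a - m a') ∂(ν 0) := by
        rw [integral_sub (integrable_const _) hmi, hMm]; simp
      rw [this, ← Real.norm_eq_abs]
      exact (norm_integral_le_of_norm_le_const (C := c)
        (Filter.Eventually.of_forall fun a' => hdiff a a')).trans (by simp)
    have hinner : ∀ a, ∫ y, (g (a, y) - M) ^ 2 ∂(Measure.pi ν') ≤ ((n : ℝ) + 1) * c ^ 2 := by
      intro a
      have h1 := ih ν' (f := fun y => g (a, y)) (b := b) (hgm.comp measurable_prodMk_left)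
        (fun y => hgb _) (fun y i x => by
          have := hc (Fin.insertNth 0 a y) (Fin.succAbove 0 i) x
          rw [← Fin.insertNth_update] at this
          exact this)
      have hB : ∀ y, |g (a, y) - m a| ≤ b + |m a| := fun y =>
        (abs_sub _ _).trans (by linarith [hgb (a, y)])
      have i0 : Integrable (fun y => g (a, y) - m a) (Measure.pi ν') :=
        (hsec a).sub (integrable_const _)
      have i1 : Integrable (fun y => (g (a, y) - m a) ^ 2) (Measure.pi ν') := by
        refine hbdd _ _ ((b + |m a|) ^ 2)
          (((hgm.comp measurable_prodMk_left).sub_const _).pow_const 2) fun y => ?_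
        rw [abs_pow]
        have := hB y
        gcongr
      have h2 : ∀ y, (g (a, y) - M) ^ 2 =
          (g (a, y) - m a) ^ 2 + (2 * (m a - M) * (g (a, y) - m a) + (m a - M) ^ 2) := by
        intro y; ring
      simp_rw [h2]
      have h3 : ∫ y, (g (a, y) - m a) ∂(Measure.pi ν') = 0 := by
        rw [integral_sub (hsec a) (integrable_const _)]
        simp [hm]
      have h4 := integral_add i1 ((i0.const_mul (2 * (m a - M))).add
        (integrable_const ((m a - M) ^ 2)))
      simp only [Pi.add_apply] at h4
      rw [h4, integral_add (i0.const_mul _) (integrable_const _), integral_const_mul, h3]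
      have h5 : (m a - M) ^ 2 ≤ c ^ 2 := by
        rw [← sq_abs]
        have := hmM a
        gcongr
      simp only [integral_const, probReal_univ, one_smul]
      linarith
    rw [hcomp]
    have i2 : Integrable (fun w => (g w - M) ^ 2) ((ν 0).prod (Measure.pi ν')) := by
      refine hbdd _ _ ((b + b) ^ 2) ((hgm.sub_const _).pow_const 2) fun w => ?_
      rw [abs_pow]
      have := (abs_sub (g w) M).trans (add_le_add (hgb w) hMb)
      gcongr
    rw [integral_prod _ i2]
    refine (integral_mono_of_nonneg (Filter.Eventually.of_forall fun a =>
      integral_nonneg fun y => sq_nonneg _) (integrable_const (((n : ℝ) + 1) * c ^ 2))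
      (Filter.Eventually.of_forall hinner)).trans ?_
    simp

/-- Tensorisation of concentration over independent blocks. -/
theorem measure_pi_prod_lt_le_of_selfConcentrated {α : ℝ → ℝ} {t : ℝ} (ht : 0 < t) :
    ∀ {k : ℕ} {X : Fin k → Type*} [∀ l, MeasurableSpace (X l)] (ν : ∀ l, Measure (X l))
      [∀ l, IsProbabilityMeasure (ν l)] {G : (∀ l, X l) → ℝ}, Measurable G →
      (∀ ω l, SelfConcentrated (ν l) (fun y => G (Function.update ω l y)) α) →
      ((Measure.pi ν).prod (Measure.pi ν)) {w | k * t < |G w.1 - G w.2|} ≤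
        k * ENNReal.ofReal (α t) := by
  intro k
  induction k with
  | zero =>
    intro X _ ν _ G hG hc
    -- With no block both sides are `0`. The strict inequality in the event is what makes this case
    -- true.
    have : ∀ ω, G ω = G default := fun ω => congrArg G (Subsingleton.elim _ _)
    simp [this]
  | succ k ih =>
    intro X _ ν _ G hG hc
    have hmp := measurePreserving_piFinSuccAbove ν 0
    set e := MeasurableEquiv.piFinSuccAbove X 0 with he
    set ν' : ∀ j : Fin k, Measure (X (Fin.succAbove 0 j)) := fun j => ν (Fin.succAbove 0 j)
      with hν'
    set g : X 0 × (∀ j : Fin k, X (Fin.succAbove 0 j)) → ℝ := fun w => G (e.symm w) with hg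
    have hgm : Measurable g := hG.comp e.symm.measurable
    have hset : MeasurableSet {w : (∀ l, X l) × (∀ l, X l) |
        ((k + 1 : ℕ) : ℝ) * t < |G w.1 - G w.2|} :=
      measurableSet_lt measurable_const
        ((hG.comp measurable_fst).sub (hG.comp measurable_snd)).abs
    rw [← ((hmp.symm).prod (hmp.symm)).measure_preimage hset.nullMeasurableSet]
    set P := (ν 0).prod (Measure.pi ν') with hP
    -- Go from `(a, b)` to `(a', b')` through `(a', b)`. `A` is a large change on exchanging the
    -- first block, `B` a large change on exchanging the others; each is estimated with the
    -- remaining coordinates frozen.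
    set A : Set ((X 0 × (∀ j : Fin k, X (Fin.succAbove 0 j))) ×
        (X 0 × (∀ j : Fin k, X (Fin.succAbove 0 j)))) :=
      {w | t ≤ |g (w.1.1, w.1.2) - g (w.2.1, w.1.2)|} with hA
    set B : Set ((X 0 × (∀ j : Fin k, X (Fin.succAbove 0 j))) ×
        (X 0 × (∀ j : Fin k, X (Fin.succAbove 0 j)))) :=
      {w | k * t < |g (w.2.1, w.1.2) - g (w.2.1, w.2.2)|} with hB
    have hsub : Prod.map e.symm e.symm ⁻¹' {w : (∀ l, X l) × (∀ l, X l) |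
        ((k + 1 : ℕ) : ℝ) * t < |G w.1 - G w.2|} ⊆ A ∪ B := by
      rintro ⟨⟨a, b⟩, ⟨a', b'⟩⟩ hw
      have hw' : ((k + 1 : ℕ) : ℝ) * t < |g (a, b) - g (a', b')| := hw
      by_contra hcon
      simp only [hA, hB, Set.mem_union, Set.mem_ofPred_eq, not_or, not_le, not_lt] at hcon
      have := abs_sub_le (g (a, b)) (g (a', b)) (g (a', b'))
      push_cast at hw'
      linarith [hcon.1, hcon.2]
    have hAm : MeasurableSet A := measurableSet_le measurable_const
      ((hgm.comp (by fun_prop)).sub (hgm.comp (by fun_prop))).abs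
    have hBm : MeasurableSet B := measurableSet_lt measurable_const
      ((hgm.comp (by fun_prop)).sub (hgm.comp (by fun_prop))).abs
    refine (measure_mono hsub).trans ((measure_union_le _ _).trans ?_)
    have hAle : (P.prod P) A ≤ ENNReal.ofReal (α t) := by
      have hφ : MeasurePreserving
          (fun w : (X 0 × (∀ j : Fin k, X (Fin.succAbove 0 j))) ×
            (X 0 × (∀ j : Fin k, X (Fin.succAbove 0 j))) => (w.1.2, (w.1.1, w.2.1)))
          (P.prod P) ((Measure.pi ν').prod ((ν 0).prod (ν 0))) := by
        have h1 : MeasurePreserving (Prod.map (id : X 0 × (∀ j : Fin k, X (Fin.succAbove 0 j)) → _)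
            Prod.fst) (P.prod P) (P.prod (ν 0)) :=
          (MeasurePreserving.id P).prod measurePreserving_fst
        have h2 : MeasurePreserving (Prod.map
            (Prod.swap : X 0 × (∀ j : Fin k, X (Fin.succAbove 0 j)) → _) (id : X 0 → X 0))
            (P.prod (ν 0)) (((Measure.pi ν').prod (ν 0)).prod (ν 0)) :=
          (Measure.measurePreserving_swap).prod (MeasurePreserving.id _)
        have h3 := measurePreserving_prodAssoc (Measure.pi ν') (ν 0) (ν 0)
        exact h3.comp (h2.comp h1)
      have hA' : MeasurableSet {v : (∀ j : Fin k, X (Fin.succAbove 0 j)) × (X 0 × X 0) |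
          t ≤ |g (v.2.1, v.1) - g (v.2.2, v.1)|} := measurableSet_le measurable_const
        ((hgm.comp (by fun_prop)).sub (hgm.comp (by fun_prop))).abs
      have := hφ.measure_preimage hA'.nullMeasurableSet
      change (P.prod P) A = _ at this
      rw [this, Measure.prod_apply hA']
      refine (lintegral_mono (g := fun _ => ENNReal.ofReal (α t)) fun b => ?_).trans ?_
      · obtain ⟨a⟩ := (ν 0).nonempty_of_neZero
        have h4 := hc (Fin.insertNth 0 a b) 0 t ht
        simp only [Fin.update_insertNth] at h4
        exact h4
      · rw [lintegral_const, measure_univ, mul_one]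
    have hBle : (P.prod P) B ≤ k * ENNReal.ofReal (α t) := by
      have hφ : MeasurePreserving
          (fun w : (X 0 × (∀ j : Fin k, X (Fin.succAbove 0 j))) ×
            (X 0 × (∀ j : Fin k, X (Fin.succAbove 0 j))) => (w.2.1, (w.1.2, w.2.2)))
          (P.prod P) ((ν 0).prod ((Measure.pi ν').prod (Measure.pi ν'))) := by
        have h1 : MeasurePreserving (Prod.map
            (Prod.snd : X 0 × (∀ j : Fin k, X (Fin.succAbove 0 j)) → _)
            (id : X 0 × (∀ j : Fin k, X (Fin.succAbove 0 j)) → _)) (P.prod P)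
            ((Measure.pi ν').prod P) :=
          measurePreserving_snd.prod (MeasurePreserving.id P)
        have h2 : MeasurePreserving (Prod.swap) ((Measure.pi ν').prod P)
          (P.prod (Measure.pi ν')) := Measure.measurePreserving_swap
        have h3 := measurePreserving_prodAssoc (ν 0) (Measure.pi ν') (Measure.pi ν')
        have h4 : MeasurePreserving (Prod.map (id : X 0 → X 0) (Prod.swap))
            ((ν 0).prod ((Measure.pi ν').prod (Measure.pi ν')))
            ((ν 0).prod ((Measure.pi ν').prod (Measure.pi ν'))) :=
          (MeasurePreserving.id _).prod Measure.measurePreserving_swap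
        exact h4.comp (h3.comp (h2.comp h1))
      have hB' : MeasurableSet {v : X 0 × ((∀ j : Fin k, X (Fin.succAbove 0 j)) ×
          (∀ j : Fin k, X (Fin.succAbove 0 j))) |
          k * t < |g (v.1, v.2.1) - g (v.1, v.2.2)|} := measurableSet_lt measurable_const
        ((hgm.comp (by fun_prop)).sub (hgm.comp (by fun_prop))).abs
      have := hφ.measure_preimage hB'.nullMeasurableSet
      change (P.prod P) B = _ at this
      rw [this, Measure.prod_apply hB']
      refine (lintegral_mono (g := fun _ => (k : ENNReal) * ENNReal.ofReal (α t))
        fun a => ?_).trans ?_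
      · refine ih ν' (G := fun b => g (a, b)) (hgm.comp measurable_prodMk_left) fun b l => ?_
        have h4 := hc (Fin.insertNth 0 a b) (Fin.succAbove 0 l)
        simp only [← Fin.insertNth_update] at h4
        exact h4
      · rw [lintegral_const, measure_univ, mul_one]
    calc _ ≤ ENNReal.ofReal (α t) + k * ENNReal.ofReal (α t) := add_le_add hAle hBle
      _ = _ := by push_cast; ring

/-- Gathering the samples class by class preserves product measures. -/
theorem measurePreserving_gather {n k : ℕ} {X : Type*} [MeasurableSpace X] (κ : Fin n → Fin k)
    (μ : Fin k → Measure X) [∀ l, IsProbabilityMeasure (μ l)] :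
    MeasurePreserving (fun (ω : ∀ l, {i // κ i = l} → X) (i : Fin n) => ω (κ i) ⟨i, rfl⟩)
      (Measure.pi fun l => Measure.pi fun _ : {i // κ i = l} => μ l)
      (Measure.pi fun i => μ (κ i)) := by
  have hm : Measurable fun (ω : ∀ l, {i // κ i = l} → X) (i : Fin n) => ω (κ i) ⟨i, rfl⟩ := by
    fun_prop
  refine ⟨hm, (Measure.pi_eq fun s hs => ?_).symm⟩
  rw [Measure.map_apply hm (MeasurableSet.univ_pi hs)]
  have e : (fun (ω : ∀ l, {i // κ i = l} → X) (i : Fin n) => ω (κ i) ⟨i, rfl⟩) ⁻¹'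
      Set.pi Set.univ s = Set.pi Set.univ fun l => Set.pi Set.univ fun i => s i.1 := by
    ext ω
    simp only [Set.mem_preimage, Set.mem_pi, Set.mem_univ, true_implies]
    constructor
    · rintro h l ⟨i, rfl⟩
      exact h i
    · intro h i
      exact h (κ i) ⟨i, rfl⟩
  rw [e, Measure.pi_pi]
  simp_rw [Measure.pi_pi]
  rw [← Fintype.prod_fiberwise κ]
  refine Finset.prod_congr rfl fun l _ => Finset.prod_congr rfl fun i _ => ?_
  rw [i.2]

end ProductMeasures

/-! ### Concentration of the trace of the resolvent -/

section TraceConcentration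

variable {p n k : ℕ}

theorem continuous_of_abs_sub_le {F : (Fin n → EuclideanSpace ℝ (Fin p)) → ℝ} {L : ℝ}
    (hLip : ∀ x y, |F x - F y| ≤ L * √(∑ j, ‖x j - y j‖ ^ 2)) : Continuous F := by
  refine continuous_iff_continuousAt.mpr fun x => ?_
  rw [ContinuousAt, tendsto_iff_dist_tendsto_zero]
  have hc : Continuous fun y : Fin n → EuclideanSpace ℝ (Fin p) =>
      L * √(∑ j, ‖y j - x j‖ ^ 2) := by fun_prop
  refine squeeze_zero (fun _ => dist_nonneg) (fun y => ?_) (by simpa using hc.tendsto x)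
  rw [Real.dist_eq]
  exact hLip y x

theorem measurePreserving_prodMap_self {Ω Ω' : Type*} [MeasurableSpace Ω] [MeasurableSpace Ω']
    {P : Measure Ω} {P' : Measure Ω'} [IsProbabilityMeasure P] {φ : Ω → Ω'}
    (hφ : MeasurePreserving φ P P') :
    MeasurePreserving (Prod.map φ φ) (P.prod P) (P'.prod P') :=
  hφ.prod hφ

/-- Concentration of convex Lipschitz functions of independent samples from several classes. -/
theorem ClassConcentration.measure_le_abs_sub_le {q C₀ c₀ : ℝ}
    {μ : Fin k → Measure (EuclideanSpace ℝ (Fin p))} [∀ l, IsProbabilityMeasure (μ l)]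
    (h : ClassConcentration q C₀ c₀ μ) (κ : Fin n → Fin k) (hk : 0 < k)
    {F : (Fin n → EuclideanSpace ℝ (Fin p)) → ℝ} (hF : ConvexOn ℝ Set.univ F) {L : ℝ}
    (hL : 0 < L) (hLip : ∀ x y, |F x - F y| ≤ L * √(∑ j, ‖x j - y j‖ ^ 2)) {t : ℝ} (ht : 0 < t) :
    ((Measure.pi fun i => μ (κ i)).prod (Measure.pi fun i => μ (κ i)))
      {w | t ≤ |F w.1 - F w.2|} ≤
      k * ENNReal.ofReal (C₀ * Real.exp (-((t / (2 * k * L)) ^ q / c₀))) := by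
  have hFm : Measurable F := (continuous_of_abs_sub_le hLip).measurable
  have hJ := measurePreserving_gather κ μ
  set J := fun (ω : ∀ l, {i // κ i = l} → EuclideanSpace ℝ (Fin p)) (i : Fin n) =>
    ω (κ i) ⟨i, rfl⟩ with hJdef
  have hm : MeasurableSet {w : (Fin n → EuclideanSpace ℝ (Fin p)) × _ | t ≤ |F w.1 - F w.2|} :=
    measurableSet_le measurable_const
      ((hFm.comp measurable_fst).sub (hFm.comp measurable_snd)).abs
  have hJJ : MeasurePreserving (Prod.map J J) _ _ := measurePreserving_prodMap_self hJ
  rw [← hJJ.measure_preimage hm.nullMeasurableSet]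
  have hk' : (0 : ℝ) < k := by exact_mod_cast hk
  -- Each of the `k` blocks is allowed `t/(2k)`, not `t/k`: the total `t/2` lies strictly below `t`,
  -- as the strict event requires.
  have key := measure_pi_prod_lt_le_of_selfConcentrated
    (α := fun t => C₀ * Real.exp (-((t / L) ^ q / c₀))) (t := t / (2 * k)) (by positivity)
    (fun l => Measure.pi fun _ : {i // κ i = l} => μ l) (G := fun ω => F (J ω))
    (hFm.comp hJ.measurable) (fun ω l => ?_)
  · rw [show t / (2 * k) / L = t / (2 * k * L) by rw [div_div]] at key
    refine (measure_mono fun w hw => ?_).trans key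
    have hw' : t ≤ |F (J w.1) - F (J w.2)| := hw
    have : (k : ℝ) * (t / (2 * k)) < |F (J w.1) - F (J w.2)| := by
      refine lt_of_lt_of_le ?_ hw'
      rw [show (k : ℝ) * (t / (2 * k)) = t / 2 by field_simp]
      linarith
    exact this
  · set e := (Fintype.equivFin {i // κ i = l}).symm with he
    set Ψ : (Fin (Fintype.card {i // κ i = l}) → EuclideanSpace ℝ (Fin p)) → Fin n →
      EuclideanSpace ℝ (Fin p) := fun y => J (Function.update ω l fun s => y (e.symm s)) with hΨ
    have hΨ1 : ∀ y i (hi : κ i = l), Ψ y i = y (e.symm ⟨i, hi⟩) := by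
      rintro y i rfl
      simp [hΨ, hJdef]
    have hΨ2 : ∀ y i, κ i ≠ l → Ψ y i = ω (κ i) ⟨i, rfl⟩ := by
      intro y i hi
      simp only [hΨ, hJdef]
      rw [Function.update_of_ne hi]
    have hconv : ConvexOn ℝ Set.univ fun y => F (Ψ y) := by
      refine ⟨convex_univ, fun x _ y _ a b ha hb hab => ?_⟩
      have : Ψ (a • x + b • y) = a • Ψ x + b • Ψ y := by
        funext i
        by_cases hi : κ i = l
        · simp [hΨ1 _ i hi]
        · simp [hΨ2 _ i hi, ← add_smul, hab]
      simp only [this]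
      exact hF.2 (Set.mem_univ _) (Set.mem_univ _) ha hb hab
    have hl : ∀ x y, |F (Ψ x) - F (Ψ y)| ≤ L * √(∑ j, ‖x j - y j‖ ^ 2) := by
      intro x y
      refine (hLip _ _).trans_eq ?_
      congr 2
      rw [← Finset.sum_filter_of_ne (p := fun i => κ i = l) fun i _ hne => by
        by_contra hi
        exact hne (by simp [hΨ2 _ i hi]),
        Finset.sum_subtype (p := fun i => κ i = l) _ (fun i => by simp),
        ← e.symm.sum_comp fun j => ‖x j - y j‖ ^ 2]
      exact Finset.sum_congr rfl fun s _ => by rw [hΨ1 x s.1 s.2, hΨ1 y s.1 s.2]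
    have hsc := h.selfConcentrated_pi l hconv.quasiconvexOn hL hl
    have hmp := measurePreserving_arrowCongr' (fun _ : Fin _ => μ l)
      (fun _ : {i // κ i = l} => μ l) e (MeasurableEquiv.refl _)
      (fun _ => MeasurePreserving.id _)
    refine SelfConcentrated.of_measurePreserving hmp ?_ hsc
    refine (hFm.comp hJ.measurable).comp ?_
    exact measurable_update ω

/-- Concentration of the Stieltjes transform of the sample covariance matrix. -/
theorem ClassConcentration.selfConcentrated_trace {q C₀ c₀ z₀ z : ℝ} {K : ℕ} (hq : 0 < q)
    (hc₀ : 0 < c₀) (hC₀ : 0 ≤ C₀) (hz₀ : 0 < z₀) (hz : z₀ ≤ z)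
    {μ : Fin k → Measure (EuclideanSpace ℝ (Fin p))} [∀ l, IsProbabilityMeasure (μ l)]
    (h : ClassConcentration q C₀ c₀ μ) (κ : Fin n → Fin k) (hk : 0 < k) (hkK : k ≤ K)
    (hp : 0 < p) (hn : 0 < n) :
    SelfConcentrated (Measure.pi fun i => μ (κ i))
      (fun x => 1 / (p : ℝ) * (resolventAt (gram x) z).trace)
      fun t => 2 * K * C₀ * Real.exp (-((√n * t) ^ q / (c₀ * (4 * K * (2 / √z₀ ^ 3)) ^ q))) := by
  intro t ht
  set κ₀ := 2 / √z₀ ^ 3 with hκ₀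
  have hs₀ : 0 < √z₀ := Real.sqrt_pos.mpr hz₀
  have hκ₀pos : 0 < κ₀ := by positivity
  have hp' : (1 : ℝ) ≤ p := by exact_mod_cast hp
  have hn' : (0 : ℝ) < n := by exact_mod_cast hn
  have hk' : (0 : ℝ) < k := by exact_mod_cast hk
  have hkK' : (k : ℝ) ≤ K := by exact_mod_cast hkK
  have hsn : 0 < √(n : ℝ) := Real.sqrt_pos.mpr hn'
  obtain ⟨F, G, hF, hG, hFL, hGL, hFG⟩ :=
    exists_trace_resolventAt_gram_eq_sub (p := p) (n := n) (hz₀.trans_le hz)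
  -- Dividing by `p` leaves the Lipschitz constant `κ/√(pn)`, at most `κ/√n`; the scale `√n` of the
  -- statement comes from here.
  have hL : 1 / (p : ℝ) * (2 / √z ^ 3 * √((p : ℝ) / n)) ≤ κ₀ / √n := by
    have h1 : 2 / √z ^ 3 ≤ κ₀ := by
      rw [hκ₀]
      gcongr
    have h2 : √(p : ℝ) ≤ p := by
      rw [Real.sqrt_le_left (by linarith)]
      nlinarith
    calc _ = 2 / √z ^ 3 * (√(p : ℝ) / p) / √n := by
          rw [Real.sqrt_div (by linarith)]; ring
      _ ≤ κ₀ * 1 / √n := by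
          gcongr
          rw [div_le_one (by linarith)]
          exact h2
      _ = _ := by rw [mul_one]
  have hconv : ∀ F : (Fin n → EuclideanSpace ℝ (Fin p)) → ℝ, ConvexOn ℝ Set.univ F →
      (∀ x y, |F x - F y| ≤ 2 / √z ^ 3 * √((p : ℝ) / n) * √(∑ j, ‖x j - y j‖ ^ 2)) →
      ((Measure.pi fun i => μ (κ i)).prod (Measure.pi fun i => μ (κ i)))
        {w | t / 2 ≤ |1 / (p : ℝ) * F w.1 - 1 / (p : ℝ) * F w.2|} ≤
      K * ENNReal.ofReal (C₀ * Real.exp (-((√n * t) ^ q / (c₀ * (4 * K * κ₀) ^ q)))) := by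
    intro F hF hFL
    refine (h.measure_le_abs_sub_le κ hk (F := fun x => 1 / (p : ℝ) * F x)
      (hF.smul (by positivity : (0 : ℝ) ≤ 1 / p)) (L := κ₀ / √n) (by positivity)
      (fun x y => ?_) (by positivity)).trans ?_
    · rw [← mul_sub, abs_mul, abs_of_pos (by positivity)]
      calc _ ≤ 1 / (p : ℝ) * (2 / √z ^ 3 * √((p : ℝ) / n) * √(∑ j, ‖x j - y j‖ ^ 2)) := by
            gcongr; exact hFL x y
        _ = 1 / (p : ℝ) * (2 / √z ^ 3 * √((p : ℝ) / n)) * √(∑ j, ‖x j - y j‖ ^ 2) := by ring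
        _ ≤ _ := by gcongr
    · have e1 : (√n * t) ^ q / (c₀ * (4 * K * κ₀) ^ q) = (√n * t / (4 * K * κ₀)) ^ q / c₀ := by
        rw [Real.div_rpow (by positivity) (by positivity)]
        field_simp
      -- The `4` is two halvings: one shares `t` between the two convex functions, the other comes
      -- from the exchange of blocks.
      have e2 : √n * t / (4 * K * κ₀) ≤ t / 2 / (2 * k * (κ₀ / √n)) := by
        rw [show t / 2 / (2 * k * (κ₀ / √n)) = √n * t / (4 * k * κ₀) by field_simp; ring]
        gcongr
      rw [e1]
      have hK0 : (0 : ℝ) < K := hk'.trans_le hkK'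
      gcongr
  refine (measure_mono (t := {w | t / 2 ≤ |1 / (p : ℝ) * F w.1 - 1 / (p : ℝ) * F w.2|} ∪
    {w | t / 2 ≤ |1 / (p : ℝ) * G w.1 - 1 / (p : ℝ) * G w.2|}) fun w hw => ?_).trans
    ((measure_union_le _ _).trans ((add_le_add (hconv F hF hFL) (hconv G hG hGL)).trans_eq ?_))
  · have hw' : t ≤ |1 / (p : ℝ) * (resolventAt (gram w.1) z).trace -
        1 / (p : ℝ) * (resolventAt (gram w.2) z).trace| := hw
    rw [hFG, hFG] at hw'
    by_contra hcon
    simp only [Set.mem_union, Set.mem_ofPred_eq, not_or, not_le] at hcon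
    have h1 := abs_sub (1 / (p : ℝ) * F w.1 - 1 / (p : ℝ) * F w.2)
      (1 / (p : ℝ) * G w.1 - 1 / (p : ℝ) * G w.2)
    have e : 1 / (p : ℝ) * (F w.1 - G w.1) - 1 / (p : ℝ) * (F w.2 - G w.2) =
      1 / (p : ℝ) * F w.1 - 1 / (p : ℝ) * F w.2 - (1 / (p : ℝ) * G w.1 - 1 / (p : ℝ) * G w.2) := by
      ring
    rw [e] at hw'
    linarith [hcon.1, hcon.2]
  · beta_reduce
    rw [show ∀ r : ℝ, 2 * K * C₀ * r = 2 * (K * (C₀ * r)) from fun r => by ring,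
      ENNReal.ofReal_mul (p := 2) (by norm_num), ENNReal.ofReal_mul (p := (K : ℝ)) (by positivity),
      ENNReal.ofReal_natCast, ENNReal.ofReal_ofNat, two_mul]

/-- From concentration of `Z - Z'` and a second moment bound to concentration around a pivot. -/
theorem SelfConcentrated.concentratedAround {Ω : Type*} [MeasurableSpace Ω] {P : Measure Ω}
    [IsProbabilityMeasure P] {Z : Ω → ℝ} (hZ : Measurable Z) {q A c a s ν : ℝ} (hq : 0 < q)
    (hc : 0 < c) (hs : 0 < s) (hν : 0 < ν)
    (h : SelfConcentrated P Z fun t => A * Real.exp (-((ν * t) ^ q / c)))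
    (hi : Integrable (fun ω => (Z ω - a) ^ 2) P)
    (h2 : ∫ ω, (Z ω - a) ^ 2 ∂P ≤ s ^ 2 / ν ^ 2) {C : ℝ} (hC1 : 2 * A ≤ C)
    (hC2 : Real.exp ((4 * s) ^ q / (c * 2 ^ q)) ≤ C) :
    ConcentratedAround P Z a fun t => C * Real.exp (-((ν * t) ^ q / (c * 2 ^ q))) := by
  intro t ht
  have hC0 : 0 < C := (Real.exp_pos _).trans_le hC2
  -- For small `t` the claimed bound is at least `1` by the choice of `C`. For large `t` an
  -- independent copy lies near the pivot with probability at least `1/2`.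
  rcases le_total (ν * t) (4 * s) with hle | hle
  · refine prob_le_one.trans ?_
    rw [ENNReal.one_le_ofReal]
    have h3 : (ν * t) ^ q / (c * 2 ^ q) ≤ (4 * s) ^ q / (c * 2 ^ q) := by gcongr
    calc (1 : ℝ) = Real.exp ((4 * s) ^ q / (c * 2 ^ q)) *
          Real.exp (-((4 * s) ^ q / (c * 2 ^ q))) := by rw [← Real.exp_add]; simp
      _ ≤ C * Real.exp (-((ν * t) ^ q / (c * 2 ^ q))) :=
          mul_le_mul hC2 (Real.exp_le_exp.mpr (by linarith)) (Real.exp_pos _).le hC0.le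
  · have hD : MeasurableSet {ω | 2 * s / ν ≤ |Z ω - a|} :=
      measurableSet_le measurable_const (hZ.sub_const a).abs
    have hcheb : P {ω | 2 * s / ν ≤ |Z ω - a|} ≤ 1 / 2 := by
      have hsub : {ω | 2 * s / ν ≤ |Z ω - a|} ⊆ {ω | 4 * (s ^ 2 / ν ^ 2) ≤ (Z ω - a) ^ 2} := by
        intro ω hω
        have hω' : 2 * s / ν ≤ |Z ω - a| := hω
        have : (2 * s / ν) ^ 2 ≤ |Z ω - a| ^ 2 := by gcongr
        rw [sq_abs] at this
        calc 4 * (s ^ 2 / ν ^ 2) = (2 * s / ν) ^ 2 := by ring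
          _ ≤ _ := this
      have hpos : 0 < s ^ 2 / ν ^ 2 := by positivity
      have hmark := mul_meas_ge_le_integral_of_nonneg
        (Filter.Eventually.of_forall fun ω => sq_nonneg (Z ω - a)) hi (4 * (s ^ 2 / ν ^ 2))
      have h4 : P.real {ω | 4 * (s ^ 2 / ν ^ 2) ≤ (Z ω - a) ^ 2} ≤ 1 / 2 := by
        by_contra hcon
        push Not at hcon
        nlinarith
      have h5 : P {ω | 4 * (s ^ 2 / ν ^ 2) ≤ (Z ω - a) ^ 2} ≤ ENNReal.ofReal (1 / 2) := by
        rw [← ENNReal.ofReal_toReal (measure_ne_top P _)]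
        exact ENNReal.ofReal_le_ofReal h4
      refine (measure_mono hsub).trans (h5.trans_eq ?_)
      rw [ENNReal.ofReal_div_of_pos (by norm_num)]
      simp
    have hgood : 1 / 2 ≤ P {ω | 2 * s / ν ≤ |Z ω - a|}ᶜ := by
      rw [prob_compl_eq_one_sub hD]
      have : (1 : ENNReal) / 2 + 1 / 2 ≤ 1 := by rw [ENNReal.add_halves]
      calc (1 : ENNReal) / 2 = 1 - 1 / 2 := by
            rw [one_div, ENNReal.one_sub_inv_two]
        _ ≤ _ := tsub_le_tsub_left hcheb _
    -- If `Z` is at distance at least `t` from `a`, and the copy within `2s/ν ≤ t/2` of it, the two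
    -- are at distance at least `t/2`.
    have hprod : P {ω | t ≤ |Z ω - a|} * P {ω | 2 * s / ν ≤ |Z ω - a|}ᶜ ≤
        ENNReal.ofReal (A * Real.exp (-((ν * (t / 2)) ^ q / c))) := by
      rw [← Measure.prod_prod]
      refine (measure_mono fun w hw => ?_).trans (h (t / 2) (by positivity))
      obtain ⟨hw1, hw2⟩ := hw
      have hw1' : t ≤ |Z w.1 - a| := hw1
      have hw2' : |Z w.2 - a| < 2 * s / ν := not_le.mp hw2
      have h3 : 2 * s / ν ≤ t / 2 := by
        rw [div_le_iff₀ hν]; linarith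
      have h4 := abs_sub_le (Z w.1) (Z w.2) a
      change t / 2 ≤ |Z w.1 - Z w.2|
      linarith
    have e : (ν * (t / 2)) ^ q / c = (ν * t) ^ q / (c * 2 ^ q) := by
      rw [show ν * (t / 2) = ν * t / 2 by ring, Real.div_rpow (by positivity) (by norm_num)]
      field_simp
    rw [e] at hprod
    have h6 : P {ω | t ≤ |Z ω - a|} ≤
        2 * ENNReal.ofReal (A * Real.exp (-((ν * t) ^ q / (c * 2 ^ q)))) := by
      calc P {ω | t ≤ |Z ω - a|} = 2 * (P {ω | t ≤ |Z ω - a|} * (1 / 2)) := by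
            rw [mul_comm, mul_assoc, one_div, ENNReal.inv_mul_cancel (by simp) (by simp), mul_one]
        _ ≤ 2 * (P {ω | t ≤ |Z ω - a|} * P {ω | 2 * s / ν ≤ |Z ω - a|}ᶜ) := by gcongr
        _ ≤ _ := by gcongr
    refine h6.trans ?_
    rw [show (2 : ENNReal) = ENNReal.ofReal 2 by simp, ← ENNReal.ofReal_mul (by norm_num),
      ← mul_assoc]
    exact ENNReal.ofReal_le_ofReal (mul_le_mul_of_nonneg_right hC1 (Real.exp_pos _).le)

end TraceConcentration

/-! ### Removing one sample from the resolvent -/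

section LeaveOneOut

open Matrix
open scoped Matrix.Norms.L2Operator

variable {p n k : ℕ}

theorem outer_zero : outer (0 : EuclideanSpace ℝ (Fin p)) = 0 := by
  simp [outer]

theorem gram_update (x : Fin n → EuclideanSpace ℝ (Fin p)) (i : Fin n)
    (y : EuclideanSpace ℝ (Fin p)) :
    gram (Function.update x i y) = gram (Function.update x i 0) + (1 / (n : ℝ)) • outer y := by
  have h : ∀ y, ∑ j, outer (Function.update x i y j) =
      outer y + ∑ j ∈ Finset.univ.erase i, outer (x j) := by
    intro y
    rw [← Finset.add_sum_erase _ _ (Finset.mem_univ i), Function.update_self]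
    congr 1
    exact Finset.sum_congr rfl fun j hj => by
      rw [Function.update_of_ne (Finset.ne_of_mem_erase hj)]
  rw [gram, gram, h, h, outer_zero, zero_add, smul_add, add_comm]

theorem continuous_outer : Continuous (outer : EuclideanSpace ℝ (Fin p) → _) := by
  unfold outer
  fun_prop

theorem continuous_gram :
    Continuous (gram : (Fin n → EuclideanSpace ℝ (Fin p)) → Matrix (Fin p) (Fin p) ℝ) := by
  unfold gram
  have := continuous_outer (p := p)
  fun_prop

theorem continuous_bilin {X : Type*} [TopologicalSpace X] {A : X → Matrix (Fin p) (Fin p) ℝ}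
    {u v : X → EuclideanSpace ℝ (Fin p)} (hA : Continuous A) (hu : Continuous u)
    (hv : Continuous v) : Continuous fun x => bilin (A x) (u x) (v x) := by
  unfold bilin
  fun_prop

/-- The resolvent of the sample covariance matrix without the `i`-th sample. -/
noncomputable def leaveOneOut (z : ℝ) (x : Fin n → EuclideanSpace ℝ (Fin p)) (i : Fin n) :
    Matrix (Fin p) (Fin p) ℝ :=
  resolventAt (gram (Function.update x i 0)) z

/-- The quadratic form `xᵢᵀ Q₋ᵢ xᵢ / n`. -/
noncomputable def leaveOneOutForm (z : ℝ) (x : Fin n → EuclideanSpace ℝ (Fin p)) (i : Fin n) : ℝ :=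
  1 / (n : ℝ) * bilin (leaveOneOut z x i) (x i) (x i)

variable {z : ℝ}

theorem leaveOneOut_update (x : Fin n → EuclideanSpace ℝ (Fin p)) (i : Fin n)
    (y : EuclideanSpace ℝ (Fin p)) :
    leaveOneOut z (Function.update x i y) i = leaveOneOut z x i := by
  rw [leaveOneOut, Function.update_idem, leaveOneOut]

theorem leaveOneOut_posSemidef (hz : 0 < z) (x : Fin n → EuclideanSpace ℝ (Fin p)) (i : Fin n) :
    (leaveOneOut z x i).PosSemidef :=
  resolventAt_posSemidef (gram_posSemidef _) hz

theorem norm_leaveOneOut_le (hz : 0 < z) (x : Fin n → EuclideanSpace ℝ (Fin p)) (i : Fin n) :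
    ‖leaveOneOut z x i‖ ≤ 1 / z :=
  norm_resolventAt_le (gram_posSemidef _) hz

theorem continuous_resolventAt_gram (hz : 0 < z) :
    Continuous fun x : Fin n → EuclideanSpace ℝ (Fin p) => resolventAt (gram x) z :=
  continuous_resolventAt continuous_gram gram_posSemidef hz

theorem continuous_leaveOneOut (hz : 0 < z) (i : Fin n) :
    Continuous fun x : Fin n → EuclideanSpace ℝ (Fin p) => leaveOneOut z x i :=
  (continuous_resolventAt_gram hz).comp (by fun_prop)

theorem continuous_leaveOneOutForm (hz : 0 < z) (i : Fin n) :
    Continuous fun x : Fin n → EuclideanSpace ℝ (Fin p) => leaveOneOutForm z x i :=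
  continuous_const.mul
    (continuous_bilin (continuous_leaveOneOut hz i) (continuous_apply i) (continuous_apply i))

theorem leaveOneOutForm_nonneg (hz : 0 < z) (x : Fin n → EuclideanSpace ℝ (Fin p)) (i : Fin n) :
    0 ≤ leaveOneOutForm z x i :=
  mul_nonneg (by positivity) (bilin_self_nonneg (leaveOneOut_posSemidef hz x i) _)

theorem leaveOneOutForm_le (hz : 0 < z) (x : Fin n → EuclideanSpace ℝ (Fin p)) (i : Fin n) :
    leaveOneOutForm z x i ≤ 1 / (n : ℝ) * (‖x i‖ ^ 2 / z) :=
  mul_le_mul_of_nonneg_left (bilin_resolventAt_le (gram_posSemidef _) hz _) (by positivity)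

theorem gram_eq_update_add (x : Fin n → EuclideanSpace ℝ (Fin p)) (i : Fin n) :
    gram x = gram (Function.update x i 0) + (1 / (n : ℝ)) • outer (x i) := by
  conv_lhs => rw [← Function.update_eq_self i x, gram_update]

theorem leaveOneOut_sub_posSemidef (hz : 0 < z) (x : Fin n → EuclideanSpace ℝ (Fin p))
    (i : Fin n) : (leaveOneOut z x i - resolventAt (gram x) z).PosSemidef := by
  rw [gram_eq_update_add x i]
  exact resolventAt_sub_add_outer_posSemidef (gram_posSemidef _) hz (by positivity) _

theorem trace_leaveOneOut_sub_le (hz : 0 < z) (x : Fin n → EuclideanSpace ℝ (Fin p))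
    (i : Fin n) : (leaveOneOut z x i - resolventAt (gram x) z).trace ≤ 1 / z := by
  rw [gram_eq_update_add x i]
  exact trace_resolventAt_sub_add_outer_le (gram_posSemidef _) hz (by positivity) _

theorem trace_leaveOneOut_sub_le' (hz : 0 < z) (x : Fin n → EuclideanSpace ℝ (Fin p))
    (i : Fin n) :
    (leaveOneOut z x i - resolventAt (gram x) z).trace ≤ 1 / (n : ℝ) * ‖x i‖ ^ 2 / z ^ 2 := by
  rw [gram_eq_update_add x i]
  exact trace_resolventAt_sub_add_outer_le' (gram_posSemidef _) hz (by positivity) _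

theorem bilin_mul_of_isHermitian {A G : Matrix (Fin p) (Fin p) ℝ} (hA : A.IsHermitian)
    (u v : EuclideanSpace ℝ (Fin p)) :
    bilin (A * G) u v = (A *ᵥ u.ofLp) ⬝ᵥ (G *ᵥ v.ofLp) := by
  have hA' : A.IsSymm := by simpa using hA
  rw [bilin, ← mulVec_mulVec, dotProduct_mulVec, ← mulVec_transpose, hA'.eq]

/-- Sherman–Morrison: passing from `Q` to `Q₋ᵢ` inside a form at `x_i` costs exactly the factor
`1/(1 + Δ_i)`, which the coefficients `1/(1 + δ_l)` of `Q̃_δ` are meant to match. -/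
theorem bilin_resolventAt_gram_mul (hz : 0 < z) (x : Fin n → EuclideanSpace ℝ (Fin p))
    (i : Fin n) (G : Matrix (Fin p) (Fin p) ℝ) :
    bilin (resolventAt (gram x) z * G) (x i) (x i) =
      (1 + leaveOneOutForm z x i)⁻¹ * bilin (leaveOneOut z x i * G) (x i) (x i) := by
  rw [bilin_mul_of_isHermitian (resolventAt_isHermitian (gram_posSemidef _) hz),
    bilin_mul_of_isHermitian (leaveOneOut_posSemidef hz x i).isHermitian, gram_eq_update_add x i,
    resolventAt_add_outer_mulVec (gram_posSemidef _) hz (by positivity), smul_dotProduct,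
    smul_eq_mul]
  rfl

theorem sum_proportion_smul {V : Type*} [AddCommGroup V] [Module ℝ V] (κ : Fin n → Fin k)
    (f : Fin k → V) : ∑ l, proportion κ l • f l = (1 / (n : ℝ)) • ∑ i, f (κ i) := by
  rw [← Finset.sum_fiberwise' Finset.univ κ f, Finset.smul_sum]
  refine Finset.sum_congr rfl fun l _ => ?_
  rw [Finset.sum_const, proportion, ← Nat.cast_smul_eq_nsmul ℝ, smul_smul]
  congr 1
  ring

theorem proportion_nonneg (κ : Fin n → Fin k) (l : Fin k) : 0 ≤ proportion κ l :=
  div_nonneg (Nat.cast_nonneg _) (Nat.cast_nonneg _)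

/-- Algebraic decomposition of `Q - Q̃_δ` along the samples. -/
theorem trace_mul_resolventAt_sub_QTilde (hz : 0 < z) (κ : Fin n → Fin k)
    {S : Fin k → Matrix (Fin p) (Fin p) ℝ} (hS : ∀ l, (S l).PosSemidef) {δ : Fin k → ℝ}
    (hδ : ∀ l, 0 ≤ δ l) (R : Matrix (Fin p) (Fin p) ℝ) (x : Fin n → EuclideanSpace ℝ (Fin p)) :
    (R * (resolventAt (gram x) z - QTilde (proportion κ) S z δ)).trace =
      1 / (n : ℝ) * ∑ i,
        ((1 + δ (κ i))⁻¹ * (resolventAt (gram x) z * (R * QTilde (proportion κ) S z δ) *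
            S (κ i)).trace -
          (1 + leaveOneOutForm z x i)⁻¹ *
            bilin (leaveOneOut z x i * (R * QTilde (proportion κ) S z δ)) (x i) (x i)) := by
  set B := QTilde (proportion κ) S z δ with hB
  set Q := resolventAt (gram x) z with hQ
  have hSS := sum_smul_posSemidef (proportion_nonneg κ) hS hδ
  have h1 : Q - B = B * (∑ l, (proportion κ l / (1 + δ l)) • S l - gram x) * Q := by
    have := resolventAt_sub hSS (gram_posSemidef x) hz
    rw [← neg_sub B Q, hB, QTilde, hQ, this, ← Matrix.neg_mul, ← Matrix.mul_neg, neg_sub]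
  have h2 : ∑ l, (proportion κ l / (1 + δ l)) • S l =
      (1 / (n : ℝ)) • ∑ i, (1 + δ (κ i))⁻¹ • S (κ i) := by
    rw [← sum_proportion_smul κ fun l => (1 + δ l)⁻¹ • S l]
    exact Finset.sum_congr rfl fun l _ => by rw [smul_smul, div_eq_mul_inv]
  have h3 : (R * (Q - B)).trace = ((Q * (R * B)) *
      (∑ l, (proportion κ l / (1 + δ l)) • S l - gram x)).trace := by
    rw [h1, ← Matrix.mul_assoc, ← Matrix.mul_assoc, trace_mul_comm]
    simp only [Matrix.mul_assoc]
  rw [h3, h2, gram, ← smul_sub, ← Finset.sum_sub_distrib, mul_smul_comm, trace_smul, smul_eq_mul,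
    Finset.mul_sum, trace_sum]
  congr 1
  refine Finset.sum_congr rfl fun i _ => ?_
  rw [Matrix.mul_sub, trace_sub, mul_smul_comm, trace_smul, smul_eq_mul, trace_mul_outer,
    hQ, bilin_resolventAt_gram_mul hz]

end LeaveOneOut

/-! ### Integrals over one coordinate of a product -/

section ProductIntegrals

variable {n : ℕ} {X : Type*} [MeasurableSpace X] (ν : Fin n → Measure X)
  [∀ i, IsProbabilityMeasure (ν i)]

theorem integrable_update {h : (Fin n → X) → ℝ} (i : Fin n)
    (hi : Integrable h (Measure.pi ν)) :
    Integrable (fun w : (Fin n → X) × X => h (Function.update w.1 i w.2))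
      ((Measure.pi ν).prod (ν i)) :=
  (measurePreserving_update ν i).integrable_comp_of_integrable hi

/-- Resampling one coordinate. -/
theorem integral_pi_eq_integral_update {h : (Fin n → X) → ℝ} (i : Fin n)
    (hi : Integrable h (Measure.pi ν)) :
    ∫ x, h x ∂(Measure.pi ν) = ∫ x, ∫ y, h (Function.update x i y) ∂(ν i) ∂(Measure.pi ν) := by
  have hm := measurePreserving_update ν i
  rw [← hm.map_eq] at hi
  rw [← integral_prod _ (integrable_update ν i (hm.map_eq ▸ hi)), ← hm.map_eq,
    integral_map hm.measurable.aemeasurable hi.1, hm.map_eq]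

theorem integrable_eval {f : X → ℝ} (i : Fin n) (hf : Integrable f (ν i)) :
    Integrable (fun x => f (x i)) (Measure.pi ν) :=
  (measurePreserving_eval ν i).integrable_comp_of_integrable hf

theorem integral_eval {f : X → ℝ} (i : Fin n) (hf : Integrable f (ν i)) :
    ∫ x, f (x i) ∂(Measure.pi ν) = ∫ y, f y ∂(ν i) := by
  have hm := measurePreserving_eval ν i
  rw [← hm.map_eq] at hf
  rw [← hm.map_eq, integral_map hm.measurable.aemeasurable hf.1]

end ProductIntegrals

/-! ### Mean resolvent against a deterministic equivalent with arbitrary parameter -/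

section MeanComparison

open Matrix
open scoped Matrix.Norms.L2Operator

variable {p n k : ℕ}

theorem abs_trace_le_card_mul_norm (D : Matrix (Fin p) (Fin p) ℝ) : |D.trace| ≤ p * ‖D‖ := by
  refine abs_le.mpr ⟨?_, trace_le_card_mul_norm D⟩
  have := trace_le_card_mul_norm (-D)
  rw [trace_neg, norm_neg] at this
  linarith

theorem integrable_trace_of_norm_le {X : Type*} [TopologicalSpace X] [MeasurableSpace X]
    [OpensMeasurableSpace X] {P : Measure X} [IsFiniteMeasure P]
    {f : X → Matrix (Fin p) (Fin p) ℝ} (hf : Continuous f) {c : ℝ} (hc : ∀ x, ‖f x‖ ≤ c) :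
    Integrable (fun x => (f x).trace) P := by
  refine Integrable.mono' (integrable_const (p * c))
    hf.matrix_trace.measurable.aestronglyMeasurable (Filter.Eventually.of_forall fun x => ?_)
  rw [Real.norm_eq_abs]
  exact (abs_trace_le_card_mul_norm _).trans (by gcongr; exact hc x)

theorem memLp_two_of_memLp_four {μ : Measure (EuclideanSpace ℝ (Fin p))} [IsFiniteMeasure μ]
    (h : MemLp (fun y => y) 4 μ) : MemLp (fun y => y) 2 μ :=
  h.mono_exponent (by norm_num)

theorem integrable_norm_sq_of_memLp {μ : Measure (EuclideanSpace ℝ (Fin p))}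
    (h : MemLp (fun y => y) 2 μ) : Integrable (fun y => ‖y‖ ^ 2) μ := by
  simpa using h.integrable_norm_pow (by norm_num)

theorem integrable_norm_pow_four_of_memLp {μ : Measure (EuclideanSpace ℝ (Fin p))}
    (h : MemLp (fun y => y) 4 μ) : Integrable (fun y => ‖y‖ ^ 4) μ := by
  have h' : MemLp (fun y => y) ((4 : ℕ) : ENNReal) μ := by simpa using h
  exact h'.integrable_norm_pow (by norm_num)

variable {μ : Fin k → Measure (EuclideanSpace ℝ (Fin p))} [∀ l, IsProbabilityMeasure (μ l)]
  {z : ℝ}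

theorem integrable_leaveOneOutForm_sub_sq (hz : 0 < z) (κ : Fin n → Fin k)
    (h4 : ∀ l, MemLp (fun y => y) 4 (μ l)) (i : Fin n) (d : ℝ) :
    Integrable (fun x => (leaveOneOutForm z x i - d) ^ 2) (Measure.pi fun i => μ (κ i)) := by
  have hI := integrable_eval (fun i => μ (κ i)) i (integrable_norm_pow_four_of_memLp (h4 (κ i)))
  have hg := (hI.const_mul (2 * (1 / ((n : ℝ) * z)) ^ 2)).add (integrable_const (2 * d ^ 2))
  refine hg.mono'
    (((continuous_leaveOneOutForm hz i).sub continuous_const).pow 2).aestronglyMeasurable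
    (Filter.Eventually.of_forall fun x => ?_)
  rw [Real.norm_eq_abs, abs_of_nonneg (sq_nonneg _)]
  have h1 := leaveOneOutForm_nonneg hz x i
  have h2 := leaveOneOutForm_le hz x i
  have h3 : leaveOneOutForm z x i ^ 2 ≤ (1 / (n : ℝ) * (‖x i‖ ^ 2 / z)) ^ 2 := by gcongr
  have h5 : (1 / (n : ℝ) * (‖x i‖ ^ 2 / z)) ^ 2 = (1 / ((n : ℝ) * z)) ^ 2 * ‖x i‖ ^ 4 := by
    rw [show 1 / (n : ℝ) * (‖x i‖ ^ 2 / z) = 1 / ((n : ℝ) * z) * ‖x i‖ ^ 2 by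
      rw [one_div_mul_eq_div, div_div, one_div_mul_eq_div, mul_comm]]
    ring
  simp only [Pi.add_apply]
  nlinarith [sq_nonneg (leaveOneOutForm z x i + d)]

theorem integrable_norm_sq_mul_leaveOneOutForm_sub (hz : 0 < z) (κ : Fin n → Fin k)
    (h4 : ∀ l, MemLp (fun y => y) 4 (μ l)) (i : Fin n) (d : ℝ) :
    Integrable (fun x => ‖x i‖ ^ 2 * |leaveOneOutForm z x i - d|)
      (Measure.pi fun i => μ (κ i)) := by
  have hI := integrable_eval (fun i => μ (κ i)) i (integrable_norm_pow_four_of_memLp (h4 (κ i)))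
  refine (hI.add (integrable_leaveOneOutForm_sub_sq hz κ h4 i d)).mono' ?_
    (Filter.Eventually.of_forall fun x => ?_)
  · have := continuous_leaveOneOutForm (p := p) hz i
    have h : Continuous fun x : Fin n → EuclideanSpace ℝ (Fin p) =>
      ‖x i‖ ^ 2 * |leaveOneOutForm z x i - d| := by fun_prop
    exact h.aestronglyMeasurable
  · rw [Real.norm_eq_abs, abs_of_nonneg (by positivity)]
    simp only [Pi.add_apply]
    nlinarith [sq_nonneg (‖x i‖ ^ 2 - |leaveOneOutForm z x i - d|),
      sq_abs (leaveOneOutForm z x i - d)]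

theorem integral_norm_sq_mul_leaveOneOutForm_sub_le (hz : 0 < z) (hp : 0 < p) (hn : 0 < n)
    (κ : Fin n → Fin k) (h4 : ∀ l, MemLp (fun y => y) 4 (μ l)) (i : Fin n) (d : ℝ) {B V : ℝ}
    (hB : ∫ y, ‖y‖ ^ 4 ∂(μ (κ i)) ≤ B * p ^ 2)
    (hV : ∫ x, (leaveOneOutForm z x i - d) ^ 2 ∂(Measure.pi fun i => μ (κ i)) ≤ V / n) :
    ∫ x, ‖x i‖ ^ 2 * |leaveOneOutForm z x i - d| ∂(Measure.pi fun i => μ (κ i)) ≤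
      (B + V) * (p / √n) := by
  have hp' : (0 : ℝ) < p := by exact_mod_cast hp
  have hn' : (0 : ℝ) < n := by exact_mod_cast hn
  have hs : 0 < √(n : ℝ) := Real.sqrt_pos.mpr hn'
  have hsq : √(n : ℝ) ^ 2 = n := Real.sq_sqrt hn'.le
  have h4' := integrable_norm_pow_four_of_memLp (h4 (κ i))
  have hI := integrable_eval (fun i => μ (κ i)) i h4'
  have hI2 := integrable_leaveOneOutForm_sub_sq hz κ h4 i d
  -- Arithmetic–geometric inequality with weight `p√n`, which balances a fourth moment of order `p²`
  -- against a squared deviation of order `1/n`.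
  have hle : ∫ x, ‖x i‖ ^ 2 * |leaveOneOutForm z x i - d| ∂(Measure.pi fun i => μ (κ i)) ≤
      ∫ x, (1 / (p * √n) * ‖x i‖ ^ 4 + p * √n * (leaveOneOutForm z x i - d) ^ 2)
        ∂(Measure.pi fun i => μ (κ i)) := by
    refine integral_mono (integrable_norm_sq_mul_leaveOneOutForm_sub hz κ h4 i d)
      ((hI.const_mul _).add (hI2.const_mul _)) fun x => ?_
    have e : 1 / (p * √(n : ℝ)) * ‖x i‖ ^ 4 + p * √n * (leaveOneOutForm z x i - d) ^ 2 =
        1 / (p * √(n : ℝ)) * ((‖x i‖ ^ 2) ^ 2 + (p * √n * |leaveOneOutForm z x i - d|) ^ 2) := by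
      rw [mul_pow _ (|_|), sq_abs]
      field_simp
    have e2 : ‖x i‖ ^ 2 * |leaveOneOutForm z x i - d| =
        1 / (p * √(n : ℝ)) * (‖x i‖ ^ 2 * (p * √n * |leaveOneOutForm z x i - d|)) := by
      field_simp
    simp only [e, e2]
    gcongr
    have ha : 0 ≤ p * √(n : ℝ) * |leaveOneOutForm z x i - d| := by positivity
    nlinarith [sq_nonneg (‖x i‖ ^ 2 - p * √(n : ℝ) * |leaveOneOutForm z x i - d|),
      sq_nonneg (‖x i‖ ^ 2), sq_nonneg (p * √(n : ℝ) * |leaveOneOutForm z x i - d|)]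
  refine hle.trans ?_
  rw [integral_add (hI.const_mul _) (hI2.const_mul _), integral_const_mul, integral_const_mul,
    integral_eval (fun i => μ (κ i)) i h4']
  calc _ ≤ 1 / (p * √(n : ℝ)) * (B * p ^ 2) + p * √n * (V / n) := by gcongr
    _ = (B + V) * (p / √n) := by
      nth_rewrite 3 [← hsq]
      field_simp

/-- Comparison of the mean resolvent with a deterministic equivalent `Q̃_δ`. -/
theorem abs_integral_trace_mul_sub_QTilde_le (hz : 0 < z) (hn : 0 < n) (κ : Fin n → Fin k)
    (h4 : ∀ l, MemLp (fun y => y) 4 (μ l)) {δ : Fin k → ℝ} (hδ : ∀ l, 0 ≤ δ l)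
    {R : Matrix (Fin p) (Fin p) ℝ} {r T D : ℝ} (hR : ‖R‖ ≤ r)
    (hT : ∀ i, ∫ x, |(R * QTilde (proportion κ) (fun l => populationCov (μ l)) z δ *
        populationCov (μ (κ i)) * (leaveOneOut z x i - resolventAt (gram x) z)).trace|
        ∂(Measure.pi fun i => μ (κ i)) ≤ T)
    (hD : ∀ i, ∫ x, ‖x i‖ ^ 2 * |leaveOneOutForm z x i - δ (κ i)|
      ∂(Measure.pi fun i => μ (κ i)) ≤ D) :
    |∫ x, (R * (resolventAt (gram x) z -
        QTilde (proportion κ) (fun l => populationCov (μ l)) z δ)).trace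
        ∂(Measure.pi fun i => μ (κ i))| ≤ T + r / z ^ 2 * D := by
  set P := Measure.pi fun i => μ (κ i) with hP
  have h2 := fun l => memLp_two_of_memLp_four (h4 l)
  have hS := fun l => populationCov_posSemidef (h2 l)
  set B := QTilde (proportion κ) (fun l => populationCov (μ l)) z δ with hB
  set G := R * B with hG
  have hr : 0 ≤ r := (norm_nonneg R).trans hR
  have hGn : ‖G‖ ≤ r / z := by
    refine (norm_mul_le _ _).trans ?_
    have := norm_QTilde_le (proportion_nonneg κ) hS hδ hz
    rw [div_eq_mul_one_div]
    gcongr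
  have hdec : ∀ x, (R * (resolventAt (gram x) z - B)).trace = _ := fun x =>
    trace_mul_resolventAt_sub_QTilde hz κ hS hδ R x
  rw [← hB, ← hG] at hdec
  simp only [hdec]
  clear_value G
  have hQc := continuous_resolventAt_gram (p := p) (n := n) hz
  have hQn : ∀ x : Fin n → EuclideanSpace ℝ (Fin p), ‖resolventAt (gram x) z‖ ≤ 1 / z :=
    fun x => norm_resolventAt_le (gram_posSemidef x) hz
  have hI1 : ∀ i, Integrable (fun x => (resolventAt (gram x) z * G *
      populationCov (μ (κ i))).trace) P := fun i => by
    refine integrable_trace_of_norm_le (c := 1 / z * ‖G‖ * ‖populationCov (μ (κ i))‖)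
      (by fun_prop) fun x => ?_
    refine (norm_mul_le _ _).trans ?_
    gcongr
    refine (norm_mul_le _ _).trans ?_
    gcongr
    exact hQn x
  have hI2 : ∀ i, Integrable (fun x => (leaveOneOut z x i * G *
      populationCov (μ (κ i))).trace) P := fun i => by
    have := continuous_leaveOneOut (p := p) hz i
    refine integrable_trace_of_norm_le (c := 1 / z * ‖G‖ * ‖populationCov (μ (κ i))‖)
      (by fun_prop) fun x => ?_
    refine (norm_mul_le _ _).trans ?_
    gcongr
    refine (norm_mul_le _ _).trans ?_
    gcongr
    exact norm_leaveOneOut_le hz x i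
  have hb : ∀ i (x : Fin n → EuclideanSpace ℝ (Fin p)),
      |bilin (leaveOneOut z x i * G) (x i) (x i)| ≤ r / z ^ 2 * ‖x i‖ ^ 2 := fun i x => by
    refine (abs_bilin_le _ _ _).trans ?_
    rw [← sq]
    gcongr
    refine (norm_mul_le _ _).trans ?_
    calc _ ≤ 1 / z * (r / z) := by
          gcongr
          exact norm_leaveOneOut_le hz x i
      _ = _ := by field_simp
  have hbc : ∀ i, Continuous fun x : Fin n → EuclideanSpace ℝ (Fin p) =>
      bilin (leaveOneOut z x i * G) (x i) (x i) := fun i => by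
    have := continuous_leaveOneOut (p := p) hz i
    exact continuous_bilin (by fun_prop) (by fun_prop) (by fun_prop)
  have hN : ∀ i, Integrable (fun x => r / z ^ 2 * ‖x i‖ ^ 2) P := fun i =>
    (integrable_eval (fun i => μ (κ i)) i (integrable_norm_sq_of_memLp (h2 (κ i)))).const_mul _
  have hI3 : ∀ i, Integrable (fun x => bilin (leaveOneOut z x i * G) (x i) (x i)) P := fun i =>
    (hN i).mono' (hbc i).aestronglyMeasurable (Filter.Eventually.of_forall fun x => hb i x)
  have hI4 : ∀ i, Integrable (fun x => (1 + leaveOneOutForm z x i)⁻¹ *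
      bilin (leaveOneOut z x i * G) (x i) (x i)) P := fun i => by
    refine (hN i).mono' ?_ (Filter.Eventually.of_forall fun x => ?_)
    · have h1 : Continuous fun x : Fin n → EuclideanSpace ℝ (Fin p) =>
          (1 + leaveOneOutForm z x i)⁻¹ :=
        (continuous_const.add (continuous_leaveOneOutForm hz i)).inv₀ fun x =>
          (add_pos_of_pos_of_nonneg one_pos (leaveOneOutForm_nonneg hz x i)).ne'
      exact (h1.mul (hbc i)).aestronglyMeasurable
    · have h1 := leaveOneOutForm_nonneg hz x i
      rw [Real.norm_eq_abs, abs_mul, abs_of_pos (by positivity)]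
      have : (1 + leaveOneOutForm z x i)⁻¹ ≤ 1 := inv_le_one_of_one_le₀ (by linarith)
      calc _ ≤ 1 * |bilin (leaveOneOut z x i * G) (x i) (x i)| := by gcongr
        _ ≤ _ := by rw [one_mul]; exact hb i x
  -- Since `Q₋ᵢ` does not depend on `x_i`, integrating over `x_i` alone replaces `x_i x_iᵀ` by the
  -- covariance of its class.
  have hres : ∀ i, ∫ x, bilin (leaveOneOut z x i * G) (x i) (x i) ∂P =
      ∫ x, (leaveOneOut z x i * G * populationCov (μ (κ i))).trace ∂P := fun i => by
    rw [hP, integral_pi_eq_integral_update (fun i => μ (κ i)) i (hI3 i)]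
    congr 1
    funext x
    simp only [leaveOneOut_update, Function.update_self]
    rw [trace_mul_populationCov (h2 (κ i))]
  have hterm : ∀ i, |∫ x, ((1 + δ (κ i))⁻¹ * (resolventAt (gram x) z * G *
      populationCov (μ (κ i))).trace - (1 + leaveOneOutForm z x i)⁻¹ *
        bilin (leaveOneOut z x i * G) (x i) (x i)) ∂P| ≤ T + r / z ^ 2 * D := fun i => by
    have hd := hδ (κ i)
    have hd1 : (1 + δ (κ i))⁻¹ ≤ 1 := inv_le_one_of_one_le₀ (by linarith)
    have hd0 : 0 ≤ (1 + δ (κ i))⁻¹ := by positivity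
    -- The error of one sample splits in two: replacing `Q` by `Q₋ᵢ`, controlled by `T`, and
    -- replacing `Δ_i` by `δ_l`, controlled by `D`.
    have e : ∫ x, ((1 + δ (κ i))⁻¹ * (resolventAt (gram x) z * G *
        populationCov (μ (κ i))).trace - (1 + leaveOneOutForm z x i)⁻¹ *
          bilin (leaveOneOut z x i * G) (x i) (x i)) ∂P =
        -((1 + δ (κ i))⁻¹ * ∫ x, (G * populationCov (μ (κ i)) *
          (leaveOneOut z x i - resolventAt (gram x) z)).trace ∂P) +
        ∫ x, ((1 + δ (κ i))⁻¹ * bilin (leaveOneOut z x i * G) (x i) (x i) -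
          (1 + leaveOneOutForm z x i)⁻¹ * bilin (leaveOneOut z x i * G) (x i) (x i)) ∂P := by
      have e1 : ∀ x, (G * populationCov (μ (κ i)) *
          (leaveOneOut z x i - resolventAt (gram x) z)).trace =
          (leaveOneOut z x i * G * populationCov (μ (κ i))).trace -
            (resolventAt (gram x) z * G * populationCov (μ (κ i))).trace := fun x => by
        rw [Matrix.mul_sub, trace_sub, trace_mul_comm, trace_mul_comm _ (resolventAt _ _),
          Matrix.mul_assoc, Matrix.mul_assoc]
      simp only [e1]
      rw [integral_sub ((hI1 i).const_mul _) (hI4 i), integral_sub (hI2 i) (hI1 i),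
        integral_sub ((hI3 i).const_mul _) (hI4 i), integral_const_mul, integral_const_mul,
        hres i]
      ring
    rw [e]
    refine (abs_add_le _ _).trans (add_le_add ?_ ?_)
    · rw [abs_neg, abs_mul, abs_of_nonneg hd0]
      calc _ ≤ 1 * |∫ x, (G * populationCov (μ (κ i)) *
            (leaveOneOut z x i - resolventAt (gram x) z)).trace ∂P| := by gcongr
        _ ≤ _ := by rw [one_mul]; exact (abs_integral_le_integral_abs).trans (hT i)
    · have hle : ∫ x, |(1 + δ (κ i))⁻¹ * bilin (leaveOneOut z x i * G) (x i) (x i) -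
          (1 + leaveOneOutForm z x i)⁻¹ * bilin (leaveOneOut z x i * G) (x i) (x i)| ∂P ≤
          ∫ x, r / z ^ 2 * (‖x i‖ ^ 2 * |leaveOneOutForm z x i - δ (κ i)|) ∂P := by
        refine integral_mono (((hI3 i).const_mul _).sub (hI4 i)).abs
          ((integrable_norm_sq_mul_leaveOneOutForm_sub hz κ h4 i _).const_mul _) fun x => ?_
        have h1 := leaveOneOutForm_nonneg hz x i
        simp only
        rw [← sub_mul, abs_mul, ← mul_assoc, mul_comm |_|]
        refine mul_le_mul (hb i x) ?_ (abs_nonneg _) (by positivity)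
        rw [inv_sub_inv (by positivity) (by positivity), abs_div, abs_of_pos (by positivity :
          0 < (1 + δ (κ i)) * (1 + leaveOneOutForm z x i)), add_sub_add_left_eq_sub]
        refine div_le_self (abs_nonneg (leaveOneOutForm z x i - δ (κ i))) ?_
        nlinarith [mul_nonneg hd h1]
      refine abs_integral_le_integral_abs.trans (hle.trans ?_)
      rw [integral_const_mul]
      gcongr
      exact hD i
  have hI5 : ∀ i ∈ Finset.univ, Integrable (fun x => (1 + δ (κ i))⁻¹ *
      (resolventAt (gram x) z * G * populationCov (μ (κ i))).trace -
        (1 + leaveOneOutForm z x i)⁻¹ * bilin (leaveOneOut z x i * G) (x i) (x i)) P :=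
    fun i _ => ((hI1 i).const_mul _).sub (hI4 i)
  rw [integral_const_mul, integral_finsetSum _ hI5]
  have hn' : (0 : ℝ) < n := by exact_mod_cast hn
  rw [abs_mul, abs_of_pos (by positivity)]
  calc _ ≤ 1 / (n : ℝ) * ∑ _i : Fin n, (T + r / z ^ 2 * D) := by
        gcongr
        exact (Finset.abs_sum_le_sum_abs _ _).trans (Finset.sum_le_sum fun i _ => hterm i)
    _ = _ := by
        rw [Finset.sum_const, Finset.card_univ, Fintype.card_fin, nsmul_eq_mul]
        field_simp

end MeanComparison

/-! ### Fluctuations of traces and of leave-one-out forms -/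

section Variance

open Matrix
open scoped Matrix.Norms.L2Operator

variable {p n k : ℕ} {μ : Fin k → Measure (EuclideanSpace ℝ (Fin p))}
  [∀ l, IsProbabilityMeasure (μ l)] {z : ℝ}

/-- The resolvents before and after the change share the same leave-one-out resolvent. Both traces
lie below its trace against `C`, by at most `‖C‖/z`, whatever the new sample. -/
theorem abs_trace_mul_resolventAt_update_sub_le (hz : 0 < z) {C : Matrix (Fin p) (Fin p) ℝ}
    (hC : C.PosSemidef) (x : Fin n → EuclideanSpace ℝ (Fin p)) (i : Fin n)
    (y : EuclideanSpace ℝ (Fin p)) :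
    |(C * resolventAt (gram (Function.update x i y)) z).trace -
      (C * resolventAt (gram x) z).trace| ≤ ‖C‖ * (1 / z) := by
  have key : ∀ x : Fin n → EuclideanSpace ℝ (Fin p),
      0 ≤ (C * leaveOneOut z x i).trace - (C * resolventAt (gram x) z).trace ∧
      (C * leaveOneOut z x i).trace - (C * resolventAt (gram x) z).trace ≤ ‖C‖ * (1 / z) := by
    intro x
    rw [← trace_sub, ← Matrix.mul_sub]
    have h := leaveOneOut_sub_posSemidef hz x i
    refine ⟨trace_mul_nonneg hC h, (le_abs_self _).trans ((abs_trace_mul_le C h).trans ?_)⟩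
    gcongr
    exact trace_leaveOneOut_sub_le hz x i
  have h1 := key x
  have h2 := key (Function.update x i y)
  rw [leaveOneOut_update] at h2
  rw [abs_le]
  constructor <;> linarith [h1.1, h1.2, h2.1, h2.2]

theorem integrable_trace_mul_resolventAt (hz : 0 < z) (P : Measure (Fin n → EuclideanSpace ℝ (Fin p)))
    [IsFiniteMeasure P] (R : Matrix (Fin p) (Fin p) ℝ) :
    Integrable (fun x => (R * resolventAt (gram x) z).trace) P := by
  have := continuous_resolventAt_gram (p := p) (n := n) hz
  refine integrable_trace_of_norm_le (c := ‖R‖ * (1 / z)) (by fun_prop) fun x => ?_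
  refine (norm_mul_le _ _).trans ?_
  gcongr
  exact norm_resolventAt_le (gram_posSemidef x) hz

theorem integrable_trace_mul_resolventAt_sub_sq (hz : 0 < z)
    (P : Measure (Fin n → EuclideanSpace ℝ (Fin p))) [IsFiniteMeasure P]
    (R : Matrix (Fin p) (Fin p) ℝ) (c d : ℝ) :
    Integrable (fun x => (c * (R * resolventAt (gram x) z).trace - d) ^ 2) P := by
  have := continuous_resolventAt_gram (p := p) (n := n) hz
  refine Integrable.mono' (integrable_const ((|c| * (p * (‖R‖ * (1 / z))) + |d|) ^ 2))
    (by fun_prop : Continuous fun x : Fin n → EuclideanSpace ℝ (Fin p) =>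
      (c * (R * resolventAt (gram x) z).trace - d) ^ 2).aestronglyMeasurable
    (Filter.Eventually.of_forall fun x => ?_)
  rw [Real.norm_eq_abs, abs_pow]
  gcongr
  refine (abs_sub _ _).trans ?_
  rw [abs_mul]
  gcongr
  refine (abs_trace_le_card_mul_norm _).trans ?_
  gcongr
  refine (norm_mul_le _ _).trans ?_
  gcongr
  exact norm_resolventAt_le (gram_posSemidef x) hz

theorem integral_trace_mul_resolventAt_sub_sq_le (hz : 0 < z) (hn : 0 < n) (κ : Fin n → Fin k)
    {C : Matrix (Fin p) (Fin p) ℝ} (hC : C.PosSemidef) :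
    ∫ x, (1 / (n : ℝ) * (C * resolventAt (gram x) z).trace -
        ∫ x, 1 / (n : ℝ) * (C * resolventAt (gram x) z).trace ∂(Measure.pi fun i => μ (κ i))) ^ 2
      ∂(Measure.pi fun i => μ (κ i)) ≤ (‖C‖ * (1 / z)) ^ 2 / n := by
  have hn' : (0 : ℝ) < n := by exact_mod_cast hn
  have hc := continuous_resolventAt_gram (p := p) (n := n) hz
  have hc' : Continuous fun x : Fin n → EuclideanSpace ℝ (Fin p) =>
    1 / (n : ℝ) * (C * resolventAt (gram x) z).trace := by fun_prop
  refine (integral_sub_integral_sq_le_of_bounded_differences (fun i => μ (κ i))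
    (b := 1 / (n : ℝ) * (p * (‖C‖ * (1 / z)))) (c := 1 / (n : ℝ) * (‖C‖ * (1 / z)))
    hc'.measurable (fun x => ?_) fun x i y => ?_).trans_eq ?_
  · rw [abs_mul, abs_of_pos (by positivity)]
    gcongr
    refine (abs_trace_le_card_mul_norm _).trans ?_
    gcongr
    refine (norm_mul_le _ _).trans ?_
    gcongr
    exact norm_resolventAt_le (gram_posSemidef x) hz
  · rw [← mul_sub, abs_mul, abs_of_pos (by positivity)]
    gcongr
    exact abs_trace_mul_resolventAt_update_sub_le hz hC x i y
  · field_simp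

/-- The quadratic forms `xᵢᵀ Q₋ᵢ xᵢ / n` concentrate around a deterministic value. -/
theorem integral_leaveOneOutForm_sub_sq_le {q C₀ c₀ : ℝ} (hq : 0 < q) (hc₀ : 0 < c₀)
    (hC₀ : 0 ≤ C₀)
    (h : ∀ l, ConvexlyConcentrated (μ l) (fun y => y) fun t => C₀ * Real.exp (-(t ^ q / c₀)))
    {B a c Γ : ℝ} (hB : ∀ l, ∫ y, ‖y‖ ^ 4 ∂(μ l) ≤ B * p ^ 2) (hp : 0 < p) (hn : 0 < n)
    (hz : 0 < z) (ha : 1 / z ≤ a) (hΓ : (p : ℝ) ≤ Γ * n) (κ : Fin n → Fin k)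
    (hc : ∀ l, ‖populationCov (μ l)‖ ≤ c) (i : Fin n) :
    ∫ x, (leaveOneOutForm z x i - ∫ x, 1 / (n : ℝ) * (populationCov (μ (κ i)) *
        resolventAt (gram x) z).trace ∂(Measure.pi fun i => μ (κ i))) ^ 2
      ∂(Measure.pi fun i => μ (κ i)) ≤
    3 * (((momentBound q C₀ c₀ 4).toReal + 4 * B) * a ^ 2 * Γ + 2 * (c * a) ^ 2) / n := by
  set P := Measure.pi fun i => μ (κ i) with hP
  set V := populationCov (μ (κ i)) with hV
  have hn' : (0 : ℝ) < n := by exact_mod_cast hn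
  have hn1 : (1 : ℝ) ≤ n := by exact_mod_cast hn
  have ha0 : 0 < a := (by positivity : 0 < 1 / z).trans_le ha
  have h4 := fun l => (h l).memLp_four hq hc₀ hC₀
  have h2 := fun l => memLp_two_of_memLp_four (h4 l)
  have hS : V.PosSemidef := populationCov_posSemidef (h2 (κ i))
  have hcc : ‖V‖ ≤ c := hc (κ i)
  have hc0 : 0 ≤ c := (norm_nonneg _).trans hcc
  set d := ∫ x, 1 / (n : ℝ) * (V * resolventAt (gram x) z).trace ∂P with hd
  have hvar : ∫ x, (1 / (n : ℝ) * (V * resolventAt (gram x) z).trace - d) ^ 2 ∂P ≤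
      (c * a) ^ 2 / n := by
    refine (integral_trace_mul_resolventAt_sub_sq_le hz hn κ hS).trans ?_
    gcongr
  have hI3 := integrable_trace_mul_resolventAt_sub_sq hz P V (1 / (n : ℝ)) d
  set g : (Fin n → EuclideanSpace ℝ (Fin p)) → ℝ := fun x =>
    (leaveOneOutForm z x i - 1 / (n : ℝ) * (leaveOneOut z x i * V).trace) ^ 2 with hg
  have hgc : Continuous g := by
    have h1 := continuous_leaveOneOut (p := p) hz i
    have h2 := continuous_leaveOneOutForm (p := p) hz i
    fun_prop
  have hga : ∀ x, g x ≤ 2 * (leaveOneOutForm z x i - 0) ^ 2 +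
      2 * (1 / (n : ℝ) * (p * (a * c))) ^ 2 := fun x => by
    have h1 : |1 / (n : ℝ) * (leaveOneOut z x i * V).trace| ≤
        1 / (n : ℝ) * (p * (a * c)) := by
      rw [abs_mul, abs_of_pos (by positivity)]
      gcongr
      refine (abs_trace_le_card_mul_norm _).trans ?_
      gcongr
      refine (norm_mul_le _ _).trans ?_
      gcongr
      exact (norm_leaveOneOut_le hz x i).trans ha
    have h2 := sq_le_sq' (neg_le_of_abs_le h1) (le_of_abs_le h1)
    simp only [hg]
    nlinarith [sq_nonneg (leaveOneOutForm z x i + 1 / (n : ℝ) * (leaveOneOut z x i * V).trace)]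
  have hIg : Integrable g P := by
    refine (((integrable_leaveOneOutForm_sub_sq hz κ h4 i 0).const_mul 2).add
      (integrable_const (2 * (1 / (n : ℝ) * (p * (a * c))) ^ 2))).mono' hgc.aestronglyMeasurable
      (Filter.Eventually.of_forall fun x => ?_)
    rw [Real.norm_eq_abs, abs_of_nonneg (sq_nonneg _)]
    exact hga x
  have hgle : ∫ x, g x ∂P ≤
      ((momentBound q C₀ c₀ 4).toReal + 4 * B) * a ^ 2 * Γ / n := by
    rw [hP, integral_pi_eq_integral_update (fun i => μ (κ i)) i hIg]
    have hin : ∀ x, ∫ y, g (Function.update x i y) ∂(μ (κ i)) ≤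
        ((momentBound q C₀ c₀ 4).toReal + 4 * B) * a ^ 2 * Γ / n := fun x => by
      have hv := ((h (κ i)).integral_bilin_sub_sq_le hq hc₀ hC₀ (hB (κ i)) hp
        (leaveOneOut_posSemidef hz x i) ha0 ((norm_leaveOneOut_le hz x i).trans ha)).2
      have e : ∀ y, g (Function.update x i y) = (1 / (n : ℝ)) ^ 2 *
          (bilin (leaveOneOut z x i) y y - (leaveOneOut z x i * V).trace) ^ 2 := fun y => by
        simp only [hg, leaveOneOutForm, leaveOneOut_update, Function.update_self]
        ring
      simp only [e]
      rw [integral_const_mul]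
      have hB0 : 0 ≤ (momentBound q C₀ c₀ 4).toReal + 4 * B := by
        have hp' : (0 : ℝ) < p ^ 2 := by positivity
        have hnn : 0 ≤ B * p ^ 2 :=
          (integral_nonneg fun y => by positivity).trans (hB (κ i))
        have : 0 ≤ B := nonneg_of_mul_nonneg_left hnn hp'
        positivity
      calc _ ≤ (1 / (n : ℝ)) ^ 2 *
            (((momentBound q C₀ c₀ 4).toReal + 4 * B) * a ^ 2 * (Γ * n)) := by
            gcongr
            exact hv.trans (by gcongr)
        _ = _ := by field_simp
    have hI' := (integrable_update (fun i => μ (κ i)) i hIg).integral_prod_left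
    calc _ ≤ ∫ _x, ((momentBound q C₀ c₀ 4).toReal + 4 * B) * a ^ 2 * Γ / n
          ∂(Measure.pi fun i => μ (κ i)) := integral_mono hI' (integrable_const _) hin
      _ = _ := by simp
  have hD : ∀ x, (1 / (n : ℝ) * (leaveOneOut z x i * V).trace -
      1 / (n : ℝ) * (V * resolventAt (gram x) z).trace) ^ 2 ≤ (c * a) ^ 2 / n := fun x => by
    have h1 : |(V * (leaveOneOut z x i - resolventAt (gram x) z)).trace| ≤ c * a := by
      refine (abs_trace_mul_le _ (leaveOneOut_sub_posSemidef hz x i)).trans ?_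
      have := (leaveOneOut_sub_posSemidef hz x i).trace_nonneg
      gcongr
      exact (trace_leaveOneOut_sub_le hz x i).trans ha
    rw [trace_mul_comm, ← mul_sub, ← trace_sub, ← Matrix.mul_sub, mul_pow]
    have h2 := sq_le_sq' (neg_le_of_abs_le h1) (le_of_abs_le h1)
    calc _ ≤ (1 / (n : ℝ)) ^ 2 * (c * a) ^ 2 := by gcongr
      _ = (c * a) ^ 2 / n * (1 / n) := by field_simp
      _ ≤ (c * a) ^ 2 / n * 1 := by
          gcongr
          rw [div_le_one hn']
          exact hn1
      _ = _ := mul_one _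
  -- Three fluctuations, whence the factor `3`: the quadratic form given `Q₋ᵢ`, the passage from
  -- `Q₋ᵢ` to `Q`, and the trace of `ΣQ/n` around its mean.
  have hle : ∫ x, (leaveOneOutForm z x i - d) ^ 2 ∂P ≤
      ∫ x, (3 * g x + 3 * ((c * a) ^ 2 / n) +
        3 * (1 / (n : ℝ) * (V * resolventAt (gram x) z).trace - d) ^ 2) ∂P := by
    refine integral_mono (integrable_leaveOneOutForm_sub_sq hz κ h4 i d)
      (((hIg.const_mul 3).add (integrable_const _)).add (hI3.const_mul 3)) fun x => ?_
    have h1 := hD x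
    simp only [hg]
    set u := leaveOneOutForm z x i
    set v := 1 / (n : ℝ) * (leaveOneOut z x i * V).trace
    set w := 1 / (n : ℝ) * (V * resolventAt (gram x) z).trace
    nlinarith [sq_nonneg ((u - v) - (v - w)), sq_nonneg ((u - v) - (w - d)),
      sq_nonneg ((v - w) - (w - d))]
  refine hle.trans ?_
  have ha1 := integral_add ((hIg.const_mul 3).add (integrable_const (3 * ((c * a) ^ 2 / (n : ℝ)))))
    (hI3.const_mul 3)
  have ha2 := integral_add (hIg.const_mul 3) (integrable_const (μ := P)
    (3 * ((c * a) ^ 2 / (n : ℝ))))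
  simp only [Pi.add_apply] at ha1 ha2
  rw [ha1, ha2, integral_const, probReal_univ, one_smul, integral_const_mul, integral_const_mul]
  calc _ ≤ 3 * (((momentBound q C₀ c₀ 4).toReal + 4 * B) * a ^ 2 * Γ / n) +
        3 * ((c * a) ^ 2 / n) + 3 * ((c * a) ^ 2 / n) := by gcongr
    _ = _ := by ring

end Variance

/-! ### Deterministic equivalents in low dimension and for bounded covariances -/

section Equivalents

open Matrix
open scoped Matrix.Norms.L2Operator

variable {p n k : ℕ} {μ : Fin k → Measure (EuclideanSpace ℝ (Fin p))}
  [∀ l, IsProbabilityMeasure (μ l)] {z a : ℝ}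

theorem sum_proportion (hn : 0 < n) (κ : Fin n → Fin k) : ∑ l, proportion κ l = 1 := by
  have h := sum_proportion_smul κ fun _ => (1 : ℝ)
  have hn' : (n : ℝ) ≠ 0 := by exact_mod_cast hn.ne'
  simpa [hn'] using h

theorem norm_one_le : ‖(1 : Matrix (Fin p) (Fin p) ℝ)‖ ≤ 1 :=
  l2_opNorm_le_of_forall zero_le_one fun v => by simp

theorem integral_trace_mul_resolventAt_sub (hz : 0 < z)
    (P : Measure (Fin n → EuclideanSpace ℝ (Fin p))) [IsProbabilityMeasure P]
    (R B : Matrix (Fin p) (Fin p) ℝ) :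
    ∫ x, (R * (resolventAt (gram x) z - B)).trace ∂P =
      ∫ x, (R * resolventAt (gram x) z).trace ∂P - (R * B).trace := by
  simp only [Matrix.mul_sub, trace_sub]
  rw [integral_sub (integrable_trace_mul_resolventAt hz P R) (integrable_const _), integral_const,
    probReal_univ, one_smul]

/-- The mean resolvent and the fixed point in dimension at most `√n`. -/
theorem abs_integral_trace_sub_le_of_le_sqrt (hz : 0 < z) (ha : 1 / z ≤ a) (hp : 0 < p)
    (hn : 0 < n) (hpn : (p : ℝ) ≤ √n) (κ : Fin n → Fin k) (h4 : ∀ l, MemLp (fun y => y) 4 (μ l))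
    {B₂ B₄ : ℝ} (hB₂ : ∀ l, ∫ y, ‖y‖ ^ 2 ∂(μ l) ≤ B₂ * p)
    (hB₄ : ∀ l, ∫ y, ‖y‖ ^ 4 ∂(μ l) ≤ B₄ * p ^ 2) {δ : Fin k → ℝ}
    (hδ : SolvesFixedPoint n (proportion κ) (fun l => populationCov (μ l)) z δ) :
    |∫ x, (resolventAt (gram x) z).trace ∂(Measure.pi fun i => μ (κ i)) -
        (QTilde (proportion κ) (fun l => populationCov (μ l)) z δ).trace| ≤
      (B₂ ^ 2 * a ^ 3 + a ^ 2 * (B₄ + (B₄ + B₂ ^ 2) * a ^ 2)) * (p / √n) := by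
  set P := Measure.pi fun i => μ (κ i) with hP
  have h2 := fun l => memLp_two_of_memLp_four (h4 l)
  have hS := fun l => populationCov_posSemidef (h2 l)
  have hp' : (0 : ℝ) < p := by exact_mod_cast hp
  have hn' : (0 : ℝ) < n := by exact_mod_cast hn
  have hs : 0 < √(n : ℝ) := Real.sqrt_pos.mpr hn'
  have hsq : √(n : ℝ) * √n = n := Real.mul_self_sqrt hn'.le
  have hz1 : 0 < 1 / z := by positivity
  have ha0 : 0 < a := hz1.trans_le ha
  have hB2n : ∀ l, 0 ≤ B₂ := fun l => nonneg_of_mul_nonneg_left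
    ((integral_nonneg fun y => by positivity).trans (hB₂ l)) hp'
  have hB4n : ∀ l, 0 ≤ B₄ := fun l => nonneg_of_mul_nonneg_left
    ((integral_nonneg fun y => by positivity).trans (hB₄ l)) (by positivity : (0 : ℝ) < p ^ 2)
  have htr : ∀ l, (populationCov (μ l)).trace ≤ B₂ * p := fun l => by
    rw [trace_populationCov (h2 l)]; exact hB₂ l
  have hδ2 : ∀ l, δ l ≤ 1 / (n : ℝ) * (B₂ * p * a) := fun l => by
    rw [hδ.2 l]
    refine (fpMap_le (proportion_nonneg κ) hS hδ.1 hz l).trans ?_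
    rw [div_eq_mul_one_div (trace _)]
    have := hB2n l
    gcongr
    exact htr l
  have hpn2 : (p : ℝ) ^ 2 ≤ n := by rw [← hsq, ← sq]; gcongr
  -- No cancellation is needed: both quantities are `O(p/n)` in `L²`, and `p² ≤ n` makes their
  -- squares `O(1/n)`.
  have hV : ∀ i, ∫ x, (leaveOneOutForm z x i - δ (κ i)) ^ 2 ∂P ≤ (B₄ + B₂ ^ 2) * a ^ 2 / n := by
    intro i
    have h4i := integrable_norm_pow_four_of_memLp (h4 (κ i))
    have hI := integrable_eval (fun i => μ (κ i)) i h4i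
    have hle : ∫ x, (leaveOneOutForm z x i - δ (κ i)) ^ 2 ∂P ≤
        ∫ x, ((1 / (n : ℝ) * a) ^ 2 * ‖x i‖ ^ 4 + (1 / (n : ℝ) * (B₂ * p * a)) ^ 2) ∂P := by
      refine integral_mono (integrable_leaveOneOutForm_sub_sq hz κ h4 i _)
        ((hI.const_mul _).add (integrable_const _)) fun x => ?_
      have h1 := leaveOneOutForm_nonneg hz x i
      have h3 : leaveOneOutForm z x i ≤ 1 / (n : ℝ) * a * ‖x i‖ ^ 2 := by
        refine (leaveOneOutForm_le hz x i).trans ?_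
        calc _ = 1 / (n : ℝ) * (1 / z) * ‖x i‖ ^ 2 := by ring
          _ ≤ _ := by gcongr
      have h5 : leaveOneOutForm z x i ^ 2 ≤ (1 / (n : ℝ) * a * ‖x i‖ ^ 2) ^ 2 := by gcongr
      have h6 : δ (κ i) ^ 2 ≤ (1 / (n : ℝ) * (B₂ * p * a)) ^ 2 := by
        have := hδ.1 (κ i)
        have := hδ2 (κ i)
        gcongr
      have h7 : (1 / (n : ℝ) * a * ‖x i‖ ^ 2) ^ 2 = (1 / (n : ℝ) * a) ^ 2 * ‖x i‖ ^ 4 := by ring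
      simp only
      nlinarith [mul_nonneg h1 (hδ.1 (κ i))]
    refine hle.trans ?_
    rw [integral_add (hI.const_mul _) (integrable_const _), integral_const_mul, integral_const,
      probReal_univ, one_smul, integral_eval (fun i => μ (κ i)) i h4i]
    have := hB4n (κ i)
    calc _ ≤ (1 / (n : ℝ) * a) ^ 2 * (B₄ * p ^ 2) + (1 / (n : ℝ) * (B₂ * p * a)) ^ 2 := by
          gcongr
          exact hB₄ (κ i)
      _ = (B₄ + B₂ ^ 2) * a ^ 2 / n * (p ^ 2 / n) := by field_simp
      _ ≤ (B₄ + B₂ ^ 2) * a ^ 2 / n * 1 := by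
          gcongr
          rwa [div_le_one hn']
      _ = _ := mul_one _
  -- Here the covariance may have norm of order `p`. The trace of `Q₋ᵢ - Q` has mean `O(p/n)`, and
  -- the product `p²/n` is at most `p/√n`.
  have hT : ∀ i, ∫ x, |(1 * QTilde (proportion κ) (fun l => populationCov (μ l)) z δ *
      populationCov (μ (κ i)) * (leaveOneOut z x i - resolventAt (gram x) z)).trace| ∂P ≤
      B₂ ^ 2 * a ^ 3 * (p / √n) := by
    intro i
    have h2i := integrable_norm_sq_of_memLp (h2 (κ i))
    have hI := integrable_eval (fun i => μ (κ i)) i h2i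
    have hB2 := hB2n (κ i)
    have hN : ‖1 * QTilde (proportion κ) (fun l => populationCov (μ l)) z δ *
        populationCov (μ (κ i))‖ ≤ a * (B₂ * p) := by
      rw [Matrix.one_mul]
      refine (norm_mul_le _ _).trans ?_
      gcongr
      · exact (norm_QTilde_le (proportion_nonneg κ) hS hδ.1 hz).trans ha
      · exact (norm_le_trace (hS (κ i))).trans (htr (κ i))
    have hc1 := continuous_resolventAt_gram (p := p) (n := n) hz
    have hc2 := continuous_leaveOneOut (p := p) hz i
    have hpt : ∀ x : Fin n → EuclideanSpace ℝ (Fin p),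
        |(1 * QTilde (proportion κ) (fun l => populationCov (μ l)) z δ *
        populationCov (μ (κ i)) * (leaveOneOut z x i - resolventAt (gram x) z)).trace| ≤
        a * (B₂ * p) * (1 / (n : ℝ) * a ^ 2) * ‖x i‖ ^ 2 := fun x => by
      have hD := leaveOneOut_sub_posSemidef hz x i
      refine (abs_trace_mul_le _ hD).trans ?_
      have h0 := hD.trace_nonneg
      rw [mul_assoc (a * (B₂ * p))]
      gcongr
      refine (trace_leaveOneOut_sub_le' hz x i).trans ?_
      calc _ = 1 / (n : ℝ) * (1 / z) ^ 2 * ‖x i‖ ^ 2 := by field_simp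
        _ ≤ _ := by gcongr
    have hle : ∫ x, |(1 * QTilde (proportion κ) (fun l => populationCov (μ l)) z δ *
        populationCov (μ (κ i)) * (leaveOneOut z x i - resolventAt (gram x) z)).trace| ∂P ≤
        ∫ x, a * (B₂ * p) * (1 / (n : ℝ) * a ^ 2) * ‖x i‖ ^ 2 ∂P :=
      integral_mono_of_nonneg (Filter.Eventually.of_forall fun x => abs_nonneg _)
        (hI.const_mul _) (Filter.Eventually.of_forall hpt)
    refine hle.trans ?_
    rw [integral_const_mul, integral_eval (fun i => μ (κ i)) i h2i]
    calc _ ≤ a * (B₂ * p) * (1 / (n : ℝ) * a ^ 2) * (B₂ * p) := by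
          gcongr
          exact hB₂ (κ i)
      _ = B₂ ^ 2 * a ^ 3 * (p / √n) * (p / √n) := by
          rw [show B₂ ^ 2 * a ^ 3 * (p / √n) * (p / √n) = B₂ ^ 2 * a ^ 3 * (p * p) * (1 / (√n * √n))
            by ring, hsq]
          ring
      _ ≤ B₂ ^ 2 * a ^ 3 * (p / √n) * 1 := by
          gcongr
          rwa [div_le_one hs]
      _ = _ := mul_one _
  have hmain := abs_integral_trace_mul_sub_QTilde_le hz hn κ h4 hδ.1 (R := 1) norm_one_le hT
    fun i => integral_norm_sq_mul_leaveOneOutForm_sub_le hz hp hn κ h4 i (δ (κ i)) (hB₄ (κ i))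
      (hV i)
  rw [integral_trace_mul_resolventAt_sub hz] at hmain
  simp only [Matrix.one_mul] at hmain
  refine hmain.trans ?_
  have hB : 0 ≤ B₄ + (B₄ + B₂ ^ 2) * a ^ 2 := by
    have := hB4n (κ ⟨0, hn⟩)
    positivity
  have e : 1 / z ^ 2 ≤ a ^ 2 := by
    calc 1 / z ^ 2 = (1 / z) ^ 2 := by ring
      _ ≤ _ := by gcongr
  calc _ ≤ B₂ ^ 2 * a ^ 3 * (p / √n) +
        a ^ 2 * ((B₄ + (B₄ + B₂ ^ 2) * a ^ 2) * (p / √n)) := by gcongr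
    _ = _ := by ring

/-- Mean field equation for the traces of the resolvent, with a test matrix `R`. -/
theorem abs_integral_trace_mul_sub_meanField_le {q C₀ c₀ : ℝ} (hq : 0 < q) (hc₀ : 0 < c₀)
    (hC₀ : 0 ≤ C₀)
    (h : ∀ l, ConvexlyConcentrated (μ l) (fun y => y) fun t => C₀ * Real.exp (-(t ^ q / c₀)))
    {B c Γ V r : ℝ} (hB : ∀ l, ∫ y, ‖y‖ ^ 4 ∂(μ l) ≤ B * p ^ 2) (hp : 0 < p) (hn : 0 < n)
    (hz : 0 < z) (ha : 1 / z ≤ a) (hΓ : (p : ℝ) ≤ Γ * n) (κ : Fin n → Fin k)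
    (hc : ∀ l, ‖populationCov (μ l)‖ ≤ c)
    (hV : 3 * (((momentBound q C₀ c₀ 4).toReal + 4 * B) * a ^ 2 * Γ + 2 * (c * a) ^ 2) ≤ V)
    {δ : Fin k → ℝ} (hδ : ∀ l, δ l = ∫ x, 1 / (n : ℝ) * (populationCov (μ l) *
        resolventAt (gram x) z).trace ∂(Measure.pi fun i => μ (κ i)))
    (hδ0 : ∀ l, 0 ≤ δ l) {R : Matrix (Fin p) (Fin p) ℝ} (hR : ‖R‖ ≤ r) :
    |∫ x, (R * resolventAt (gram x) z).trace ∂(Measure.pi fun i => μ (κ i)) -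
        (R * QTilde (proportion κ) (fun l => populationCov (μ l)) z δ).trace| ≤
      r * a ^ 2 * (c + (B + V) * (p / √n)) := by
  set P := Measure.pi fun i => μ (κ i) with hP
  have h4 := fun l => (h l).memLp_four hq hc₀ hC₀
  have h2 := fun l => memLp_two_of_memLp_four (h4 l)
  have hS := fun l => populationCov_posSemidef (h2 l)
  have hz1 : 0 < 1 / z := by positivity
  have ha0 : 0 < a := hz1.trans_le ha
  have hr : 0 ≤ r := (norm_nonneg R).trans hR
  have hc0 : ∀ l, 0 ≤ c := fun l => (norm_nonneg _).trans (hc l)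
  have hT : ∀ i, ∫ x, |(R * QTilde (proportion κ) (fun l => populationCov (μ l)) z δ *
      populationCov (μ (κ i)) * (leaveOneOut z x i - resolventAt (gram x) z)).trace| ∂P ≤
      r * a * c * a := by
    intro i
    have hpt : ∀ x : Fin n → EuclideanSpace ℝ (Fin p),
        |(R * QTilde (proportion κ) (fun l => populationCov (μ l)) z δ *
        populationCov (μ (κ i)) * (leaveOneOut z x i - resolventAt (gram x) z)).trace| ≤
        r * a * c * a := fun x => by
      have hD := leaveOneOut_sub_posSemidef hz x i
      have h0 := hD.trace_nonneg
      have hc0 := hc0 (κ i)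
      refine (abs_trace_mul_le _ hD).trans ?_
      gcongr
      · refine (norm_mul_le _ _).trans ?_
        gcongr
        · refine (norm_mul_le _ _).trans ?_
          gcongr
          exact (norm_QTilde_le (proportion_nonneg κ) hS hδ0 hz).trans ha
        · exact hc (κ i)
      · exact (trace_leaveOneOut_sub_le hz x i).trans ha
    calc _ ≤ ∫ _x, r * a * c * a ∂P :=
          integral_mono_of_nonneg (Filter.Eventually.of_forall fun x => abs_nonneg _)
            (integrable_const _) (Filter.Eventually.of_forall hpt)
      _ = _ := by simp
  have hn' : (0 : ℝ) < n := by exact_mod_cast hn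
  have hVi : ∀ i, ∫ x, (leaveOneOutForm z x i - δ (κ i)) ^ 2 ∂P ≤ V / n := fun i => by
    rw [hδ]
    refine (integral_leaveOneOutForm_sub_sq_le hq hc₀ hC₀ h hB hp hn hz ha hΓ κ hc i).trans ?_
    gcongr
  have hmain := abs_integral_trace_mul_sub_QTilde_le hz hn κ h4 hδ0 hR hT
    fun i => integral_norm_sq_mul_leaveOneOutForm_sub_le hz hp hn κ h4 i (δ (κ i)) (hB (κ i))
      (hVi i)
  rw [integral_trace_mul_resolventAt_sub hz] at hmain
  refine hmain.trans ?_
  have hD0 : 0 ≤ (B + V) * (p / √n) :=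
    (integral_nonneg fun x => by positivity).trans (integral_norm_sq_mul_leaveOneOutForm_sub_le hz
      hp hn κ h4 ⟨0, hn⟩ (δ (κ ⟨0, hn⟩)) (hB (κ ⟨0, hn⟩)) (hVi ⟨0, hn⟩))
  have e : r / z ^ 2 ≤ r * a ^ 2 := by
    calc r / z ^ 2 = r * (1 / z) ^ 2 := by ring
      _ ≤ _ := by gcongr
  calc _ ≤ r * a * c * a + r * a ^ 2 * ((B + V) * (p / √n)) := by gcongr
    _ = _ := by ring

/-- The mean resolvent of samples with bounded covariances is close to `Q̃_ε`, for every
approximate solution `ε` of the fixed point system. -/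
theorem abs_integral_trace_sub_QTilde_le_of_approx {q C₀ c₀ : ℝ} (hq : 0 < q) (hc₀ : 0 < c₀)
    (hC₀ : 0 ≤ C₀)
    (h : ∀ l, ConvexlyConcentrated (μ l) (fun y => y) fun t => C₀ * Real.exp (-(t ^ q / c₀)))
    {B c Γ V E : ℝ} (hB : ∀ l, ∫ y, ‖y‖ ^ 4 ∂(μ l) ≤ B * p ^ 2) (hp : 0 < p) (hn : 0 < n)
    (hz : 0 < z) (ha : 1 / z ≤ a) (hΓ : (p : ℝ) ≤ Γ * n) (κ : Fin n → Fin k)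
    (hc : ∀ l, ‖populationCov (μ l)‖ ≤ c)
    (hV : 3 * (((momentBound q C₀ c₀ 4).toReal + 4 * B) * a ^ 2 * Γ + 2 * (c * a) ^ 2) ≤ V)
    (hnB : 2 * (c * a ^ 2 * (c + (B + V) * Γ)) ≤ √n)
    {ε : Fin k → ℝ} (hε0 : ∀ l, 0 ≤ ε l)
    (hε1 : ∀ l, fpMap n (proportion κ) (fun l => populationCov (μ l)) z ε l ≤ ε l + 1 / 2)
    (hE : ∑ l, proportion κ l *
      |ε l - fpMap n (proportion κ) (fun l => populationCov (μ l)) z ε l| ≤ E / √n) :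
    |∫ x, (resolventAt (gram x) z).trace ∂(Measure.pi fun i => μ (κ i)) -
        (QTilde (proportion κ) (fun l => populationCov (μ l)) z ε).trace| ≤
      a ^ 2 * (c + (B + V) * (p / √n)) +
        c * a ^ 2 * (2 * (c * Γ * a) + 1) * (c * a ^ 2 * (c + (B + V) * Γ) + E) * (p / √n) := by
  set P := Measure.pi fun i => μ (κ i) with hP
  set S := fun l => populationCov (μ l) with hSdef
  set w := proportion κ with hw
  have h4 := fun l => (h l).memLp_four hq hc₀ hC₀
  have h2 := fun l => memLp_two_of_memLp_four (h4 l)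
  have hS : ∀ l, (S l).PosSemidef := fun l => populationCov_posSemidef (h2 l)
  have hw0 : ∀ l, 0 ≤ w l := proportion_nonneg κ
  have hw1 : ∑ l, w l = 1 := sum_proportion hn κ
  have hp' : (0 : ℝ) < p := by exact_mod_cast hp
  have hn' : (0 : ℝ) < n := by exact_mod_cast hn
  have hn1 : (1 : ℝ) ≤ n := by exact_mod_cast hn
  have hs : 0 < √(n : ℝ) := Real.sqrt_pos.mpr hn'
  have hs1 : 1 ≤ √(n : ℝ) := Real.one_le_sqrt.mpr hn1
  have hsq : √(n : ℝ) * √n = n := Real.mul_self_sqrt hn'.le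
  have hz1 : 0 < 1 / z := by positivity
  have ha0 : 0 < a := hz1.trans_le ha
  have hc0 : 0 ≤ c := (norm_nonneg _).trans (hc (κ ⟨0, hn⟩))
  have hΓ0 : 0 < Γ := by
    by_contra hcon
    push Not at hcon
    nlinarith
  have hB0 : 0 ≤ B := nonneg_of_mul_nonneg_left
    ((integral_nonneg fun y => by positivity).trans (hB (κ ⟨0, hn⟩)))
    (by positivity : (0 : ℝ) < p ^ 2)
  have hV0 : 0 ≤ V := le_trans (by positivity) hV
  -- An intermediate parameter, the mean of `tr(Σ_l Q)/n`. The leave-one-out forms concentrate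
  -- around it; it is then compared with `ε`.
  set δ : Fin k → ℝ := fun l => ∫ x, 1 / (n : ℝ) * (S l * resolventAt (gram x) z).trace ∂P
    with hδ
  have hδ0 : ∀ l, 0 ≤ δ l := fun l => integral_nonneg fun x =>
    mul_nonneg (by positivity) (trace_mul_resolventAt_nonneg (gram_posSemidef x) hz (hS l))
  have hMF := fun (R : Matrix (Fin p) (Fin p) ℝ) r (hR : ‖R‖ ≤ r) =>
    abs_integral_trace_mul_sub_meanField_le hq hc₀ hC₀ h hB hp hn hz ha hΓ κ hc hV
      (δ := δ) (fun l => rfl) hδ0 hR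
  set e₀ := c * a ^ 2 * (c + (B + V) * Γ) with he₀
  -- The mean field equation tested against `R = Σ_l` says that `δ` almost solves the system.
  -- Dividing by `n` and using `p ≤ Γn` gives an error `O(1/√n)`.
  have he : ∀ l, |δ l - fpMap n w S z δ l| ≤ e₀ / √n := fun l => by
    have h1 := hMF (S l) c (hc l)
    have h3 : δ l - fpMap n w S z δ l = 1 / (n : ℝ) *
        (∫ x, (S l * resolventAt (gram x) z).trace ∂P - (S l * QTilde w S z δ).trace) := by
      rw [hδ, fpMap, mul_sub]
      simp only
      rw [integral_const_mul]
    rw [h3, abs_mul, abs_of_pos (by positivity)]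
    calc _ ≤ 1 / (n : ℝ) * (c * a ^ 2 * (c + (B + V) * (p / √n))) := by gcongr
      _ = c * a ^ 2 * (c * (1 / √n) + (B + V) * (p / n)) / √n := by
          rw [show c * a ^ 2 * (c * (1 / √n) + (B + V) * (p / n)) / √n = c * a ^ 2 *
            (c * (1 / (√n * √n)) + (B + V) * (p / n) / √n) by ring, hsq]
          ring
      _ ≤ c * a ^ 2 * (c * 1 + (B + V) * Γ) / √n := by
          gcongr
          · rw [div_le_one hs]; exact hs1
          · rwa [div_le_iff₀ hn']
      _ = _ := by rw [he₀, mul_one]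
  have hfp : ∀ (η : Fin k → ℝ), (∀ l, 0 ≤ η l) → ∀ l, fpMap n w S z η l ≤ c * Γ * a := by
    intro η hη l
    refine (fpMap_le hw0 hS hη hz l).trans ?_
    have h1 : (S l).trace ≤ Γ * n * c := (trace_le_card_mul_norm _).trans (by
      gcongr
      exact hc l)
    calc _ = 1 / (n : ℝ) * ((S l).trace * (1 / z)) := by rw [div_eq_mul_one_div (S l).trace]
      _ ≤ 1 / (n : ℝ) * (Γ * n * c * a) := by gcongr
      _ = _ := by field_simp
  -- For `n` large the residual is at most `1/2`, the margin needed by the stability estimate.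
  have hδ1 : ∀ l, fpMap n w S z δ l ≤ δ l + 1 / 2 := fun l => by
    have h1 := neg_le_of_abs_le (he l)
    have h3 : e₀ / √n ≤ 1 / 2 := by
      rw [div_le_iff₀ hs]; linarith
    linarith
  have hstab := sum_fpWeight_mul_abs_sub_le (n := n) hw0 hS hδ0 hε0 hz
    (by positivity : 0 ≤ c * Γ * a) (hfp δ hδ0) (hfp ε hε0) hδ1 hε1
  have hsum : ∑ l, w l * fpWeight δ ε l * |δ l - ε l| ≤
      (2 * (c * Γ * a) + 1) * ((e₀ + E) / √n) := by
    refine hstab.trans ?_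
    gcongr
    calc _ ≤ ∑ l, w l * (e₀ / √n + |ε l - fpMap n w S z ε l|) := by
          refine Finset.sum_le_sum fun l _ => ?_
          have h1 := fpWeight_le_one hδ0 hε0 l
          have h0 := hw0 l
          have h3 := (fpWeight_pos hδ0 hε0 l).le
          have h4 := he l
          calc w l * fpWeight δ ε l * (|δ l - fpMap n w S z δ l| + |ε l - fpMap n w S z ε l|) ≤
              w l * 1 * (e₀ / √n + |ε l - fpMap n w S z ε l|) := by gcongr
            _ = _ := by rw [mul_one]
      _ = e₀ / √n + ∑ l, w l * |ε l - fpMap n w S z ε l| := by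
          simp only [mul_add]
          rw [Finset.sum_add_distrib, ← Finset.sum_mul, hw1, one_mul]
      _ ≤ e₀ / √n + E / √n := by gcongr
      _ = _ := by ring
  have hQQ : |(QTilde w S z δ).trace - (QTilde w S z ε).trace| ≤
      p * (a * c * a) * ∑ l, w l * fpWeight δ ε l * |δ l - ε l| := by
    rw [← trace_sub, QTilde_sub hw0 hS hδ0 hε0 hz, trace_sum, Finset.mul_sum]
    refine (Finset.abs_sum_le_sum_abs _ _).trans (Finset.sum_le_sum fun l _ => ?_)
    have h1 := fpWeight_le_one hδ0 hε0 l
    have h0 := hw0 l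
    have h3 := (fpWeight_pos hδ0 hε0 l).le
    rw [trace_smul, smul_eq_mul, abs_mul, abs_mul, abs_of_nonneg (by positivity :
      0 ≤ w l * fpWeight δ ε l ^ 2), mul_comm]
    have h5 : |(QTilde w S z δ * S l * QTilde w S z ε).trace| ≤ p * (a * c * a) := by
      refine (abs_trace_le_card_mul_norm _).trans ?_
      gcongr
      refine (norm_mul_le _ _).trans ?_
      gcongr
      · refine (norm_mul_le _ _).trans ?_
        gcongr
        · exact (norm_QTilde_le hw0 hS hδ0 hz).trans ha
        · exact hc l
      · exact (norm_QTilde_le hw0 hS hε0 hz).trans ha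
    have h6 : fpWeight δ ε l ^ 2 ≤ fpWeight δ ε l := by nlinarith
    gcongr
  have h1 := hMF 1 1 norm_one_le
  simp only [Matrix.one_mul] at h1
  refine (abs_sub_le _ (QTilde w S z δ).trace _).trans (add_le_add (h1.trans_eq (by ring)) ?_)
  calc _ ≤ p * (a * c * a) * ((2 * (c * Γ * a) + 1) * ((e₀ + E) / √n)) := by
        refine hQQ.trans ?_
        gcongr
    _ = _ := by ring

end Equivalents

/-! ### Reduction to centred classes and the mean estimate -/

section Centring

open Matrix
open scoped Matrix.Norms.L2Operator

variable {p n k : ℕ} {z : ℝ}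

/-- With `b = ∑ (x_i - m)`, centring produces the cross terms `bmᵀ + mbᵀ`. They are polarised as
half of `(m+b)(m+b)ᵀ - (m-b)(m-b)ᵀ`, and the negative square is moved to the other side, so only
positive rank one updates appear. -/
theorem sum_outer_add_eq {ι : Type*} (s : Finset ι) (x : ι → EuclideanSpace ℝ (Fin p))
    (m : EuclideanSpace ℝ (Fin p)) :
    ∑ i ∈ s, outer (x i) + (1 / 2 : ℝ) • outer (m - ∑ i ∈ s, (x i - m)) =
      ∑ i ∈ s, outer (x i - m) + (1 / 2 : ℝ) • outer (m + ∑ i ∈ s, (x i - m)) +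
        (s.card : ℝ) • outer m := by
  ext a b
  have h : ∑ i ∈ s, x i a * x i b = ∑ i ∈ s, (x i a - m a) * (x i b - m b) +
      (∑ i ∈ s, (x i a - m a)) * m b + m a * (∑ i ∈ s, (x i b - m b)) +
        s.card * (m a * m b) := by
    rw [Finset.sum_mul, Finset.mul_sum, ← nsmul_eq_mul, ← Finset.sum_const,
      ← Finset.sum_add_distrib, ← Finset.sum_add_distrib, ← Finset.sum_add_distrib]
    exact Finset.sum_congr rfl fun i _ => by ring
  have hs : ∀ c, (∑ i ∈ s, (x i - m)) c = ∑ i ∈ s, (x i c - m c) := fun c => by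
    rw [WithLp.ofLp_sum, Finset.sum_apply]
    rfl
  simp only [outer, Matrix.add_apply, Matrix.smul_apply, Matrix.sum_apply, vecMulVec_apply,
    smul_eq_mul, PiLp.sub_apply, PiLp.add_apply, hs, h]
  ring

/-- Centring the samples class by class is a perturbation of rank at most `3k`. -/
theorem abs_trace_resolventAt_gram_sub_centred_le (hz : 0 < z) (κ : Fin n → Fin k)
    (m : Fin k → EuclideanSpace ℝ (Fin p)) (x : Fin n → EuclideanSpace ℝ (Fin p)) :
    |(resolventAt (gram x) z).trace - (resolventAt (gram fun i => x i - m (κ i)) z).trace| ≤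
      2 * (k / z) := by
  set b : Fin k → EuclideanSpace ℝ (Fin p) := fun l => ∑ i with κ i = l, (x i - m l) with hb
  set t₁ : Fin k → ℝ := fun _ => 1 / (n : ℝ) * (1 / 2) with ht₁
  set t₂ : Fin k → ℝ := fun l => 1 / (n : ℝ) * ((Finset.univ.filter fun i => κ i = l).card : ℝ)
    with ht₂
  have h1 := resolventAt_sub_add_sum_outer Finset.univ (gram_posSemidef x) hz t₁
    (fun _ => by positivity) fun l => m l - b l
  have h2 := resolventAt_sub_add_sum_outer Finset.univ
    (gram_posSemidef fun i => x i - m (κ i)) hz t₁ (fun _ => by positivity) fun l => m l + b l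
  have h3 := resolventAt_sub_add_sum_outer Finset.univ h2.1 hz t₂ (fun _ => by positivity) m
  have hx : ∀ f : Fin n → Matrix (Fin p) (Fin p) ℝ, ∑ l, ∑ i with κ i = l, f i = ∑ i, f i :=
    fun f => Finset.sum_fiberwise _ _ _
  have key : gram x + ∑ l, t₁ l • outer (m l - b l) = gram (fun i => x i - m (κ i)) +
      ∑ l, t₁ l • outer (m l + b l) + ∑ l, t₂ l • outer (m l) := by
    have e : ∀ l, ∑ i with κ i = l, outer (x i - m (κ i)) =
        ∑ i with κ i = l, outer (x i - m l) := fun l =>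
      Finset.sum_congr rfl fun i hi => by rw [(Finset.mem_filter.mp hi).2]
    rw [gram, gram, ← hx, ← hx, Finset.smul_sum, Finset.smul_sum, ← Finset.sum_add_distrib,
      ← Finset.sum_add_distrib, ← Finset.sum_add_distrib]
    refine Finset.sum_congr rfl fun l _ => ?_
    rw [e, ht₁, ht₂]
    simp only
    rw [mul_smul, mul_smul, mul_smul, ← smul_add, ← smul_add, ← smul_add, sum_outer_add_eq]
  -- Each family of `k` updates lowers the trace by an amount between `0` and `k/z`. There is one
  -- family on the original side and two on the centred side, hence the bound `2k/z`.
  have a1 := h1.2.1.trace_nonneg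
  have a2 := h1.2.2
  have a3 := h2.2.1.trace_nonneg
  have a4 := h2.2.2
  have a5 := h3.2.1.trace_nonneg
  have a6 := h3.2.2
  rw [← key] at a5 a6
  simp only [trace_sub, Finset.card_univ, Fintype.card_fin] at a1 a2 a3 a4 a5 a6
  have : 0 ≤ (k : ℝ) / z := by positivity
  rw [abs_le]
  constructor <;> linarith

theorem measurePreserving_sub_pi {μ : Fin k → Measure (EuclideanSpace ℝ (Fin p))}
    [∀ l, IsProbabilityMeasure (μ l)] (κ : Fin n → Fin k) (m : Fin k → EuclideanSpace ℝ (Fin p)) :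
    MeasurePreserving (fun (x : Fin n → EuclideanSpace ℝ (Fin p)) i => x i - m (κ i))
      (Measure.pi fun i => μ (κ i))
      (Measure.pi fun i => (μ (κ i)).map fun y => y - m (κ i)) := by
  have hm : ∀ l, IsProbabilityMeasure ((μ l).map fun y => y - m l) := fun l =>
    Measure.isProbabilityMeasure_map (by fun_prop)
  exact measurePreserving_pi (fun i => μ (κ i)) (fun i => (μ (κ i)).map fun y => y - m (κ i))
    (f := fun i y => y - m (κ i)) fun i => ⟨by fun_prop, rfl⟩

variable {w δ : Fin k → ℝ} {C : Fin k → Matrix (Fin p) (Fin p) ℝ}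
  {m : Fin k → EuclideanSpace ℝ (Fin p)}

theorem sum_smul_add_outer (w δ : Fin k → ℝ) (C : Fin k → Matrix (Fin p) (Fin p) ℝ)
    (m : Fin k → EuclideanSpace ℝ (Fin p)) : ∑ l, (w l / (1 + δ l)) • (C l + outer (m l)) =
      ∑ l, (w l / (1 + δ l)) • C l + ∑ l, (w l / (1 + δ l)) • outer (m l) := by
  simp only [smul_add, Finset.sum_add_distrib]

theorem QTilde_sub_add_outer (hw : ∀ l, 0 ≤ w l) (hC : ∀ l, (C l).PosSemidef)
    (hδ : ∀ l, 0 ≤ δ l) (hz : 0 < z) (m : Fin k → EuclideanSpace ℝ (Fin p)) :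
    (QTilde w C z δ - QTilde w (fun l => C l + outer (m l)) z δ).PosSemidef ∧
    (QTilde w C z δ - QTilde w (fun l => C l + outer (m l)) z δ).trace ≤ k / z := by
  have h := resolventAt_sub_add_sum_outer Finset.univ (sum_smul_posSemidef hw hC hδ) hz
    (fun l => w l / (1 + δ l)) (fun l => by have := hw l; have := hδ l; positivity) m
  rw [QTilde, QTilde, sum_smul_add_outer]
  simpa using h.2

/-- The term `mₗmₗᵀ` already belongs to `Q̃_δ`. Splitting it off by Sherman–Morrison gives `wΔ/(1 +
wΔ/(1+δ))`, bounded by `1 + δ` for any `mₗ`. Only the product with the proportion `w` is controlled,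
so stability is needed in a norm weighted by proportions. -/
theorem mul_bilin_QTilde_add_outer_le (hw : ∀ l, 0 ≤ w l) (hC : ∀ l, (C l).PosSemidef)
    (hδ : ∀ l, 0 ≤ δ l) (hz : 0 < z) (m : Fin k → EuclideanSpace ℝ (Fin p)) (l : Fin k) :
    w l * bilin (QTilde w (fun l => C l + outer (m l)) z δ) (m l) (m l) ≤ 1 + δ l := by
  have ht : ∀ l, 0 ≤ w l / (1 + δ l) := fun l => by
    have := hw l; have := hδ l; positivity
  have hA := (resolventAt_sub_add_sum_outer (Finset.univ.erase l)
    (sum_smul_posSemidef hw hC hδ) hz (fun l => w l / (1 + δ l)) ht m).1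
  set A := ∑ l, (w l / (1 + δ l)) • C l +
    ∑ i ∈ Finset.univ.erase l, (w i / (1 + δ i)) • outer (m i) with hAdef
  have e : QTilde w (fun l => C l + outer (m l)) z δ =
      resolventAt (A + (w l / (1 + δ l)) • outer (m l)) z := by
    rw [QTilde, sum_smul_add_outer, hAdef, add_assoc,
      Finset.sum_erase_add _ _ (Finset.mem_univ l)]
  have hΔ := bilin_resolventAt_nonneg hA hz (m l)
  have h1 : bilin (QTilde w (fun l => C l + outer (m l)) z δ) (m l) (m l) =
      (1 + w l / (1 + δ l) * bilin (resolventAt A z) (m l) (m l))⁻¹ *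
        bilin (resolventAt A z) (m l) (m l) := by
    rw [e, bilin, resolventAt_add_outer_mulVec hA hz (ht l), dotProduct_smul, smul_eq_mul]
    rfl
  have hd : 0 < 1 + δ l := by have := hδ l; positivity
  have htl := ht l
  have hpos : 0 < 1 + w l / (1 + δ l) * bilin (resolventAt A z) (m l) (m l) := by positivity
  rw [h1]
  set Δ := bilin (resolventAt A z) (m l) (m l)
  rw [show w l * ((1 + w l / (1 + δ l) * Δ)⁻¹ * Δ) =
    w l * Δ / (1 + w l / (1 + δ l) * Δ) by ring, div_le_iff₀ hpos]
  have : (1 + δ l) * (1 + w l / (1 + δ l) * Δ) = 1 + δ l + w l * Δ := by field_simp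
  rw [this]
  linarith

/-- The solution of the fixed point system nearly solves the centred system. -/
theorem SolvesFixedPoint.centred_bounds (hw : ∀ l, 0 ≤ w l) (hw1 : ∑ l, w l = 1)
    (hC : ∀ l, (C l).PosSemidef) (hz : 0 < z) {a c d : ℝ} (ha : 1 / z ≤ a)
    (hc : ∀ l, ‖C l‖ ≤ c) (hn : 0 < n)
    (hδ : SolvesFixedPoint n w (fun l => C l + outer (m l)) z δ) (hd : ∀ l, δ l ≤ d) :
    (∀ l, fpMap n w C z δ l ≤ δ l + c * (k * a) / n) ∧
    ∑ l, w l * |δ l - fpMap n w C z δ l| ≤ (k * (1 + d) + c * (k * a)) / n := by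
  have hn' : (0 : ℝ) < n := by exact_mod_cast hn
  obtain ⟨hD, hDt⟩ := QTilde_sub_add_outer hw hC hδ.1 hz m
  have hS : ∀ l, (C l + outer (m l)).PosSemidef := fun l => (hC l).add (outer_posSemidef (m l))
  set Q := QTilde w (fun l => C l + outer (m l)) z δ with hQ
  set Q₀ := QTilde w C z δ with hQ₀
  have ha0 : 0 < a := (by positivity : 0 < 1 / z).trans_le ha
  have hCD : ∀ l, |(C l * (Q₀ - Q)).trace| ≤ c * (k * a) := fun l => by
    have hc0 : 0 ≤ c := (norm_nonneg _).trans (hc l)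
    have := hD.trace_nonneg
    refine (abs_trace_mul_le _ hD).trans ?_
    gcongr
    · exact hc l
    · refine hDt.trans ?_
      rw [div_eq_mul_one_div]
      gcongr
  -- The residual is the contribution of the mean, nonnegative and controlled after weighting, minus
  -- the effect of a rank `k` change of `Q̃`.
  have he : ∀ l, δ l - fpMap n w C z δ l =
      1 / (n : ℝ) * bilin Q (m l) (m l) - 1 / (n : ℝ) * (C l * (Q₀ - Q)).trace := fun l => by
    have h1 := hδ.2 l
    rw [← hQ] at h1
    have h2 : (outer (m l) * Q).trace = bilin Q (m l) (m l) := by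
      rw [trace_mul_comm, trace_mul_outer]
    rw [h1, fpMap, ← hQ₀]
    simp only [Matrix.add_mul, Matrix.mul_sub, trace_add, trace_sub, h2]
    ring
  have hb : ∀ l, 0 ≤ bilin Q (m l) (m l) := fun l =>
    bilin_self_nonneg (QTilde_posSemidef hw hS hδ.1 hz) _
  constructor
  · intro l
    have h1 : 1 / (n : ℝ) * (C l * (Q₀ - Q)).trace ≤ c * (k * a) / n := by
      rw [one_div_mul_eq_div]
      gcongr
      exact (le_abs_self _).trans (hCD l)
    have h2 : 0 ≤ 1 / (n : ℝ) * bilin Q (m l) (m l) := mul_nonneg (by positivity) (hb l)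
    linarith [he l]
  · have hl : ∀ l, w l * |δ l - fpMap n w C z δ l| ≤
        (1 + d) / n + w l * (c * (k * a) / n) := fun l => by
      have h1 := mul_bilin_QTilde_add_outer_le hw hC hδ.1 hz m l
      rw [← hQ] at h1
      have h2 := hd l
      have h3 := hw l
      have h5 := hb l
      have h4 : |δ l - fpMap n w C z δ l| ≤ 1 / (n : ℝ) * bilin Q (m l) (m l) +
          c * (k * a) / n := by
        rw [he]
        refine (abs_sub _ _).trans ?_
        rw [abs_of_nonneg (by positivity), abs_mul, abs_of_pos (by positivity : 0 < 1 / (n : ℝ))]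
        gcongr
        rw [one_div_mul_eq_div]
        gcongr
        exact hCD l
      calc _ ≤ w l * (1 / (n : ℝ) * bilin Q (m l) (m l) + c * (k * a) / n) := by gcongr
        _ = w l * bilin Q (m l) (m l) / n + w l * (c * (k * a) / n) := by ring
        _ ≤ _ := by
            gcongr
            linarith
    refine (Finset.sum_le_sum fun l _ => hl l).trans_eq ?_
    rw [Finset.sum_add_distrib, ← Finset.sum_mul, hw1, Finset.sum_const, Finset.card_univ,
      Fintype.card_fin, nsmul_eq_mul]
    ring

set_option maxHeartbeats 800000 in
/-- Quantitative deterministic equivalent for the mean of the trace of the resolvent. -/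
theorem exists_abs_integral_trace_sub_QTilde_le {q C₀ c₀ z₀ : ℝ} (hq : 0 < q) (hc₀ : 0 < c₀)
    (hC₀ : 0 ≤ C₀) (hz₀ : 0 < z₀) (M Γ : ℝ) (K : ℕ) :
    ∃ (A : ℝ) (N : ℕ), 0 ≤ A ∧ ∀ (p n k : ℕ), 0 < p → 0 < n → N ≤ n → k ≤ K → (p : ℝ) ≤ Γ * n →
      ∀ (μ : Fin k → Measure (EuclideanSpace ℝ (Fin p))) [∀ l, IsProbabilityMeasure (μ l)],
      (∀ l, ConvexlyConcentrated (μ l) (fun y => y) fun t => C₀ * Real.exp (-(t ^ q / c₀))) →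
      (∀ l, ‖∫ y, y ∂(μ l)‖ ≤ M * √p) →
      ∀ (κ : Fin n → Fin k) (z : ℝ), z₀ ≤ z → ∀ δ : Fin k → ℝ,
      SolvesFixedPoint n (proportion κ) (fun l => populationCov (μ l)) z δ →
      |∫ x, (resolventAt (gram x) z).trace ∂(Measure.pi fun i => μ (κ i)) -
        (QTilde (proportion κ) (fun l => populationCov (μ l)) z δ).trace| ≤ A * (p / √n) := by
  set c := (momentBound q C₀ c₀ 2).toReal with hc
  have hc0 : 0 ≤ c := ENNReal.toReal_nonneg
  set B₂ := c + M ^ 2 with hB₂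
  have hB₂0 : 0 ≤ B₂ := by positivity
  set B₄ := 16 * ((momentBound q C₀ c₀ 4).toReal + 1) + 32 * (B₂ + 1) ^ 2 with hB₄
  have hB₄0 : 0 ≤ B₄ := by
    have : 0 ≤ (momentBound q C₀ c₀ 4).toReal := ENNReal.toReal_nonneg
    positivity
  set a := 1 / z₀ with ha
  have ha0 : 0 < a := by positivity
  set V := 3 * (((momentBound q C₀ c₀ 4).toReal + 4 * B₄) * a ^ 2 * |Γ| + 2 * (c * a) ^ 2) with hV
  have hV0 : 0 ≤ V := by
    have : 0 ≤ (momentBound q C₀ c₀ 4).toReal := ENNReal.toReal_nonneg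
    positivity
  set e := c * a ^ 2 * (c + (B₄ + V) * |Γ|) with he
  have he0 : 0 ≤ e := by positivity
  set E := K * (1 + B₂ * |Γ| * a) + c * (K * a) with hE
  have hE0 : 0 ≤ E := by positivity
  set A₁ := B₂ ^ 2 * a ^ 3 + a ^ 2 * (B₄ + (B₄ + B₂ ^ 2) * a ^ 2) with hA₁
  have hA₁0 : 0 ≤ A₁ := by positivity
  set A₂ := 3 * (K * a) + a ^ 2 * (c + (B₄ + V)) + c * a ^ 2 * (2 * (c * |Γ| * a) + 1) * (e + E)
    with hA₂
  have hA₂0 : 0 ≤ A₂ := by positivity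
  -- `A₁` serves `p ≤ √n` and `A₂` serves `p ≥ √n`. The threshold ensures `2e ≤ √n` and `c·K·a/n ≤
  -- 1/2`, the two smallness conditions of the stability argument.
  refine ⟨A₁ + A₂, ⌈(2 * e) ^ 2 + 2 * (c * (K * a))⌉₊, by positivity, ?_⟩
  intro p n k hp hn hN hkK hΓ μ _ hμ hM κ z hz δ hδ
  have hp' : (0 : ℝ) < p := by exact_mod_cast hp
  have hn' : (0 : ℝ) < n := by exact_mod_cast hn
  have hn1 : (1 : ℝ) ≤ n := by exact_mod_cast hn
  have hs : 0 < √(n : ℝ) := Real.sqrt_pos.mpr hn'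
  have hs1 : 1 ≤ √(n : ℝ) := Real.one_le_sqrt.mpr hn1
  have hsq : √(n : ℝ) * √n = n := Real.mul_self_sqrt hn'.le
  have hkK' : (k : ℝ) ≤ K := by exact_mod_cast hkK
  have hz0 : 0 < z := hz₀.trans_le hz
  have haz : 1 / z ≤ a := one_div_le_one_div_of_le hz₀ hz
  have hΓ' : (p : ℝ) ≤ |Γ| * n := hΓ.trans (by gcongr; exact le_abs_self Γ)
  have h4 := fun l => (hμ l).memLp_four hq hc₀ hC₀
  have h2 := fun l => memLp_two_of_memLp_four (h4 l)
  have hsqμ : ∀ l, ∫ y, ‖y‖ ^ 2 ∂(μ l) ≤ B₂ * p := fun l => (hμ l).integral_norm_sq_le hq hc₀ hC₀ (hM l)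
  have h4μ : ∀ l, ∫ y, ‖y‖ ^ 4 ∂(μ l) ≤ B₄ * p ^ 2 := fun l =>
    (hμ l).integral_norm_pow_four_le hq hc₀ hC₀ hB₂0 (hsqμ l) hp
  -- Centring costs `O(1)` in the unnormalised trace, which is within `O(p/√n)` only when `p ≥ √n`.
  rcases le_total (p : ℝ) (√n) with hpn | hpn
  · refine (abs_integral_trace_sub_le_of_le_sqrt hz0 haz hp hn hpn κ h4 hsqμ h4μ hδ).trans ?_
    exact mul_le_mul_of_nonneg_right (by linarith) (by positivity)
  · set m := fun l => ∫ y, y ∂(μ l) with hm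
    set μ₀ : Fin k → Measure (EuclideanSpace ℝ (Fin p)) := fun l => (μ l).map fun y => y - m l
      with hμ₀
    have hprob : ∀ l, IsProbabilityMeasure (μ₀ l) := fun l =>
      Measure.isProbabilityMeasure_map (by fun_prop)
    have hμ₀c := fun l => (hμ l).map_sub (m l)
    have hmean : ∀ l, ∫ y, y ∂(μ₀ l) = 0 := fun l => integral_map_sub_mean (h2 l)
    have h2₀ : ∀ l, MemLp (fun y => y) 2 (μ₀ l) := fun l => memLp_map_sub (h2 l) (m l)
    have hM₀ : ∀ l, ‖∫ y, y ∂(μ₀ l)‖ ≤ M * √p := fun l => by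
      rw [hmean, norm_zero]
      exact (norm_nonneg _).trans (hM l)
    have hsq₀ : ∀ l, ∫ y, ‖y‖ ^ 2 ∂(μ₀ l) ≤ B₂ * p := fun l =>
      ConvexlyConcentrated.integral_norm_sq_le hq hc₀ hC₀ (hμ₀c l) (hM₀ l)
    have h4₀ : ∀ l, ∫ y, ‖y‖ ^ 4 ∂(μ₀ l) ≤ B₄ * p ^ 2 := fun l =>
      ConvexlyConcentrated.integral_norm_pow_four_le hq hc₀ hC₀ (hμ₀c l) hB₂0 (hsq₀ l) hp
    have hcov : ∀ l, populationCov (μ l) = populationCov (μ₀ l) + outer (m l) := fun l =>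
      populationCov_eq_add_outer (h2 l)
    have hCn : ∀ l, ‖populationCov (μ₀ l)‖ ≤ c := fun l =>
      ConvexlyConcentrated.norm_populationCov_le hq hc₀ hC₀ (hμ₀c l) (hmean l)
    have hC := fun l => populationCov_posSemidef (h2₀ l)
    have hS := fun l => populationCov_posSemidef (h2 l)
    have hδd : ∀ l, δ l ≤ B₂ * |Γ| * a := fun l => by
      rw [hδ.2 l]
      refine (fpMap_le (proportion_nonneg κ) hS hδ.1 hz0 l).trans ?_
      rw [div_eq_mul_one_div (trace _), trace_populationCov (h2 l)]
      calc _ ≤ 1 / (n : ℝ) * (B₂ * (|Γ| * n) * a) := by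
            gcongr
            exact (hsqμ l).trans (by gcongr)
        _ = _ := by field_simp
    simp only [hcov] at hδ ⊢
    obtain ⟨hb1, hb2⟩ := hδ.centred_bounds (proportion_nonneg κ) (sum_proportion hn κ) hC hz0 haz
      hCn hn hδd
    have hNr : (2 * e) ^ 2 + 2 * (c * (K * a)) ≤ n := Nat.ceil_le.mp hN
    have happ := abs_integral_trace_sub_QTilde_le_of_approx hq hc₀ hC₀ hμ₀c (E := E) h4₀ hp hn hz0
      haz hΓ' κ hCn le_rfl ?_ hδ.1 (fun l => (hb1 l).trans ?_) (hb2.trans ?_)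
    · have hcent : |∫ x, (resolventAt (gram x) z).trace ∂(Measure.pi fun i => μ (κ i)) -
          ∫ x, (resolventAt (gram x) z).trace ∂(Measure.pi fun i => μ₀ (κ i))| ≤
          2 * (K * a) := by
        have hmp : MeasurePreserving (fun (x : Fin n → EuclideanSpace ℝ (Fin p)) i => x i - m (κ i))
          (Measure.pi fun i => μ (κ i)) (Measure.pi fun i => μ₀ (κ i)) :=
          measurePreserving_sub_pi κ m
        have hi := fun (P : Measure (Fin n → EuclideanSpace ℝ (Fin p))) [IsFiniteMeasure P] =>
          integrable_trace_mul_resolventAt hz0 P 1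
        simp only [Matrix.one_mul] at hi
        have h1 := hi (Measure.pi fun i => μ (κ i))
        have h3 := hi (Measure.pi fun i => μ₀ (κ i))
        have h5 : Integrable (fun x => (resolventAt (gram fun i => x i - m (κ i)) z).trace)
          (Measure.pi fun i => μ (κ i)) := hmp.integrable_comp_of_integrable h3
        have h6 : ∫ x, (resolventAt (gram x) z).trace ∂(Measure.pi fun i => μ₀ (κ i)) =
            ∫ x, (resolventAt (gram fun i => x i - m (κ i)) z).trace
              ∂(Measure.pi fun i => μ (κ i)) := by
          rw [← hmp.map_eq, integral_map hmp.measurable.aemeasurable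
            (hmp.map_eq.symm ▸ h3.1)]
        rw [h6, ← integral_sub h1 h5]
        have hle := norm_integral_le_of_norm_le_const (μ := Measure.pi fun i => μ (κ i))
          (f := fun x => (resolventAt (gram x) z).trace -
            (resolventAt (gram fun i => x i - m (κ i)) z).trace) (C := 2 * (K * a))
          (Filter.Eventually.of_forall fun x => ?_)
        · rwa [probReal_univ, mul_one] at hle
        refine (abs_trace_resolventAt_gram_sub_centred_le hz0 κ m x).trans ?_
        rw [div_eq_mul_one_div]
        gcongr
      have hlast : |(QTilde (proportion κ) (fun l => populationCov (μ₀ l)) z δ).trace -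
          (QTilde (proportion κ) (fun l => populationCov (μ₀ l) + outer (m l)) z δ).trace| ≤
          K * a := by
        obtain ⟨hD, hDt⟩ := QTilde_sub_add_outer (proportion_nonneg κ) hC hδ.1 hz0 m
        rw [← trace_sub, abs_of_nonneg hD.trace_nonneg]
        refine hDt.trans ?_
        rw [div_eq_mul_one_div]
        gcongr
      have hpn1 : 1 ≤ (p : ℝ) / √n := by rwa [le_div_iff₀ hs, one_mul]
      set r := (p : ℝ) / √n
      -- Chain: centre the samples (`2Ka`), compare with the centred equivalent at the original
      -- solution, then restore the means in `Q̃` (`Ka`). Constants are absorbed by `r ≥ 1`.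
      calc _ ≤ 2 * (K * a) + (a ^ 2 * (c + (B₄ + V) * r) +
            c * a ^ 2 * (2 * (c * |Γ| * a) + 1) * (e + E) * r) + K * a := by
            refine (abs_sub_le _ _ _).trans (add_le_add ((abs_sub_le _ _ _).trans
              (add_le_add hcent happ)) hlast)
        _ ≤ 3 * (K * a) * r + (a ^ 2 * (c * r + (B₄ + V) * r) +
            c * a ^ 2 * (2 * (c * |Γ| * a) + 1) * (e + E) * r) := by
            have h1 : 3 * (K * a) ≤ 3 * (K * a) * r := le_mul_of_one_le_right (by positivity) hpn1
            have h3 : a ^ 2 * (c + (B₄ + V) * r) ≤ a ^ 2 * (c * r + (B₄ + V) * r) := by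
              gcongr
              exact le_mul_of_one_le_right hc0 hpn1
            linarith
        _ = A₂ * r := by rw [hA₂]; ring
        _ ≤ _ := mul_le_mul_of_nonneg_right (by linarith) (by linarith)
    · refine Real.le_sqrt_of_sq_le ?_
      refine le_trans ?_ hNr
      have : 0 ≤ c * (K * a) := by positivity
      linarith
    · have h1 : c * (k * a) ≤ c * (K * a) := by gcongr
      have h3 : c * (k * a) / n ≤ 1 / 2 := by
        rw [div_le_iff₀ hn']
        linarith [sq_nonneg (2 * e)]
      linarith
    · have h3 : √(n : ℝ) ≤ n := (le_mul_of_one_le_right hs.le hs1).trans_eq hsq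
      have h5 : k * (1 + B₂ * |Γ| * a) + c * (k * a) ≤ E := by
        rw [hE]
        gcongr
      exact (div_le_div_of_nonneg_right h5 hn'.le).trans (div_le_div_of_nonneg_left hE0 hs h3)

end Centring

/-! ### From mean and fluctuations to concentration around the equivalent -/

section Assembly

variable {p n k : ℕ}

theorem ClassSizeBound.norm_mean_le {q M : ℝ} {μ : Fin k → Measure (EuclideanSpace ℝ (Fin p))}
    (h : ClassSizeBound q M μ) (hp : 0 < p) (l : Fin k) : ‖∫ y, y ∂(μ l)‖ ≤ M * √p := by
  have hs : 0 < √(p : ℝ) := Real.sqrt_pos.mpr (by exact_mod_cast hp)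
  rcases h with h | ⟨-, h⟩
  · exact (norm_integral_le_integral_norm _).trans ((div_le_iff₀ hs).mp (h l))
  · exact (div_le_iff₀ hs).mp (h l)

theorem populationCov_eq_centredCov_add_outer {μ : Measure (EuclideanSpace ℝ (Fin p))}
    [IsProbabilityMeasure μ] (hμ : MemLp (fun y => y) 2 μ) :
    populationCov μ = centredCov μ + outer (∫ y, y ∂μ) := by
  have hc : ∀ i, MemLp (fun y : EuclideanSpace ℝ (Fin p) => y i) 2 μ := fun i =>
    (EuclideanSpace.proj (𝕜 := ℝ) i).comp_memLp' hμ
  have hm : ∀ i, ∫ y, y i ∂μ = (∫ y, y ∂μ) i := fun i =>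
    (EuclideanSpace.proj (𝕜 := ℝ) i).integral_comp_comm (hμ.integrable one_le_two)
  ext i j
  simp only [populationCov, centredCov, outer, Matrix.add_apply, Matrix.of_apply,
    Matrix.vecMulVec_apply]
  rw [covariance_eq_sub (hc i) (hc j), hm i, hm j, sub_add_cancel]
  rfl

/-- The Stieltjes transform at `-z` concentrates around the one of the deterministic
equivalent. -/
theorem exists_concentratedAround_trace {q C₀ c₀ z₀ : ℝ} (hq : 0 < q) (hc₀ : 0 < c₀)
    (hC₀ : 0 ≤ C₀) (hz₀ : 0 < z₀) (M Γ : ℝ) (K : ℕ) :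
    ∃ (C c : ℝ) (N : ℕ), Real.exp 1 ≤ C ∧ 0 < c ∧ ∀ (p n k : ℕ), 0 < p → 0 < n → N ≤ n → k ≤ K →
      (p : ℝ) ≤ Γ * n →
      ∀ (μ : Fin k → Measure (EuclideanSpace ℝ (Fin p))) [∀ l, IsProbabilityMeasure (μ l)],
      ClassConcentration q C₀ c₀ μ → (∀ l, ‖∫ y, y ∂(μ l)‖ ≤ M * √p) →
      ∀ (κ : Fin n → Fin k) (z : ℝ), z₀ ≤ z → ∀ δ : Fin k → ℝ,
      SolvesFixedPoint n (proportion κ) (fun l => populationCov (μ l)) z δ →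
      ConcentratedAround (Measure.pi fun i => μ (κ i))
        (fun x => 1 / (p : ℝ) * (resolventAt (gram x) z).trace)
        (1 / (p : ℝ) * (QTilde (proportion κ) (fun l => populationCov (μ l)) z δ).trace)
        fun t => C * Real.exp (-((√n * t) ^ q / c)) := by
  obtain ⟨A, N, hA, hmean⟩ := exists_abs_integral_trace_sub_QTilde_le hq hc₀ hC₀ hz₀ M Γ K
  -- `K + 1` in place of `K` keeps the constant positive when `K = 0`.
  set c₁ := c₀ * (4 * (K + 1 : ℕ) * (2 / √z₀ ^ 3)) ^ q with hc₁
  have hs₀ : 0 < √z₀ := Real.sqrt_pos.mpr hz₀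
  have hc₁0 : 0 < c₁ := by positivity
  set C₁ := 2 * (K + 1 : ℕ) * C₀ with hC₁
  have hC₁0 : 0 ≤ C₁ := by positivity
  set V := (momentBound q C₁ c₁ 2).toReal with hV
  have hV0 : 0 ≤ V := ENNReal.toReal_nonneg
  -- `V/n` bounds the variance and `A²/n` the squared bias, so `s²/n` dominates the second moment
  -- around the equivalent; the `1` makes `s` positive.
  set s := √(V + A ^ 2 + 1) with hs
  have hs0 : 0 < s := Real.sqrt_pos.mpr (by positivity)
  have hs2 : s ^ 2 = V + A ^ 2 + 1 := Real.sq_sqrt (by positivity)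
  have hexp := Real.exp_pos ((4 * s) ^ q / (c₁ * 2 ^ q))
  refine ⟨Real.exp 1 + 2 * C₁ + Real.exp ((4 * s) ^ q / (c₁ * 2 ^ q)), c₁ * 2 ^ q, N,
    by linarith, by positivity, ?_⟩
  intro p n k hp hn hN hkK hΓ μ _ hμ hM κ z hz δ hδ
  have hp' : (0 : ℝ) < p := by exact_mod_cast hp
  have hn' : (0 : ℝ) < n := by exact_mod_cast hn
  have hsn : 0 < √(n : ℝ) := Real.sqrt_pos.mpr hn'
  have hsq : √(n : ℝ) ^ 2 = n := Real.sq_sqrt hn'.le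
  have hz0 : 0 < z := hz₀.trans_le hz
  have hk : 0 < k := (κ ⟨0, hn⟩).pos
  set P := Measure.pi fun i => μ (κ i) with hP
  set F := fun x : Fin n → EuclideanSpace ℝ (Fin p) =>
    1 / (p : ℝ) * (resolventAt (gram x) z).trace with hF
  set a := 1 / (p : ℝ) * (QTilde (proportion κ) (fun l => populationCov (μ l)) z δ).trace with ha
  have hconc : SelfConcentrated P F fun t => C₁ * Real.exp (-((√n * t) ^ q / c₁)) :=
    hμ.selfConcentrated_trace hq hc₀ hC₀ hz₀ hz κ hk (hkK.trans (Nat.le_succ K)) hp hn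
  have hFc : Continuous F := by
    have := continuous_resolventAt_gram (p := p) (n := n) hz0
    fun_prop
  have hFsq : ∀ d, Integrable (fun x => (F x - d) ^ 2) P := fun d => by
    have := integrable_trace_mul_resolventAt_sub_sq hz0 P (1 : Matrix (Fin p) (Fin p) ℝ)
      (1 / (p : ℝ)) d
    simpa only [Matrix.one_mul] using this
  have hFi : Integrable F P := by
    have := integrable_trace_mul_resolventAt hz0 P (1 : Matrix (Fin p) (Fin p) ℝ)
    simp only [Matrix.one_mul] at this
    exact this.const_mul _
  have hFL : MemLp F 2 P := by
    rw [memLp_two_iff_integrable_sq hFc.aestronglyMeasurable]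
    simpa using hFsq 0
  have hbias : |∫ x, F x ∂P - a| ≤ A / √n := by
    have h1 := hmean p n k hp hn hN hkK hΓ μ (fun l => hμ.convexlyConcentrated l) hM κ z hz δ hδ
    rw [hF, ha, integral_const_mul, ← mul_sub, abs_mul, abs_of_pos (by positivity)]
    calc _ ≤ 1 / (p : ℝ) * (A * (p / √n)) := by gcongr
      _ = _ := by field_simp
  -- After scaling by `√n` the concentration function no longer depends on `n`, so neither does the
  -- moment bound `V`.
  have hvar : ∫ x, (F x - ∫ y, F y ∂P) ^ 2 ∂P ≤ V / n := by
    have hsc : SelfConcentrated P (fun x => √n * F x) fun t => C₁ * Real.exp (-(t ^ q / c₁)) := by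
      intro t ht
      have h1 := hconc (t / √n) (by positivity)
      beta_reduce at h1
      rw [mul_div_cancel₀ _ hsn.ne'] at h1
      refine (measure_mono fun w hw => ?_).trans h1
      have hw' : t ≤ |√n * F w.1 - √n * F w.2| := hw
      rw [← mul_sub, abs_mul, abs_of_pos hsn] at hw'
      change t / √n ≤ |F w.1 - F w.2|
      rwa [div_le_iff₀' hsn]
    have h2 := (hsc.integral_pow_le (by fun_prop) hq hc₁0 hC₁0 (r := 2) (by norm_num)).2
    have h3 := integral_prod_sub_sq hFL
    have e : ∀ w : (Fin n → EuclideanSpace ℝ (Fin p)) × (Fin n → EuclideanSpace ℝ (Fin p)),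
        |√n * F w.1 - √n * F w.2| ^ 2 = n * (F w.1 - F w.2) ^ 2 := fun w => by
      rw [sq_abs, ← mul_sub, mul_pow, hsq]
    simp only [e] at h2
    rw [integral_const_mul, h3, ← hV] at h2
    rw [le_div_iff₀ hn']
    have h0 : 0 ≤ ∫ x, (F x - ∫ y, F y ∂P) ^ 2 ∂P := integral_nonneg fun x => sq_nonneg _
    nlinarith [mul_nonneg hn'.le h0]
  refine hconc.concentratedAround (s := s) hFc.measurable hq hc₁0 hs0 hsn (hFsq a) ?_
    (by linarith [Real.exp_pos 1]) (by linarith [Real.exp_pos 1])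
  set e := ∫ y, F y ∂P with he
  have hdec : ∫ x, (F x - a) ^ 2 ∂P = ∫ x, (F x - e) ^ 2 ∂P + (e - a) ^ 2 := by
    have h1 : ∀ x, (F x - a) ^ 2 = (F x - e) ^ 2 + 2 * (e - a) * (F x - e) + (e - a) ^ 2 :=
      fun x => by ring
    simp only [h1]
    have hI1 : Integrable (fun x => F x - e) P := hFi.sub (integrable_const e)
    have hI2 : Integrable (fun x => (F x - e) ^ 2 + 2 * (e - a) * (F x - e)) P :=
      (hFsq e).add (hI1.const_mul _)
    rw [integral_add hI2 (integrable_const _), integral_add (hFsq e) (hI1.const_mul _),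
      integral_const_mul, integral_sub hFi (integrable_const e), integral_const, integral_const,
      probReal_univ, one_smul, one_smul, ← he]
    ring
  have hb2 : (e - a) ^ 2 ≤ A ^ 2 / n := by
    rw [← sq_abs]
    calc _ ≤ (A / √n) ^ 2 := by gcongr
      _ = _ := by rw [div_pow, hsq]
  rw [hdec, hs2, hsq]
  calc _ ≤ V / n + A ^ 2 / n := add_le_add hvar hb2
    _ = (V + A ^ 2) / n := by ring
    _ ≤ _ := div_le_div_of_nonneg_right (by linarith) hn'.le

end Assembly

end ConcentratedCovariance

theorem mainTheorem2 (q C₀ c₀ M Γ z₀ : ℝ) (K : ℕ) (hq : 0 < q)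
    (hC₀ : Real.exp 1 ≤ C₀) (hc₀ : 0 < c₀) (hz₀ : 0 < z₀) :
    ∃ (C c : ℝ) (N : ℕ), Real.exp 1 ≤ C ∧ 0 < c ∧
      ∀ (p n k : ℕ), 0 < p → 0 < n → N ≤ n → k ≤ K → (p : ℝ) / n + 1 ≤ Γ →
      ∀ (μ : Fin k → Measure (EuclideanSpace ℝ (Fin p))) [∀ l, IsProbabilityMeasure (μ l)],
        ClassConcentration q C₀ c₀ μ → ClassSizeBound q M μ →
      ∀ (κ : Fin n → Fin k) (z : ℝ), z₀ ≤ z →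
        ∃ δ' : Fin k → ℝ,
          -- `δ'` is the unique nonnegative solution of the fixed point system
          SolvesFixedPoint n (proportion κ) (fun l => populationCov (μ l)) z δ' ∧
          (∀ ε : Fin k → ℝ,
            SolvesFixedPoint n (proportion κ) (fun l => populationCov (μ l)) z ε → ε = δ') ∧
          -- concentration of the Stieltjes transform of the spectral distribution
          (∀ {Ω : Type*} [MeasurableSpace Ω] (P : Measure Ω) [IsProbabilityMeasure P]
              (x : Fin n → Ω → EuclideanSpace ℝ (Fin p)),
              (∀ i, HasLaw (x i) (μ (κ i)) P) → iIndepFun x P →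
              (∀ ω, stieltjes
                  (spectralDistribution (sampleCov_isHermitian (ofColumns fun i => x i ω))) (-z)
                = 1 / (p : ℝ) *
                  (resolventAt (sampleCov (ofColumns fun i => x i ω)) z).trace) ∧
              ConcentratedAround P
                (fun ω => stieltjes
                  (spectralDistribution (sampleCov_isHermitian (ofColumns fun i => x i ω))) (-z))
                (1 / (p : ℝ) *
                  (QTilde (proportion κ) (fun l => populationCov (μ l)) z δ').trace)
                (fun t => C * Real.exp (-((Real.sqrt n * t) ^ q / c)))) ∧
          -- the deterministic equivalent depends on the laws and on the labels only through
          -- the class means, the class covariances and the class proportions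
          (∀ (ν : Fin k → Measure (EuclideanSpace ℝ (Fin p)))
              [∀ l, IsProbabilityMeasure (ν l)] (κ' : Fin n → Fin k),
              ClassConcentration q C₀ c₀ ν → ClassSizeBound q M ν →
              (∀ l, ∫ y, y ∂(ν l) = ∫ y, y ∂(μ l)) →
              (∀ l, centredCov (ν l) = centredCov (μ l)) →
              (∀ l, proportion κ' l = proportion κ l) →
              ∀ ε : Fin k → ℝ,
                SolvesFixedPoint n (proportion κ') (fun l => populationCov (ν l)) z ε →
                QTilde (proportion κ') (fun l => populationCov (ν l)) z ε
                  = QTilde (proportion κ) (fun l => populationCov (μ l)) z δ') := by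

  have hC₀' : 0 ≤ C₀ := (Real.exp_pos 1).le.trans hC₀
  obtain ⟨C, c, N, hC, hc, hmain⟩ :=
    exists_concentratedAround_trace hq hc₀ hC₀' hz₀ M (Γ - 1) K
  refine ⟨C, c, N, hC, hc, ?_⟩
  intro p n k hp hn hN hkK hΓ μ _ hμ hM κ z hz
  have hn' : (0 : ℝ) < n := by exact_mod_cast hn
  have hz0 : 0 < z := hz₀.trans_le hz
  have hμ2 := fun l => (hμ.convexlyConcentrated l).memLp_two hq hc₀ hC₀'
  have hS := fun l => populationCov_posSemidef (hμ2 l)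
  obtain ⟨δ, hδ⟩ := exists_solvesFixedPoint n (proportion_nonneg κ) hS hz0
  have huniq : ∀ ε : Fin k → ℝ,
      SolvesFixedPoint n (proportion κ) (fun l => populationCov (μ l)) z ε → ε = δ :=
    fun ε hε => solvesFixedPoint_unique (proportion_nonneg κ) hS hz0 hε hδ
  refine ⟨δ, hδ, huniq, ?_, ?_⟩
  · intro Ω _ P _ x hx hind
    have hst : ∀ ω, stieltjes
        (spectralDistribution (sampleCov_isHermitian (ofColumns fun i => x i ω))) (-z) =
        1 / (p : ℝ) * (resolventAt (gram fun i => x i ω) z).trace := fun ω => by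
      rw [stieltjes_spectralDistribution (by
        rw [sampleCov_ofColumns]; exact gram_posSemidef _) hz0, sampleCov_ofColumns]
    refine ⟨fun ω => by rw [hst, sampleCov_ofColumns], fun t ht => ?_⟩
    have hmap := (iIndepFun_iff_map_fun_eq_pi_map fun i => (hx i).aemeasurable).mp hind
    simp only [fun i => (hx i).map_eq] at hmap
    have hΓ' : (p : ℝ) ≤ (Γ - 1) * n := by
      rw [← div_le_iff₀ hn']
      linarith
    have h := hmain p n k hp hn hN hkK hΓ' μ hμ (hM.norm_mean_le hp) κ z hz δ hδ t ht
    refine le_of_eq_of_le ?_ h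
    have hcont := continuous_resolventAt_gram (p := p) (n := n) hz0
    have hcont' : Continuous fun y : Fin n → EuclideanSpace ℝ (Fin p) =>
      |1 / (p : ℝ) * (resolventAt (gram y) z).trace - 1 / (p : ℝ) *
        (QTilde (proportion κ) (fun l => populationCov (μ l)) z δ).trace| := by fun_prop
    rw [← hmap, Measure.map_apply_of_aemeasurable
      (aemeasurable_pi_lambda _ fun i => (hx i).aemeasurable)
      (measurableSet_le measurable_const hcont'.measurable)]
    simp only [hst]
    rfl
  · intro ν _ κ' hν _ hmean hcov hprop ε hε
    have hν2 := fun l => (hν.convexlyConcentrated l).memLp_two hq hc₀ hC₀'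
    -- The non-centred covariance is the centred one plus the square of the mean. Both systems
    -- therefore coincide, and uniqueness identifies their solutions.
    have hpop : ∀ l, populationCov (ν l) = populationCov (μ l) := fun l => by
      rw [populationCov_eq_centredCov_add_outer (hν2 l),
        populationCov_eq_centredCov_add_outer (hμ2 l), hmean, hcov]
    have hprop' : proportion κ' = proportion κ := funext hprop
    simp only [hpop, hprop'] at hε ⊢
    rw [huniq ε hε]
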